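/- Let $l,b\ge 0$ be integers, $\nu=(\nu_1,\dots,\nu_k)$ a finite sequence of nonnegative integers with sum $|\nu|$, $W\subseteq\{1,\dots,k\}$ with complement $\overline W$, and $N=|\nu|+b$ (when $N$ is even, write $N=2n$; when $N$ is odd, everything below is trivial). **Multisets.** Let $\mathcal M_W(\nu;b)$ be the set of finite multisets $M$ on $\{1,\dots,k\}^2$ that are symmetric under $(i,j)\mapsto(j,i)$; are $(\overline W,\overline W)$-compatible, i.e. $(i,j)$ occurs at most once if exactly one of $i,j$ lies in $W$; have content $\nu$, i.e. $i$ occurs $\nu_i$ times as a first coordinate; and have $b$ fixed points, i.e. $\sum_i f_i(M)=b$, where $f_i(M)$ is the multiplicity of $(i,i)$ in $M$ if $i\in\overline W$, and that multiplicity modulo $2$ if $i\in W$. A $(W,W)$-decreasing sequence is a sequence of points $(x_r,y_r)$ with $x_r\le x_{r+1}$ and $y_r\ge y_{r+1}$, where $x_r=x_{r+1}$ is allowed only if $x_r\in W$ and $y_r=y_{r+1}$ only if $y_r\in W$. Let $\ell^-_{WW}(M)$ be the largest length of such a sequence using each point at most as often as it occurs in $M$. **Invariants.** Let $V=\mathbb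 C^{2l}$, let $J$ be the standard skew-symmetric $2l\times 2l$ matrix, let $Sp(2l)=\{A\in U(2l): AJA^{t}=J\}$, and let $F_N(Sp(2l))$ be the space of $Sp(2l)$-invariants in $V^{\otimes N}$. Permutations $\pi\in S_N$ act on $V^{\otimes N}$ by $T(\pi)(v_1\otimes\cdots\otimes v_N)=v_{\pi(1)}\otimes\cdots\otimes v_{\pi(N)}$. For $S\subseteq\{1,\dots,N\}$ let $E_S=\sum_\pi \operatorname{sgn}(\pi)T(\pi)$ and $H_S=\sum_\pi T(\pi)$, both sums over the permutations fixing every element outside $S$. Split $\{1,\dots,N\}$ into consecutive intervals $S_1,\dots,S_k,S_\infty$ of sizes $\nu_1,\dots,\nu_k,b$, and put $$\Pi^{Sp}(\nu;b)=\prod_{i\in W}E_{S_i}\prod_{i\in\overline W}H_{S_i}\cdot H_{S_\infty}.$$ For a fixed-point-free involution $\tau\in S_N$, let $T^{Sp}_l(\tau)\in V^{\otimes N}$ be the tensor product over all pairs $p<\tau(p)$ of the invariant tensor $\sum_{a,c}J_{ac}\,e_a\otimes e_c$ placed in positions $p,\tau(p)$. For $M\in\mathcal M_W(\nu;b)$,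 replace $f_i(M)$ of the copies of $(i,i)$ by as many copies of both $(i,\infty)$ and $(\infty,i)$, for every $i$, to obtain a multiset $M'$. There is a fixed-point-free involution $\tau\in S_N$ that represents $M$, in the sense that for all $x,y\in\{1,\dots,k,\infty\}$ the number of $p\in S_x$ with $\tau(p)\in S_y$ is the multiplicity of $(x,y)$ in $M'$. Choose one and set $T^{Sp}_l(M)=\Pi^{Sp}(\nu;b)\,T^{Sp}_l(\tau)$. **Theorem.** For every choice of the representatives $\tau$, the family $$\{T^{Sp}_l(M): M\in\mathcal M_W(\nu;b),\ \ell^-_{WW}(M)\le 2l\}$$ is a basis of $\Pi^{Sp}(\nu;b)\,F_{N}(Sp(2l))$. (For $b=0$ this is a basis of $\Pi(\nu)F_{2n}(Sp(2l))$, where $\Pi(\nu)=\Pi^{Sp}(\nu;0)$ and $2n=|\nu|$.) -/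

import Mathlib

namespace SympInv

open Finset

/-! ### Multisets of points and decreasing subsequences -/

section Multisets

variable {α β : Type*} [LinearOrder α] [LinearOrder β]

/-- `(W₁, W₂)`-compatible multisets: a point `(i, j)` for which exactly one of `i ∈ W₁`, `j ∈ W₂`
holds occurs at most once. -/
def Compatible (W₁ : Set α) (W₂ : Set β) (M : Multiset (α × β)) : Prop :=
  ∀ i j, ¬(i ∈ W₁ ↔ j ∈ W₂) → M.count (i, j) ≤ 1

/-- `(W₁, W₂)`-decreasing sequences: the first coordinate weakly increases, the second weakly
decreases, and consecutive equal first (second) coordinates must belong to `W₁` (to `W₂`). -/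
def IsDecreasing (W₁ : Set α) (W₂ : Set β) (L : List (α × β)) : Prop :=
  L.IsChain fun p q =>
    p.1 ≤ q.1 ∧ q.2 ≤ p.2 ∧ (p.1 = q.1 → p.1 ∈ W₁) ∧ (p.2 = q.2 → p.2 ∈ W₂)

/-- The length `ℓ⁻` of the longest `(W₁, W₂)`-decreasing subsequence of `M`; a point may be used
at most as often as it occurs in `M`. (The set is non-empty and bounded by the size of `M`.) -/
noncomputable def decLength (W₁ : Set α) (W₂ : Set β) (M : Multiset (α × β)) : ℕ :=
  sSup {n | ∃ L : List (α × β), IsDecreasing W₁ W₂ L ∧ (L : Multiset (α × β)) ≤ M ∧ L.length = n}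

end Multisets

variable {k : ℕ}

open Classical in
/-- The number of fixed points of `M` at `(i, i)`, relative to `W`: the multiplicity of `(i, i)`
if `i ∈ W`, and that multiplicity modulo `2` if `i ∉ W`. -/
noncomputable def fixedPointMult (W : Set (Fin k)) (M : Multiset (Fin k × Fin k)) (i : Fin k) : ℕ :=
  if i ∈ W then M.count (i, i) else M.count (i, i) % 2

/-- The symmetric `(W, W)`-compatible multisets with content `ν` and `b` fixed points. -/
def symmetricMultisets (W : Set (Fin k)) (ν : Fin k → ℕ) (b : ℕ) :
    Set (Multiset (Fin k × Fin k)) :=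
  {M | M.map Prod.swap = M ∧ Compatible W W M ∧
    (∀ i, (M.map Prod.fst).count i = ν i) ∧ ∑ i, fixedPointMult W M i = b}

/-- Each fixed point `(i, i)` of `M` is replaced by the two points `(i, ∞)` and `(∞, i)`. -/
noncomputable def withInfinity (W : Set (Fin k)) (M : Multiset (Fin k × Fin k)) :
    Multiset (WithTop (Fin k) × WithTop (Fin k)) :=
  (M - ∑ i, fixedPointMult W M i • {(i, i)}).map (fun x => ((x.1 : WithTop (Fin k)), (x.2 : WithTop (Fin k)))) +
    ∑ i : Fin k, fixedPointMult W M i •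
      ({((i : WithTop (Fin k)), ⊤), (⊤, (i : WithTop (Fin k)))} :
        Multiset (WithTop (Fin k) × WithTop (Fin k)))

/-- The partition of the `|ν| + b` tensor positions into consecutive intervals of sizes
`ν 0, ν 1, …` and (indexed by `∞ = ⊤`) a last one of size `b`. -/
def part (ν : Fin k → ℕ) (b : ℕ) : WithTop (Fin k) → Finset (Fin (∑ i, ν i + b))
  | ⊤ => {p | ∑ i, ν i ≤ (p : ℕ)}
  | (i : Fin k) => {p | ∑ j ∈ Iio i, ν j ≤ (p : ℕ) ∧ (p : ℕ) < ∑ j ∈ Iic i, ν j}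

/-- `τ` is a fixed-point-free involution of the tensor positions whose graph, after each position
is replaced by the (index of the) interval containing it, is the multiset `M'`. -/
def Represents (ν : Fin k → ℕ) (b : ℕ) (M' : Multiset (WithTop (Fin k) × WithTop (Fin k)))
    (τ : Equiv.Perm (Fin (∑ i, ν i + b))) : Prop :=
  (∀ p, τ (τ p) = p) ∧ (∀ p, τ p ≠ p) ∧
    ∀ x y, #{p | p ∈ part ν b x ∧ τ p ∈ part ν b y} = M'.count (x, y)

/-! ### Tensors and the symplectic group -/

/-- `V^{⊗ N}` for `V = ℂ^{2l}`. -/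
abbrev TensorSpace (l N : ℕ) : Type :=
  PiTensorProduct ℂ (fun _ : Fin N => (Fin l ⊕ Fin l → ℂ))

/-- The compact symplectic group `Sp(2l)`: the unitary matrices `A` with `A J Aᵀ = J`. -/
def compactSp (l : ℕ) : Submonoid (Matrix (Fin l ⊕ Fin l) (Fin l ⊕ Fin l) ℂ) :=
  Matrix.symplecticGroup (Fin l) ℂ ⊓ Matrix.unitaryGroup (Fin l ⊕ Fin l) ℂ

/-- The action of a matrix `A` on `V^{⊗ N}`, as `A ⊗ A ⊗ ⋯ ⊗ A`. -/
noncomputable def tensorAction (l N : ℕ) (A : Matrix (Fin l ⊕ Fin l) (Fin l ⊕ Fin l) ℂ) :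
    Module.End ℂ (TensorSpace l N) :=
  PiTensorProduct.map fun _ => Matrix.toLin' A

/-- `F_N(Sp(2l))`, the space of `Sp(2l)`-invariants in `V^{⊗ N}`. -/
noncomputable def invariants (l N : ℕ) : Submodule ℂ (TensorSpace l N) where
  carrier := {x | ∀ A ∈ compactSp l, tensorAction l N A x = x}
  add_mem' hx hy A hA := by rw [map_add, hx A hA, hy A hA]
  zero_mem' A _ := map_zero _
  smul_mem' c x hx A hA := by rw [map_smul, hx A hA]

/-- `T(π) (v₁ ⊗ ⋯ ⊗ v_N) = v_{π(1)} ⊗ ⋯ ⊗ v_{π(N)}`. -/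
noncomputable def permAction (l N : ℕ) (π : Equiv.Perm (Fin N)) :
    Module.End ℂ (TensorSpace l N) :=
  (PiTensorProduct.reindex ℂ (fun _ : Fin N => (Fin l ⊕ Fin l → ℂ)) π.symm).toLinearMap

theorem permAction_tprod (l N : ℕ) (π : Equiv.Perm (Fin N)) (v : Fin N → (Fin l ⊕ Fin l → ℂ)) :
    permAction l N π (PiTensorProduct.tprod ℂ v) = PiTensorProduct.tprod ℂ fun p => v (π p) :=
  PiTensorProduct.reindex_tprod _ _

/-- The action of `E_S`, the signed sum of the permutations fixing every position outside `S`. -/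
noncomputable def antisymmetrizer (l N : ℕ) (S : Finset (Fin N)) :
    Module.End ℂ (TensorSpace l N) :=
  ∑ π : Equiv.Perm (Fin N) with ∀ p ∉ S, π p = p,
    (((Equiv.Perm.sign π : ℤˣ) : ℤ) : ℂ) • permAction l N π

/-- The action of `H_S`, the sum of the permutations fixing every position outside `S`. -/
noncomputable def symmetrizer (l N : ℕ) (S : Finset (Fin N)) : Module.End ℂ (TensorSpace l N) :=
  ∑ π : Equiv.Perm (Fin N) with ∀ p ∉ S, π p = p, permAction l N π

open Classical in
/-- The action of `Π^Sp(ν; b)`: the product of `E_S` over the intervals `S` of `ν` with index in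
`W`, of `H_S` over those with index not in `W`, and of `H_S` for the last interval, of size `b`.
(The factors commute, so their order is immaterial.) -/
noncomputable def projector (l : ℕ) (W : Set (Fin k)) (ν : Fin k → ℕ) (b : ℕ) :
    Module.End ℂ (TensorSpace l (∑ i, ν i + b)) :=
  ((List.finRange k).map fun i =>
    if i ∈ W then antisymmetrizer l _ (part ν b i) else symmetrizer l _ (part ν b i)).prod *
    symmetrizer l _ (part ν b ⊤)

/-- The basic invariant of a fixed-point-free involution `τ`: the tensor product, over the pairs
`p < τ p`, of the invariant tensors `∑ₐ,ₑ J a e • (a ⊗ e)` placed in the positions `p` and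
`τ p`. -/
noncomputable def basicInvariant (l N : ℕ) (τ : Equiv.Perm (Fin N)) : TensorSpace l N :=
  ∑ w : Fin N → Fin l ⊕ Fin l, (∏ p with p < τ p, Matrix.J (Fin l) ℂ (w p) (w (τ p))) •
    PiTensorProduct.tprod ℂ fun p => (Pi.single (w p) 1 : Fin l ⊕ Fin l → ℂ)

end SympInv

set_option linter.unusedSectionVars false

namespace SympInv

open Finset

/-! ### Coordinates on the tensor space -/

/-! In coordinates a tensor is a function on words in the `2l` letters, a basic invariant is
`pairing l τ` for a matching `τ`, and the projector becomes the signed sum `young` over the Young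
subgroup of the classes (`coords_projector`). Spanning and independence are proved separately.

By the first fundamental theorem (`invariants_eq_span`) the invariants are spanned by the basic
invariants. A vector orthogonal to all of these has only zero full contractions and is killed by the
Lie algebra `sp`; induction over partial contractions reduces to traceless tensors, and for these a
sum of squares equals a negative multiple of the squared norm (`eq_zero_of_traceless`).

After symmetrization only admissible matchings survive (`young_pairing_eq_zero`). They correspond,
up to class-preserving conjugation, to the symmetric multisets (`IsAdmissible.exists_multiset`,
`exists_conj`, `eq_of_represents_of_conj`), and conjugation alters the tensor only by a sign. A
standardizing rank of the positions turns decreasing sequences of the multiset into sets of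
positions on which the partner map is strictly decreasing (`decLength_of_represents`).

Spanning: a decreasing set with more than `2l` elements can be made stable under the partner map,
and antisymmetrizing over it gives zero because there are only `2l` letters. In this relation the
original matching occurs with a positive coefficient, while all other terms have larger `weight`,
since a decreasing arrangement minimizes a sum of products (`weight_conj`,
`young_pairing_mem_span`). The weight is bounded, so straightening terminates
(`young_pairing_mem_span_range`).

Independence: if no decreasing set exceeds `2l`, the left ends of arcs can be coloured with `l`
letters by the length of the longest decreasing set of left ends finishing there; right ends get the
opposite letters. On this word the symmetrized tensor of the matching has no cancellation
(`IsSeparating.young_ne_zero`), and any other admissible matching that does not vanish there has a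
larger `outerWeight`, or the same one and a smaller `productWeight`, or is conjugate
(`IsSeparating.weights_of_young_ne_zero`). Evaluation at these words is therefore triangular. -/

/-- The basis vectors of `V = ℂ^{2l}`. -/
abbrev Letter (l : ℕ) : Type := Fin l ⊕ Fin l

/-- The coordinates of a tensor: its coefficients at the words in the basis vectors. -/
noncomputable def coords (l N : ℕ) : TensorSpace l N ≃ₗ[ℂ] ((Fin N → Letter l) → ℂ) :=
  (Module.Basis.equivFun (Basis.piTensorProduct fun _ : Fin N => Pi.basisFun ℂ (Letter l)))

theorem coords_tprod (l N : ℕ) (v : Fin N → (Letter l → ℂ)) (w : Fin N → Letter l) :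
    coords l N (PiTensorProduct.tprod ℂ v) w = ∏ p, v p (w p) := by
  simp [coords, Module.Basis.equivFun_apply, Basis.piTensorProduct_repr_tprod_apply]

theorem coords_permAction (l N : ℕ) (π : Equiv.Perm (Fin N)) (x : TensorSpace l N)
    (w : Fin N → Letter l) :
    coords l N (permAction l N π x) w = coords l N x (fun p => w (π⁻¹ p)) := by
  induction x using PiTensorProduct.induction_on with
  | smul_tprod c v =>
    simp only [map_smul, permAction_tprod, Pi.smul_apply, coords_tprod]
    congr 1
    refine Fintype.prod_equiv π _ _ fun p => ?_
    simp
  | add x y hx hy => simp only [map_add, Pi.add_apply, hx, hy]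

theorem coords_tensorAction (l N : ℕ) (A : Matrix (Letter l) (Letter l) ℂ) (x : TensorSpace l N)
    (w : Fin N → Letter l) :
    coords l N (tensorAction l N A x) w =
      ∑ u : Fin N → Letter l, (∏ p, A (w p) (u p)) * coords l N x u := by
  induction x using PiTensorProduct.induction_on with
  | smul_tprod c v =>
    simp only [map_smul, tensorAction, PiTensorProduct.map_tprod, Pi.smul_apply, coords_tprod,
      Matrix.toLin'_apply, Matrix.mulVec, dotProduct, Finset.prod_univ_sum, Finset.mul_sum,
      Fintype.piFinset_univ, smul_eq_mul]
    refine Finset.sum_congr rfl fun u _ => ?_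
    rw [Finset.prod_mul_distrib]
    ring
  | add x y hx hy => simp only [map_add, Pi.add_apply, hx, hy, mul_add, Finset.sum_add_distrib]

section Pairing

variable {P : Type*} [Fintype P] [LinearOrder P]

/-- The coordinates of the basic invariant of `τ`. -/
noncomputable def pairing (l : ℕ) (τ : Equiv.Perm P) (w : P → Letter l) : ℂ :=
  ∏ p with p < τ p, Matrix.J (Fin l) ℂ (w p) (w (τ p))

end Pairing

theorem coords_basicInvariant (l N : ℕ) (τ : Equiv.Perm (Fin N)) :
    coords l N (basicInvariant l N τ) = pairing l τ := by
  funext w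
  simp only [basicInvariant, map_sum, map_smul, Finset.sum_apply, Pi.smul_apply, coords_tprod,
    smul_eq_mul]
  rw [Finset.sum_eq_single w]
  · simp [pairing]
  · intro u _ hu
    obtain ⟨p, hp⟩ := Function.ne_iff.mp hu
    rw [Finset.prod_eq_zero (Finset.mem_univ p), mul_zero]
    simp [Ne.symm hp]
  · simp

/-! ### Matchings -/

theorem J_apply_swap (l : ℕ) (a b : Letter l) :
    Matrix.J (Fin l) ℂ a b = -Matrix.J (Fin l) ℂ b a := by
  have := congrFun (congrFun (Matrix.J_transpose (Fin l) ℂ) b) a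
  simpa using this

theorem J_ne_zero_iff (l : ℕ) (a b : Letter l) : Matrix.J (Fin l) ℂ a b ≠ 0 ↔ b = a.swap := by
  rcases a with a | a <;> rcases b with b | b <;>
    simp [Matrix.J, Matrix.one_apply, eq_comm]

/-- A fixed-point-free involution. -/
structure IsMatching {P : Type*} (τ : Equiv.Perm P) : Prop where
  invol : ∀ p, τ (τ p) = p
  ne : ∀ p, τ p ≠ p

/-- The conjugate `g τ g⁻¹` of a matching is a matching. -/
theorem IsMatching.conj {P : Type*} {τ : Equiv.Perm P} (hτ : IsMatching τ) (g : Equiv.Perm P) :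
    IsMatching (g * τ * g⁻¹) where
  invol p := by simp [hτ.invol]
  ne p h := hτ.ne (g⁻¹ p) (by
    have := congrArg (g⁻¹ : Equiv.Perm P) h
    simpa using this)

section Matching

variable {P : Type*} [Fintype P] [LinearOrder P]

/-- Each row of `J` has a single nonzero entry, at the opposite letter. All evaluations of basic
invariants at words rest on this description of their support. -/
theorem pairing_ne_zero_iff {l : ℕ} {τ : Equiv.Perm P} (hτ : IsMatching τ) (w : P → Letter l) :
    pairing l τ w ≠ 0 ↔ ∀ p, w (τ p) = (w p).swap := by
  simp only [pairing, Finset.prod_ne_zero_iff, Finset.mem_filter, Finset.mem_univ, true_and,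
    J_ne_zero_iff]
  refine ⟨fun h p => ?_, fun h p _ => h p⟩
  rcases lt_or_gt_of_ne (hτ.ne p).symm with hp | hp
  · exact h p hp
  · have := h (τ p) (by rwa [hτ.invol])
    rw [hτ.invol] at this
    rw [this, Sum.swap_swap]

/-- A matching identifies the set of positions with two copies of the set of left ends. -/
noncomputable def IsMatching.equiv {τ : Equiv.Perm P} (hτ : IsMatching τ) :
    {p // p < τ p} × Bool ≃ P := by
  refine Equiv.ofBijective (fun a => if a.2 then τ a.1 else a.1) ⟨?_, ?_⟩
  · rintro ⟨⟨p, hp⟩, s⟩ ⟨⟨q, hq⟩, t⟩ h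
    cases s <;> cases t <;> simp at h
    · simp [h]
    · subst h
      rw [hτ.invol] at hp
      exact absurd hp hq.asymm
    · subst h
      rw [hτ.invol] at hq
      exact absurd hp hq.asymm
    · simp [h]
  · intro p
    rcases lt_or_gt_of_ne (hτ.ne p).symm with hp | hp
    · exact ⟨(⟨p, hp⟩, false), by simp⟩
    · exact ⟨(⟨τ p, by rwa [hτ.invol]⟩, true), by simp [hτ.invol]⟩

@[simp] theorem IsMatching.equiv_false {τ : Equiv.Perm P} (hτ : IsMatching τ) (a) :
    hτ.equiv (a, false) = a := rfl

@[simp] theorem IsMatching.equiv_true {τ : Equiv.Perm P} (hτ : IsMatching τ) (a) :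
    hτ.equiv (a, true) = τ a := rfl

/-- The sign by which renaming the positions by `g` changes the basic invariant of `τ`. -/
def flipSign (τ g : Equiv.Perm P) : ℤˣ := ∏ p with p < τ p, if g p < g (τ p) then 1 else -1

/-- Renaming the positions changes a basic invariant into the one of the conjugate matching,
up to a sign. -/
theorem pairing_comp {l : ℕ} {τ : Equiv.Perm P} (hτ : IsMatching τ) (g : Equiv.Perm P)
    (w : P → Letter l) :
    pairing l τ (fun p => w (g p)) =
      ((flipSign τ g : ℤ) : ℂ) * pairing l (g * τ * g⁻¹) w := by
  simp only [pairing, flipSign, Units.coe_prod, Int.cast_prod]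
  have hl : ∀ p : P, ¬ p < τ p → τ p < τ (τ p) := fun p hp => by
    rw [hτ.invol]
    exact lt_of_le_of_ne (not_lt.mp hp) (hτ.ne p)
  have hl' : ∀ p : P, ¬ g p < g (τ p) → g (τ p) < g p := fun p hp =>
    lt_of_le_of_ne (not_lt.mp hp) fun h => hτ.ne p (g.injective h)
  -- The arcs of the conjugate are the images under `g` of the arcs of `τ`; the left end of an image
  -- is the smaller of `g p` and `g (τ p)`.
  have key : ∏ p with p < (g * τ * g⁻¹) p, Matrix.J (Fin l) ℂ (w p) (w ((g * τ * g⁻¹) p)) =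
      ∏ p with p < τ p, if g p < g (τ p) then Matrix.J (Fin l) ℂ (w (g p)) (w (g (τ p)))
        else Matrix.J (Fin l) ℂ (w (g (τ p))) (w (g p)) := by
    refine (Finset.prod_bij' (fun p _ => if g p < g (τ p) then g p else g (τ p))
      (fun q _ => if g⁻¹ q < τ (g⁻¹ q) then g⁻¹ q else τ (g⁻¹ q)) ?_ ?_ ?_ ?_ ?_).symm
    · intro p hp
      simp only [Finset.mem_filter, Finset.mem_univ, true_and]
      split_ifs with h
      · simpa using h
      · simpa [hτ.invol] using hl' p h
    · intro q hq
      simp only [Finset.mem_filter, Finset.mem_univ, true_and]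
      split_ifs with h
      · exact h
      · exact hl _ h
    · intro p hp
      simp only [Finset.mem_filter, Finset.mem_univ, true_and] at hp
      split_ifs with h h1 h1 <;> simp_all [hp.asymm, hτ.invol]
    · intro q hq
      obtain ⟨p, rfl⟩ := g.surjective q
      have hq' : g p < g (τ p) := by simpa using (Finset.mem_filter.mp hq).2
      by_cases h1 : p < τ p
      · simp [h1, hq']
      · simp [h1, hτ.invol, hq'.asymm]
    · intro p hp
      split_ifs with h <;> simp [hτ.invol]
  rw [key, ← Finset.prod_mul_distrib]
  refine Finset.prod_congr rfl fun p _ => ?_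
  split_ifs with h
  · simp
  · rw [J_apply_swap l (w (g (τ p)))]
    simp

/-- Such a permutation is a permutation of `A` applied to both copies, which is even, composed with
flips in some of the fibres, each of which is odd. -/
theorem sign_prod_bool {A : Type*} [Fintype A] [DecidableEq A] (z : Equiv.Perm (A × Bool))
    (hz : ∀ a s, z (a, !s) = ((z (a, s)).1, !(z (a, s)).2)) :
    Equiv.Perm.sign z = ∏ a, if (z (a, false)).2 = false then 1 else -1 := by
  have h1 : ∀ a s, z (a, s) = ((z (a, false)).1, xor s (z (a, false)).2) := by
    intro a s
    cases s
    · simp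
    · simpa using hz a false
  have hinj : Function.Injective fun a => (z (a, false)).1 := by
    intro a b hab
    have : z (a, false) = z (b, xor (z (a, false)).2 (z (b, false)).2) := by
      rw [h1 b]
      refine Prod.ext hab ?_
      simp
    exact congrArg Prod.fst (z.injective this)
  let σ : Equiv.Perm A := Equiv.ofBijective _ (Finite.injective_iff_bijective.mp hinj)
  let δ : A → Equiv.Perm Bool := fun a => if (z (a, false)).2 = false then 1 else Equiv.boolNot
  have h2 : z = Equiv.prodCongrLeft (fun _ : Bool => σ) * Equiv.prodCongrRight δ := by
    ext1 ⟨a, s⟩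
    rw [h1]
    by_cases h : (z (a, false)).2 = false <;> cases s <;> simp [σ, δ, h]
  have hb : Equiv.Perm.sign Equiv.boolNot = -1 := by decide
  rw [h2, Equiv.Perm.sign_mul, Equiv.Perm.sign_prodCongrLeft, Equiv.Perm.sign_prodCongrRight]
  simp only [Finset.prod_const, Finset.card_univ, Fintype.card_bool, Int.units_sq, one_mul, δ,
    ← h2]
  refine Finset.prod_congr rfl fun a _ => ?_
  split_ifs <;> simp [hb]

/-- The sign of an automorphism of a matching. -/
theorem flipSign_of_commute {τ : Equiv.Perm P} (hτ : IsMatching τ) (z : Equiv.Perm P)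
    (hz : ∀ p, z (τ p) = τ (z p)) : flipSign τ z = Equiv.Perm.sign z := by
  have hflip : ∀ a s, hτ.equiv (a, !s) = τ (hτ.equiv (a, s)) := by
    intro a s
    cases s <;> simp [hτ.invol]
  have hflip' : ∀ x : {p // p < τ p} × Bool, hτ.equiv (x.1, !x.2) = τ (hτ.equiv x) :=
    fun x => hflip x.1 x.2
  have := sign_prod_bool (hτ.equiv.symm.permCongr z) (by
    intro a s
    apply hτ.equiv.injective
    rw [hflip']
    simp [hflip, hz])
  rw [Equiv.Perm.sign_permCongr] at this
  rw [this, flipSign, ← Finset.prod_subtype_eq_prod_filter, Finset.subtype_univ]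
  refine Finset.prod_congr rfl fun a _ => ?_
  rw [hz]
  congr 1
  simp only [Equiv.permCongr_apply, Equiv.symm_symm, IsMatching.equiv_false, eq_iff_iff]
  obtain ⟨⟨b, s⟩, hb⟩ := hτ.equiv.surjective (z a)
  rw [← hb, Equiv.symm_apply_apply]
  cases s
  · simpa using b.2
  · simpa [hτ.invol] using b.2.le

theorem conj_eq_self {τ z : Equiv.Perm P} (hz : ∀ p, z (τ p) = τ (z p)) :
    z * τ * z⁻¹ = τ := by
  ext p
  simp [hz]

/-- An automorphism `z` of a matching acts on its basic invariant by the sign of `z`. -/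
theorem pairing_comp_of_commute {l : ℕ} {τ : Equiv.Perm P} (hτ : IsMatching τ) (z : Equiv.Perm P)
    (hz : ∀ p, z (τ p) = τ (z p)) (w : P → Letter l) :
    pairing l τ (fun p => w (z p)) = ((Equiv.Perm.sign z : ℤ) : ℂ) * pairing l τ w := by
  rw [pairing_comp hτ, conj_eq_self hz, flipSign_of_commute hτ z hz]

/-- An automorphism of a matching that maps left ends to left ends is even. -/
theorem sign_eq_one_of_commute {τ : Equiv.Perm P} (hτ : IsMatching τ) (z : Equiv.Perm P)
    (hz : ∀ p, z (τ p) = τ (z p)) (hl : ∀ p, p < τ p → z p < τ (z p)) :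
    Equiv.Perm.sign z = 1 := by
  rw [← flipSign_of_commute hτ z hz, flipSign]
  refine Finset.prod_eq_one fun p hp => ?_
  rw [if_pos]
  rw [hz]
  exact hl p (by simpa using hp)

end Matching

/-! ### The first fundamental theorem -/

section FFT

variable {P n : Type*} [Fintype P] [DecidableEq P] [Fintype n] [DecidableEq n]

/-- The derivation induced by `X` on the tensor positions in `F`, in coordinates. -/
def derivation (F : Finset P) (X : Matrix n n ℂ) (y : (P → n) → ℂ)
    (u : P → n) : ℂ :=
  ∑ p ∈ F, ∑ a, X (u p) a * y (Function.update u p a)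

theorem sum_update_comm {F : Type*} [AddCommMonoid F] (p : P)
    (f : (P → n) → n → F) :
    ∑ w : P → n, ∑ b, f w b = ∑ u : P → n, ∑ a, f (Function.update u p a) (u p) := by
  rw [← Finset.sum_product', ← Finset.sum_product']
  refine Finset.sum_bij' (fun x _ => (Function.update x.1 p x.2, x.1 p))
    (fun x _ => (Function.update x.1 p x.2, x.1 p)) ?_ ?_ ?_ ?_ ?_ <;> simp

theorem sum_comm_four {α β γ δ M : Type*} [Fintype α] [Fintype β] [Fintype γ] [AddCommMonoid M]
    (F : Finset δ) (f : α → β → γ → δ → M) :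
    ∑ a, ∑ b, ∑ u, ∑ q ∈ F, f a b u q = ∑ q ∈ F, ∑ u, ∑ b, ∑ a, f a b u q := by
  rw [Finset.sum_comm]
  simp_rw [Finset.sum_comm (s := (Finset.univ : Finset α)) (t := (Finset.univ : Finset γ))]
  rw [Finset.sum_comm]
  simp_rw [Finset.sum_comm (s := (Finset.univ : Finset α)) (t := F),
    Finset.sum_comm (s := (Finset.univ : Finset β)) (t := F)]
  rw [Finset.sum_comm]

/-- A tensor killed by the symplectic Lie algebra and by all contractions vanishes. -/
theorem eq_zero_of_traceless (J : Matrix n n ℂ) (hJ2 : J * J = -1) (hJT : J.transpose = -J) (F : Finset P) (hF : F.Nonempty) (y : (P → n) → ℂ)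
    (hD : ∀ X : Matrix n n ℂ,
      X * J + J * X.transpose = 0 → derivation F X y = 0)
    (hT : ∀ p ∈ F, ∀ q ∈ F, p ≠ q → ∀ u, ∑ a, ∑ j, J a j *
      y (Function.update (Function.update u q a) p j) = 0) : y = 0 := by
  have hJJ : ∀ i j, ∑ a, J a i * J a j = if i = j then 1 else 0 := by
    intro i j
    have h : J.transpose * J = 1 := by rw [hJT, neg_mul, hJ2, neg_neg]
    have := congrFun (congrFun h i) j
    simpa only [Matrix.mul_apply, Matrix.one_apply, Matrix.transpose_apply] using this
  -- the invariance under `E a b + J * E b a * J`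
  have h1 : ∀ a b u, derivation F (Matrix.single a b (1 : ℂ)) y u =
      -∑ p ∈ F, ∑ j, J (u p) b * J a j * y (Function.update u p j) := by
    intro a b u
    have hX := hD (Matrix.single a b 1 + J * Matrix.single b a 1 * J) (by
      have : (Matrix.single a b (1 : ℂ)).transpose = Matrix.single b a 1 := by simp
      simp only [Matrix.transpose_add, Matrix.transpose_mul, hJT, this]
      have : (Matrix.single b a (1 : ℂ)).transpose = Matrix.single a b 1 := by simp
      rw [this]
      have e1 : J * Matrix.single b a 1 * J * J = -(J * Matrix.single b a 1) := by
        rw [Matrix.mul_assoc _ J J, hJ2]; simp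
      have e2 : J * (-J * (Matrix.single a b 1 * -J)) = -(Matrix.single a b 1 * J) := by
        rw [← Matrix.mul_assoc, mul_neg, hJ2]; simp
      rw [add_mul, mul_add, e1, e2]
      abel)
    have hX' := congrFun hX u
    simp only [derivation, Matrix.add_apply, add_mul, Finset.sum_add_distrib, Pi.zero_apply] at hX'
    rw [derivation, eq_neg_iff_add_eq_zero, ← hX']
    congr 1
    refine Finset.sum_congr rfl fun p _ => Finset.sum_congr rfl fun j _ => ?_
    congr 1
    rw [Matrix.mul_assoc, Matrix.mul_apply, Finset.sum_eq_single b]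
    · simp
    · intro c _ hc
      rw [Matrix.single_mul_apply_of_ne, mul_zero]
      exact hc
    · simp
  have h2 : ∀ a b u, derivation F (Matrix.single a b (1 : ℂ)) y u =
      ∑ p ∈ F, if u p = a then y (Function.update u p b) else 0 := by
    intro a b u
    refine Finset.sum_congr rfl fun p _ => ?_
    rw [Finset.sum_eq_single b]
    · simp [Matrix.single_apply, eq_comm]
    · intro c _ hc
      simp [Ne.symm hc]
    · simp
  -- the sum of the squares
  have h3 : ∑ a, ∑ b, ∑ u, star (derivation F (Matrix.single a b (1 : ℂ)) y u) *
      derivation F (Matrix.single a b (1 : ℂ)) y u = -(#F * ∑ u, star (y u) * y u) := by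
    -- After the letter at `q` is renamed, the term `p = q` gives the squared norm by `hJJ`, and the
    -- terms `p ≠ q` contain a contraction and vanish by `hT`.
    have step : ∀ q ∈ F, ∑ u : P → n, ∑ b, ∑ a,
        (if u q = a then star (y (Function.update u q b)) else 0) *
          (∑ p ∈ F, ∑ j, J (u p) b * J a j * y (Function.update u p j)) =
        ∑ u, star (y u) * y u := by
      intro q hq
      rw [sum_update_comm q]
      refine Finset.sum_congr rfl fun u _ => ?_
      simp only [Function.update_self, Function.update_idem, Function.update_eq_self, ite_mul,
        zero_mul, Finset.sum_ite_eq, Finset.mem_univ, if_true]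
      rw [← Finset.mul_sum, Finset.sum_comm]
      congr 1
      rw [← Finset.add_sum_erase F _ hq, Finset.sum_eq_zero (s := F.erase q), add_zero]
      · simp only [Function.update_self, Function.update_idem]
        rw [Finset.sum_comm]
        simp_rw [← Finset.sum_mul, hJJ]
        simp
      · intro p hp
        obtain ⟨hpq, hpF⟩ := Finset.mem_erase.mp hp
        simp only [Function.update_of_ne hpq, mul_assoc]
        simp_rw [← Finset.mul_sum]
        rw [hT p hpF q hq hpq u, mul_zero]
    calc _ = -∑ q ∈ F, ∑ u : P → n, ∑ b, ∑ a,
        (if u q = a then star (y (Function.update u q b)) else 0) *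
          (∑ p ∈ F, ∑ j, J (u p) b * J a j * y (Function.update u p j)) := by
          rw [← Finset.sum_neg_distrib]
          have : ∀ a b u, star (derivation F (Matrix.single a b (1 : ℂ)) y u) *
              derivation F (Matrix.single a b (1 : ℂ)) y u =
              ∑ q ∈ F, -((if u q = a then star (y (Function.update u q b)) else 0) *
                (∑ p ∈ F, ∑ j, J (u p) b * J a j * y (Function.update u p j))) := by
            intro a b u
            conv_lhs => rw [congrArg star (h2 a b u), h1 a b u, star_sum, Finset.sum_mul]
            refine Finset.sum_congr rfl fun q _ => ?_
            rw [mul_neg]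
            congr 2
            split_ifs <;> simp
          simp_rw [this]
          simp_rw [← Finset.sum_neg_distrib]
          exact sum_comm_four F _
      _ = _ := by rw [Finset.sum_congr rfl step]; simp
  -- A sum of squares now equals minus `#F` times the squared norm of `y`, so both are zero.
  have h4 : 0 ≤ ∑ a, ∑ b, ∑ u, ‖derivation F (Matrix.single a b (1 : ℂ)) y u‖ ^ 2 := by positivity
  have h5 : ∑ a, ∑ b, ∑ u, ‖derivation F (Matrix.single a b (1 : ℂ)) y u‖ ^ 2 =
      -(#F * ∑ u, ‖y u‖ ^ 2) := by
    have e : ∀ z : ℂ, star z * z = ((‖z‖ ^ 2 : ℝ) : ℂ) := fun z => by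
      simpa using Complex.conj_mul' z
    simp_rw [e] at h3
    exact_mod_cast h3
  have hF' : (0 : ℝ) < #F := by exact_mod_cast hF.card_pos
  have h6 : ∑ u, ‖y u‖ ^ 2 = 0 := by
    refine le_antisymm ?_ (by positivity)
    rw [h5] at h4
    nlinarith
  funext u
  have := (Finset.sum_eq_zero_iff_of_nonneg fun u _ => by positivity).mp h6 u (Finset.mem_univ u)
  simpa using this

end FFT

/-! ### Induction over partial contractions. -/

section Contraction

variable {P : Type*} [Fintype P] [LinearOrder P] {l : ℕ}

/-- The contraction with `J` is invariant under `X`: the contributions of the positions `p` and `q`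
cancel, and those of the other positions commute with the contraction. -/
theorem derivation_contraction (F : Finset P) (y : (P → Letter l) → ℂ)
    (X : Matrix (Letter l) (Letter l) ℂ)
    (hX : X * Matrix.J (Fin l) ℂ + Matrix.J (Fin l) ℂ * X.transpose = 0)
    (hy : derivation F X y = 0) {p q : P} (hp : p ∈ F) (hq : q ∈ F) (hpq : p ≠ q) :
    derivation ((F.erase p).erase q) X (fun u => ∑ a, ∑ j, Matrix.J (Fin l) ℂ a j *
      y (Function.update (Function.update u q a) p j)) = 0 := by
  have hX' : X.transpose * Matrix.J (Fin l) ℂ + Matrix.J (Fin l) ℂ * X = 0 := by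
    have h2 : Matrix.J (Fin l) ℂ * Matrix.J (Fin l) ℂ = -1 := Matrix.J_squared _ _
    have := congrArg (fun Y => Matrix.J (Fin l) ℂ * Y * Matrix.J (Fin l) ℂ) hX
    simp only [mul_add, add_mul, mul_zero, zero_mul] at this
    rw [← neg_eq_zero, ← this, Matrix.mul_assoc _ (X * _), Matrix.mul_assoc X, h2,
      ← Matrix.mul_assoc (Matrix.J (Fin l) ℂ) (Matrix.J (Fin l) ℂ), h2]
    simp [add_comm]
  revert hX'
  generalize Matrix.J (Fin l) ℂ = J
  intro hX'
  have hX'' : ∀ a j, (∑ b, X b a * J b j) + ∑ b, J a b * X b j = 0 := fun a j => by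
    simpa only [Matrix.add_apply, Matrix.mul_apply, Matrix.transpose_apply, Matrix.zero_apply]
      using congrFun (congrFun hX' a) j
  funext u
  have key : ∑ a, ∑ j, J a j * derivation F X y (Function.update (Function.update u q a) p j) = 0 := by
    simp [hy]
  have hqe : q ∈ F.erase p := Finset.mem_erase.mpr ⟨hpq.symm, hq⟩
  have hsplit : ∀ v, derivation F X y v = (∑ c, X (v p) c * y (Function.update v p c)) +
      ((∑ c, X (v q) c * y (Function.update v q c)) + derivation ((F.erase p).erase q) X y v) := by
    intro v
    rw [derivation, derivation, Finset.add_sum_erase _ (fun r => ∑ c, X (v r) c * y _) hqe,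
      Finset.add_sum_erase _ (fun r => ∑ c, X (v r) c * y _) hp]
  simp only [hsplit, mul_add, Finset.sum_add_distrib, Function.update_self,
    Function.update_of_ne hpq.symm, Function.update_idem] at key
  have t1 : ∑ a, ∑ j, J a j * ∑ c, X j c * y (Function.update (Function.update u q a) p c) =
      ∑ a, ∑ c, (∑ j, J a j * X j c) * y (Function.update (Function.update u q a) p c) := by
    refine Finset.sum_congr rfl fun a _ => ?_
    simp only [Finset.mul_sum, Finset.sum_mul, ← mul_assoc]
    rw [Finset.sum_comm]
  have t2 : ∑ a, ∑ j, J a j * ∑ c, X a c *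
        y (Function.update (Function.update (Function.update u q a) p j) q c) =
      ∑ c, ∑ j, (∑ a, X a c * J a j) * y (Function.update (Function.update u q c) p j) := by
    simp only [Function.update_comm hpq, Function.update_idem, Finset.mul_sum, Finset.sum_mul]
    rw [Finset.sum_comm]
    conv_rhs => rw [Finset.sum_comm]
    refine Finset.sum_congr rfl fun j _ => ?_
    rw [Finset.sum_comm]
    refine Finset.sum_congr rfl fun c _ => Finset.sum_congr rfl fun a _ => ?_
    ring
  have t3 : derivation ((F.erase p).erase q) X (fun u => ∑ a, ∑ j, J a j *
      y (Function.update (Function.update u q a) p j)) u = ∑ a, ∑ j, J a j *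
        derivation ((F.erase p).erase q) X y (Function.update (Function.update u q a) p j) := by
    simp only [derivation, Finset.mul_sum]
    simp_rw [Finset.sum_comm (s := (Finset.univ : Finset (Letter l))) (t := (F.erase p).erase q)]
    refine Finset.sum_congr rfl fun r hr => ?_
    have hrq : r ≠ q := (Finset.mem_erase.mp hr).1
    have hrp : r ≠ p := (Finset.mem_erase.mp (Finset.mem_erase.mp hr).2).1
    simp only [Function.update_of_ne hrq, Function.update_of_ne hrp]
    rw [Finset.sum_comm]
    refine Finset.sum_congr rfl fun a _ => ?_
    rw [Finset.sum_comm]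
    refine Finset.sum_congr rfl fun j _ => Finset.sum_congr rfl fun c _ => ?_
    rw [Function.update_comm hrq, Function.update_comm hrp]
    ring
  rw [t3, Pi.zero_apply, ← key, t1, t2, ← add_assoc]
  refine (add_eq_right.mpr ?_).symm
  rw [← Finset.sum_add_distrib]
  refine Finset.sum_eq_zero fun a _ => ?_
  rw [← Finset.sum_add_distrib]
  refine Finset.sum_eq_zero fun c _ => ?_
  rw [← add_mul, add_comm, hX'', zero_mul]

/-- Joining two unmatched positions by a new arc adds one factor to the product. The sign `ε`
accounts for which of the two is the left end. -/
theorem pairing_mul_swap {τ : Equiv.Perm P} {p q : P} (hp : τ p = p)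
    (hq : τ q = q) (hpq : p ≠ q) :
    ∃ ε : ℂ, ε ≠ 0 ∧ ∀ w : P → Letter l, pairing l (τ * Equiv.swap p q) w =
      ε * (pairing l τ w * Matrix.J (Fin l) ℂ (w q) (w p)) := by
  wlog h : q < p generalizing p q
  · obtain ⟨ε, hε, h'⟩ := this hq hp hpq.symm (lt_of_le_of_ne (not_lt.mp h) hpq)
    refine ⟨-ε, neg_ne_zero.mpr hε, fun w => ?_⟩
    rw [Equiv.swap_comm, h', J_apply_swap l (w q)]
    ring
  · refine ⟨1, one_ne_zero, fun w => ?_⟩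
    have hf : ∀ r, r ≠ p → r ≠ q → (τ * Equiv.swap p q) r = τ r := fun r h1 h2 => by
      rw [Equiv.Perm.mul_apply, Equiv.swap_apply_of_ne_of_ne h1 h2]
    have hset : (Finset.univ.filter fun r => r < (τ * Equiv.swap p q) r) =
        insert q (Finset.univ.filter fun r => r < τ r) := by
      ext r
      simp only [Finset.mem_filter, Finset.mem_univ, true_and, Finset.mem_insert]
      rcases eq_or_ne r p with rfl | h1
      · simp [hq, hpq, h.le, hp]
      rcases eq_or_ne r q with rfl | h2
      · simp [hp, h]
      rw [hf r h1 h2]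
      simp [h2]
    rw [pairing, hset, Finset.prod_insert (by simp [hq]), pairing, one_mul, mul_comm]
    congr 1
    · refine Finset.prod_congr rfl fun r hr => ?_
      have hr' : r < τ r := by simpa using hr
      rw [hf r (by rintro rfl; exact hr'.ne hp.symm) (by rintro rfl; exact hr'.ne hq.symm)]
    · simp [hp]

theorem pairing_update {τ : Equiv.Perm P} {p : P} (hp : τ p = p) (w : P → Letter l) (a : Letter l) :
    pairing l τ (Function.update w p a) = pairing l τ w := by
  refine Finset.prod_congr rfl fun r hr => ?_
  have hr' : r < τ r := by simpa using hr
  have h1 : r ≠ p := by rintro rfl; exact hr'.ne hp.symm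
  have h2 : τ r ≠ p := fun h => h1 (τ.injective (h.trans hp.symm))
  rw [Function.update_of_ne h1, Function.update_of_ne h2]

/-- Induction on the number of positions not yet contracted. Contracting one more pair keeps both
hypotheses, so by induction every single contraction of `y` vanishes, and then
`eq_zero_of_traceless` applies. For odd `#F` the hypothesis `hC` is empty, and the induction still
ends with a tensor without contractions. -/
theorem eq_zero_of_contractions (F : Finset P) (y : (P → Letter l) → ℂ)
    (hD : ∀ X : Matrix (Letter l) (Letter l) ℂ,
      X * Matrix.J (Fin l) ℂ + Matrix.J (Fin l) ℂ * X.transpose = 0 → derivation F X y = 0)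
    (hC : ∀ τ : Equiv.Perm P, (∀ p, τ (τ p) = p) → (∀ p, τ p ≠ p ↔ p ∈ F) →
      ∀ u : P → Letter l, ∑ w with ∀ p, p ∉ F → w p = u p, pairing l τ w * y w = 0) :
    y = 0 := by
  induction hn : #F using Nat.strong_induction_on generalizing F y with
  | _ n ih =>
  rcases F.eq_empty_or_nonempty with rfl | hF
  · funext u
    have := hC 1 (by simp) (by simp) u
    rw [Finset.sum_eq_single u] at this
    · simpa [pairing] using this
    · intro w hw hwu
      refine absurd (funext fun p => ?_) hwu
      exact (Finset.mem_filter.mp hw).2 p (Finset.notMem_empty p)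
    · simp
  · refine eq_zero_of_traceless (Matrix.J (Fin l) ℂ) (Matrix.J_squared _ _) (Matrix.J_transpose _ _)
      F hF y hD fun p hp q hq hpq => ?_
    have hqe : q ∈ F.erase p := Finset.mem_erase.mpr ⟨hpq.symm, hq⟩
    have := ih #((F.erase p).erase q) (by
        rw [← hn]
        exact (Finset.card_erase_lt_of_mem hqe).trans (Finset.card_erase_lt_of_mem hp))
      ((F.erase p).erase q) _
      (fun X hX => derivation_contraction F y X hX (hD X hX) hp hq hpq) ?_ rfl
    · exact fun u => congrFun this u
    · intro τ hτ hfix u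
      have hτp : τ p = p := by
        by_contra h
        simpa using (hfix p).mp h
      have hτq : τ q = q := by
        by_contra h
        simpa using (hfix q).mp h
      obtain ⟨ε, hε, hmul⟩ := pairing_mul_swap (l := l) hτp hτq hpq
      have hne : ∀ r, r ≠ p → r ≠ q → τ r ≠ p ∧ τ r ≠ q := fun r h1 h2 =>
        ⟨fun h => h1 (τ.injective (h.trans hτp.symm)), fun h => h2 (τ.injective (h.trans hτq.symm))⟩
      have hC' := hC (τ * Equiv.swap p q) (by
          intro r
          simp only [Equiv.Perm.mul_apply]
          rcases eq_or_ne r p with rfl | h1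
          · simp [hτq, hτp]
          rcases eq_or_ne r q with rfl | h2
          · simp [hτq, hτp]
          rw [Equiv.swap_apply_of_ne_of_ne h1 h2,
            Equiv.swap_apply_of_ne_of_ne (hne r h1 h2).1 (hne r h1 h2).2, hτ]) (by
          intro r
          simp only [Equiv.Perm.mul_apply]
          rcases eq_or_ne r p with rfl | h1
          · simp [hτq, hp, hpq.symm]
          rcases eq_or_ne r q with rfl | h2
          · simp [hτp, hq, hpq]
          rw [Equiv.swap_apply_of_ne_of_ne h1 h2, hfix]
          simp [h1, h2]) u
      -- A word that is free on `F` is a word that is free on `F` without `p` and `q`, together with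
      -- the two letters summed over in the contraction.
      have e : ∑ w with ∀ r, r ∉ (F.erase p).erase q → w r = u r, pairing l τ w *
          ∑ a, ∑ j, Matrix.J (Fin l) ℂ a j * y (Function.update (Function.update w q a) p j) =
          ∑ w with ∀ r, r ∉ F → w r = u r,
            pairing l τ w * Matrix.J (Fin l) ℂ (w q) (w p) * y w := by
        simp only [← Finset.sum_product', Finset.mul_sum]
        refine Finset.sum_bij' (fun x _ => Function.update (Function.update x.1 q x.2.1) p x.2.2)
          (fun w _ => (Function.update (Function.update w q (u q)) p (u p), (w q, w p)))
          ?_ ?_ ?_ ?_ ?_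
        · rintro ⟨w, a, j⟩ h
          simp only [Finset.mem_product, Finset.mem_filter, Finset.mem_univ, true_and, and_true]
            at h ⊢
          intro r hr
          have h1 : r ≠ p := by rintro rfl; exact hr hp
          have h2 : r ≠ q := by rintro rfl; exact hr hq
          rw [Function.update_of_ne h1, Function.update_of_ne h2]
          exact h r (by simp [hr])
        · intro w h
          simp only [Finset.mem_product, Finset.mem_filter, Finset.mem_univ, true_and, and_true]
            at h ⊢
          intro r hr
          rcases eq_or_ne r p with rfl | h1
          · simp
          rcases eq_or_ne r q with rfl | h2
          · simp [h1]
          rw [Function.update_of_ne h1, Function.update_of_ne h2]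
          exact h r (by simpa [h1, h2] using hr)
        · rintro ⟨w, a, j⟩ h
          simp only [Finset.mem_product, Finset.mem_filter, Finset.mem_univ, true_and, and_true]
            at h
          have e1 := h p (by simp)
          have e2 := h q (by simp)
          simp only [Function.update_self, Function.update_of_ne hpq.symm,
            Function.update_comm hpq, Function.update_idem]
          rw [← e1, ← e2]
          simp
        · intro w h
          simp only [Function.update_comm hpq, Function.update_idem, Function.update_eq_self]
        · rintro ⟨w, a, j⟩ h
          simp only [pairing_update hτp, pairing_update hτq, Function.update_self,
            Function.update_of_ne hpq.symm]
          ring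
      rw [e]
      simp only [hmul, mul_assoc ε] at hC'
      rw [← Finset.mul_sum] at hC'
      exact (mul_eq_zero.mp hC').resolve_left hε

end Contraction

/-! ### One-parameter subgroups of the compact symplectic group. -/

section LieAlgebra

attribute [local instance] Matrix.linftyOpNormedRing Matrix.linftyOpNormedAlgebra

/-- The relation `hX` says that conjugation by `J` takes `X.transpose` to `-X`; conjugation commutes
with the exponential, which gives the symplectic condition, and `hX'` gives unitarity. -/
theorem exp_mem_compactSp {l : ℕ} (X : Matrix (Letter l) (Letter l) ℂ)
    (hX : X * Matrix.J (Fin l) ℂ + Matrix.J (Fin l) ℂ * X.transpose = 0)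
    (hX' : X.conjTranspose = -X) : NormedSpace.exp X ∈ compactSp l := by
  have hinv : NormedSpace.exp X * NormedSpace.exp (-X) = 1 := by
    rw [← Matrix.exp_add_of_commute _ _ (Commute.neg_right (Commute.refl X)), add_neg_cancel,
      NormedSpace.exp_zero]
  refine Submonoid.mem_inf.mpr ⟨?_, ?_⟩
  · rw [SymplecticGroup.mem_iff, ← Matrix.exp_transpose]
    have hu : IsUnit (Matrix.J (Fin l) ℂ) := (Matrix.isUnit_iff_isUnit_det _).mpr
      (Matrix.isUnit_det_J (Fin l) ℂ)
    have hc : -X = Matrix.J (Fin l) ℂ * X.transpose * (Matrix.J (Fin l) ℂ)⁻¹ := by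
      rw [eq_neg_of_add_eq_zero_right hX, neg_mul,
        Matrix.mul_nonsing_inv_cancel_right _ _ (Matrix.isUnit_det_J (Fin l) ℂ)]
    rw [hc, Matrix.exp_conj _ _ hu] at hinv
    have := congrArg (· * Matrix.J (Fin l) ℂ) hinv
    simp only [one_mul] at this
    rw [← Matrix.mul_assoc, ← Matrix.mul_assoc,
      Matrix.nonsing_inv_mul_cancel_right _ _ (Matrix.isUnit_det_J (Fin l) ℂ)] at this
    exact this
  · refine Matrix.mem_unitaryGroup_iff.mpr ?_
    rw [Matrix.star_eq_conjTranspose, ← Matrix.exp_conjTranspose, hX', hinv]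

theorem hasDerivAt_exp_apply {n : Type*} [Fintype n] [DecidableEq n] (X : Matrix n n ℂ) (i j : n) :
    HasDerivAt (fun t : ℝ => NormedSpace.exp (t • X) i j) (X i j) 0 := by
  have h := hasDerivAt_exp_smul_const (𝕂 := ℝ) X 0
  rw [zero_smul, NormedSpace.exp_zero, one_mul] at h
  have h2 := (LinearMap.toContinuousLinearMap
    (Matrix.entryLinearMap ℝ ℂ i j)).hasFDerivAt.comp_hasDerivAt (0 : ℝ) h
  exact h2

end LieAlgebra

/-! ### From invariance under the compact group to the complex Lie algebra, and invariance of the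
pairings. -/

section Invariants

variable {P : Type*} [Fintype P] [LinearOrder P] {l : ℕ}

/-- This is the derivative at `t = 0` of the invariance under `exp (t X)`. -/
theorem derivation_univ_eq_zero_of_antihermitian (x : (P → Letter l) → ℂ)
    (hx : ∀ A ∈ compactSp l, ∀ w, ∑ u : P → Letter l, (∏ p, A (w p) (u p)) * x u = x w)
    (X : Matrix (Letter l) (Letter l) ℂ)
    (hX : X * Matrix.J (Fin l) ℂ + Matrix.J (Fin l) ℂ * X.transpose = 0)
    (hX' : X.conjTranspose = -X) : derivation Finset.univ X x = 0 := by
  funext w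
  have h1 : ∀ u : P → Letter l, HasDerivAt
      (fun t : ℝ => (∏ p, NormedSpace.exp (t • X) (w p) (u p)) * x u)
      ((∑ p, (∏ q ∈ Finset.univ.erase p, (1 : Matrix (Letter l) (Letter l) ℂ) (w q) (u q)) •
        X (w p) (u p)) * x u) 0 := by
    intro u
    have := HasDerivAt.fun_finsetProd (u := Finset.univ) (x := (0 : ℝ))
      (f := fun p (t : ℝ) => NormedSpace.exp (t • X) (w p) (u p))
      (fun p _ => hasDerivAt_exp_apply X (w p) (u p))
    simp only [zero_smul, NormedSpace.exp_zero] at this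
    exact this.mul_const (x u)
  have h2 := HasDerivAt.fun_sum (u := Finset.univ) fun u _ => h1 u
  have h3 : (fun t : ℝ => ∑ u : P → Letter l, (∏ p, NormedSpace.exp (t • X) (w p) (u p)) * x u) =
      fun _ => x w := by
    funext t
    refine hx _ (exp_mem_compactSp _ ?_ ?_) w
    · rw [Matrix.transpose_smul, smul_mul_assoc, mul_smul_comm, ← smul_add, hX, smul_zero]
    · rw [Matrix.conjTranspose_smul, hX', star_trivial, smul_neg]
  rw [h3] at h2
  have h4 := h2.unique (hasDerivAt_const (0 : ℝ) (x w))
  rw [Pi.zero_apply, ← h4, derivation]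
  simp_rw [Finset.sum_mul]
  conv_rhs => rw [Finset.sum_comm]
  refine Finset.sum_congr rfl fun p _ => ?_
  -- In the summand for `p` all other positions carry entries of the identity matrix, so only words
  -- that agree with `w` away from `p` contribute.
  have hinj : Function.Injective fun a => Function.update w p a := Function.update_injective w p
  rw [← Finset.sum_subset (Finset.subset_univ (Finset.univ.image fun a => Function.update w p a)),
    Finset.sum_image hinj.injOn]
  · refine Finset.sum_congr rfl fun a _ => ?_
    rw [Finset.prod_eq_one, Function.update_self, one_smul]
    intro q hq
    rw [Function.update_of_ne (Finset.ne_of_mem_erase hq), Matrix.one_apply_eq]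
  · intro u _ hu
    have : ∃ q, q ≠ p ∧ w q ≠ u q := by
      by_contra! h
      refine hu (Finset.mem_image.mpr ⟨u p, Finset.mem_univ _, ?_⟩)
      funext q
      rcases eq_or_ne q p with rfl | hq
      · simp
      · rw [Function.update_of_ne hq, h q hq]
    obtain ⟨q, hq, hne⟩ := this
    have h0 : ∏ r ∈ Finset.univ.erase p, (1 : Matrix (Letter l) (Letter l) ℂ) (w r) (u r) = 0 :=
      Finset.prod_eq_zero (i := q) (Finset.mem_erase.mpr ⟨hq, Finset.mem_univ q⟩)
        (Matrix.one_apply_ne hne)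
    rw [h0, zero_smul, zero_mul]

/-- Unitarian trick: the symplectic Lie algebra is closed under the conjugate transpose, so `X` is a
complex combination of the antihermitian elements `X - Xᴴ` and `i (X + Xᴴ)` of it. -/
theorem derivation_univ_eq_zero (x : (P → Letter l) → ℂ)
    (hx : ∀ A ∈ compactSp l, ∀ w, ∑ u : P → Letter l, (∏ p, A (w p) (u p)) * x u = x w)
    (X : Matrix (Letter l) (Letter l) ℂ)
    (hX : X * Matrix.J (Fin l) ℂ + Matrix.J (Fin l) ℂ * X.transpose = 0) :
    derivation Finset.univ X x = 0 := by
  have hJ2 : Matrix.J (Fin l) ℂ * Matrix.J (Fin l) ℂ = -1 := Matrix.J_squared _ _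
  have hJc : (Matrix.J (Fin l) ℂ).conjTranspose = -Matrix.J (Fin l) ℂ := by
    rw [Matrix.conjTranspose, Matrix.J_transpose, Matrix.map_neg _ (by simp)]
    congr 1
    exact Matrix.map_J (Fin l) (starRingEnd ℂ)
  have hXs : X.conjTranspose * Matrix.J (Fin l) ℂ +
      Matrix.J (Fin l) ℂ * X.conjTranspose.transpose = 0 := by
    have h1 := congrArg Matrix.conjTranspose hX
    simp only [Matrix.conjTranspose_add, Matrix.conjTranspose_mul, hJc,
      Matrix.conjTranspose_zero] at h1
    have h2 : X.transpose.conjTranspose = X.conjTranspose.transpose := rfl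
    rw [h2] at h1
    have h3 := congrArg (fun Y => Matrix.J (Fin l) ℂ * Y * Matrix.J (Fin l) ℂ) h1
    simp only [mul_add, add_mul, mul_zero, zero_mul] at h3
    have h4 : Matrix.J (Fin l) ℂ * (-Matrix.J (Fin l) ℂ * X.conjTranspose) * Matrix.J (Fin l) ℂ =
        X.conjTranspose * Matrix.J (Fin l) ℂ := by
      rw [neg_mul, mul_neg, ← Matrix.mul_assoc, hJ2]
      simp
    have h5 : Matrix.J (Fin l) ℂ * (X.conjTranspose.transpose * -Matrix.J (Fin l) ℂ) *
        Matrix.J (Fin l) ℂ = Matrix.J (Fin l) ℂ * X.conjTranspose.transpose := by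
      rw [mul_neg, mul_neg, neg_mul, Matrix.mul_assoc, Matrix.mul_assoc, hJ2]
      simp
    rw [← h3, h4, h5]
  set Y := X.conjTranspose with hY
  have hYc : Y.conjTranspose = X := Matrix.conjTranspose_conjTranspose X
  have hA := derivation_univ_eq_zero_of_antihermitian x hx (X - Y) (by
      rw [Matrix.transpose_sub, sub_mul, mul_sub, sub_add_sub_comm, hX, hXs, sub_zero]) (by
      rw [Matrix.conjTranspose_sub, hYc, ← hY, neg_sub])
  have hB := derivation_univ_eq_zero_of_antihermitian x hx (Complex.I • (X + Y)) (by
      rw [Matrix.transpose_smul, smul_mul_assoc, mul_smul_comm, ← smul_add, Matrix.transpose_add,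
        add_mul, mul_add, add_add_add_comm, hX, hXs, add_zero, smul_zero]) (by
      rw [Matrix.conjTranspose_smul, Matrix.conjTranspose_add, hYc, ← hY]
      simp [add_comm])
  funext u
  have hA' := congrFun hA u
  have hB' := congrFun hB u
  simp only [derivation, Matrix.sub_apply, Matrix.smul_apply, Matrix.add_apply, smul_eq_mul,
    Pi.zero_apply, mul_assoc, ← Finset.mul_sum, mul_eq_zero, Complex.I_ne_zero, false_or, add_mul,
    sub_mul, Finset.sum_add_distrib, Finset.sum_sub_distrib] at hA' hB' ⊢
  linear_combination (hA' + hB') / 2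

/-- An invariant tensor that is orthogonal to all basic invariants vanishes. -/
theorem eq_zero_of_invariant (x : (P → Letter l) → ℂ)
    (hx : ∀ A ∈ compactSp l, ∀ w, ∑ u : P → Letter l, (∏ p, A (w p) (u p)) * x u = x w)
    (hxτ : ∀ τ : Equiv.Perm P, IsMatching τ → ∑ w, pairing l τ w * x w = 0) : x = 0 := by
  refine eq_zero_of_contractions Finset.univ x (derivation_univ_eq_zero x hx) ?_
  intro τ hτ hne u
  simpa using hxτ τ ⟨hτ, by simpa using hne⟩

theorem pairing_eq_prod (τ : Equiv.Perm P) (w : P → Letter l) :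
    pairing l τ w = ∏ a : {p // p < τ p}, Matrix.J (Fin l) ℂ (w a) (w (τ a)) := by
  rw [pairing, ← Finset.prod_subtype_eq_prod_filter, Finset.subtype_univ]

/-- Basic invariants are invariant. -/
theorem sum_prod_mul_pairing {τ : Equiv.Perm P} (hτ : IsMatching τ)
    {A : Matrix (Letter l) (Letter l) ℂ} (hA : A ∈ Matrix.symplecticGroup (Fin l) ℂ)
    (w : P → Letter l) :
    ∑ u : P → Letter l, (∏ p, A (w p) (u p)) * pairing l τ u = pairing l τ w := by
  have hA' : ∀ i j, ∑ v : Bool → Letter l, (A i (v false) * A j (v true)) *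
      Matrix.J (Fin l) ℂ (v false) (v true) = Matrix.J (Fin l) ℂ i j := by
    intro i j
    have := congrFun (congrFun (SymplecticGroup.mem_iff.mp hA) i) j
    rw [← this, Matrix.mul_apply]
    simp only [Matrix.mul_apply, Finset.sum_mul, Matrix.transpose_apply]
    rw [Finset.sum_comm, ← Finset.sum_product', Finset.univ_product_univ]
    refine Fintype.sum_equiv (Equiv.boolArrowEquivProd _) _ _ fun v => ?_
    simp [Equiv.boolArrowEquivProd]
    ring
  rw [pairing_eq_prod]
  rw [Fintype.prod_congr _ _ fun a : {p // p < τ p} => (hA' (w a) (w (τ a))).symm]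
  rw [Finset.prod_univ_sum, Fintype.piFinset_univ]
  refine Fintype.sum_equiv ((Equiv.arrowCongr hτ.equiv.symm (Equiv.refl _)).trans
    (Equiv.curry _ _ _)) _ _ fun u => ?_
  rw [pairing_eq_prod, Finset.prod_mul_distrib]
  congr 1
  rw [← hτ.equiv.prod_comp, Fintype.prod_prod_type]
  refine Finset.prod_congr rfl fun a _ => ?_
  simp [mul_comm]

end Invariants

/-- The first fundamental theorem for the compact symplectic group: the invariants are spanned by
the basic invariants. -/
theorem invariants_eq_span (l N : ℕ) :
    invariants l N = Submodule.span ℂ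
      (basicInvariant l N '' {τ : Equiv.Perm (Fin N) | IsMatching τ}) := by
  have hmem : ∀ x, x ∈ invariants l N ↔ ∀ A ∈ compactSp l, ∀ w,
      ∑ u : Fin N → Letter l, (∏ p, A (w p) (u p)) * coords l N x u = coords l N x w := by
    intro x
    refine forall₂_congr fun A hA => ?_
    rw [← (coords l N).injective.eq_iff, funext_iff]
    simp_rw [coords_tensorAction]
  have hle : Submodule.span ℂ (basicInvariant l N '' {τ : Equiv.Perm (Fin N) | IsMatching τ}) ≤
      invariants l N := by
    rw [Submodule.span_le]
    rintro _ ⟨τ, hτ, rfl⟩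
    refine (hmem _).mpr fun A hA w => ?_
    rw [coords_basicInvariant]
    exact sum_prod_mul_pairing hτ (Submonoid.mem_inf.mp hA).1 w
  refine le_antisymm (fun x hx => ?_) hle
  let e : TensorSpace l N ≃ₗ[ℂ] EuclideanSpace ℂ (Fin N → Letter l) :=
    (coords l N).trans (WithLp.linearEquiv 2 ℂ _).symm
  set B := Submodule.span ℂ (basicInvariant l N '' {τ : Equiv.Perm (Fin N) | IsMatching τ})
  obtain ⟨y, hy, z, hz, hxyz⟩ := (B.map e.toLinearMap).exists_add_mem_mem_orthogonal (e x)
  obtain ⟨y', hy', rfl⟩ := hy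
  obtain ⟨z', rfl⟩ := e.surjective z
  have hx' : x = y' + z' := e.injective (by rw [map_add]; exact hxyz)
  have hz' : z' ∈ invariants l N := by
    have : z' = x - y' := by rw [hx', add_sub_cancel_left]
    rw [this]
    exact Submodule.sub_mem _ hx (hle hy')
  have hz0 : coords l N z' = 0 := by
    refine eq_zero_of_invariant _ ((hmem z').mp hz') fun τ hτ => ?_
    have := (Submodule.mem_orthogonal _ _).mp hz (e (basicInvariant l N τ))
      ⟨_, Submodule.subset_span ⟨τ, hτ, rfl⟩, rfl⟩
    rw [PiLp.inner_apply] at this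
    rw [← this]
    refine Finset.sum_congr rfl fun w _ => ?_
    -- The entries of `J` are real, so Hermitian orthogonality to a basic invariant is the vanishing
    -- of the bilinear full contraction.
    have hr : (starRingEnd ℂ) (pairing l τ w) = pairing l τ w := by
      rw [pairing, map_prod]
      refine Finset.prod_congr rfl fun p _ => ?_
      exact congrFun (congrFun (Matrix.map_J (Fin l) (starRingEnd ℂ)) (w p)) (w (τ p))
    simp [e, coords_basicInvariant, hr, mul_comm]
  rw [hx', (coords l N).map_eq_zero_iff.mp hz0, add_zero]
  exact hy'

/-! ### Young symmetrizers -/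

section Restrict

variable {P K : Type*} [Fintype P] [DecidableEq P]

open Classical in
/-- The permutation that agrees with `g` on `A` and fixes all points outside `A`
(for a set `A` that is preserved by `g`). -/
noncomputable def restrictPerm (A : Set P) (g : Equiv.Perm P) : Equiv.Perm P :=
  if h : ∀ p, g p ∈ A ↔ p ∈ A then Equiv.Perm.ofSubtype (g.subtypePerm h) else 1

open Classical in
theorem restrictPerm_apply {A : Set P} {g : Equiv.Perm P} (h : ∀ p, g p ∈ A ↔ p ∈ A) (p : P) :
    restrictPerm A g p = if p ∈ A then g p else p := by
  rw [restrictPerm, dif_pos h]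
  split_ifs with hp
  · exact Equiv.Perm.ofSubtype_subtypePerm_of_mem h hp
  · exact Equiv.Perm.ofSubtype_subtypePerm_of_not_mem h hp

theorem restrictPerm_apply_of_mem {A : Set P} {g : Equiv.Perm P} (h : ∀ p, g p ∈ A ↔ p ∈ A) {p : P}
    (hp : p ∈ A) : restrictPerm A g p = g p := by
  rw [restrictPerm_apply h, if_pos hp]

theorem restrictPerm_apply_of_notMem {A : Set P} {g : Equiv.Perm P} (h : ∀ p, g p ∈ A ↔ p ∈ A)
    {p : P} (hp : p ∉ A) : restrictPerm A g p = p := by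
  rw [restrictPerm_apply h, if_neg hp]

theorem restrictPerm_mul {A : Set P} {g h : Equiv.Perm P} (hg : ∀ p, g p ∈ A ↔ p ∈ A)
    (hh : ∀ p, h p ∈ A ↔ p ∈ A) :
    restrictPerm A (g * h) = restrictPerm A g * restrictPerm A h := by
  have hgh : ∀ p, (g * h) p ∈ A ↔ p ∈ A := fun p => (hg _).trans (hh p)
  ext p
  by_cases hp : p ∈ A
  · rw [restrictPerm_apply_of_mem hgh hp, Equiv.Perm.mul_apply, Equiv.Perm.mul_apply,
      restrictPerm_apply_of_mem hh hp, restrictPerm_apply_of_mem hg ((hh p).mpr hp)]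
  · rw [restrictPerm_apply_of_notMem hgh hp, Equiv.Perm.mul_apply,
      restrictPerm_apply_of_notMem hh hp, restrictPerm_apply_of_notMem hg hp]

theorem restrictPerm_mul_compl {A : Set P} {g : Equiv.Perm P} (hg : ∀ p, g p ∈ A ↔ p ∈ A) :
    restrictPerm A g * restrictPerm Aᶜ g = g := by
  have hg' : ∀ p, g p ∈ Aᶜ ↔ p ∈ Aᶜ := fun p => not_congr (hg p)
  ext p
  rw [Equiv.Perm.mul_apply]
  by_cases hp : p ∈ A
  · rw [restrictPerm_apply_of_notMem hg' (by simpa using hp), restrictPerm_apply_of_mem hg hp]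
  · rw [restrictPerm_apply_of_mem hg' hp,
      restrictPerm_apply_of_notMem hg (fun h => hp ((hg p).mp h))]

/-- The character of the Young subgroup of `s` that is the sign on the classes in `W` and trivial
on the others. -/
noncomputable def classSign (s : P → K) (W : Set K) (g : Equiv.Perm P) : ℤˣ :=
  Equiv.Perm.sign (restrictPerm {p | s p ∈ W} g)

variable {s : P → K} {W : Set K} {g h : Equiv.Perm P}

theorem mem_class_iff (hg : ∀ p, s (g p) = s p) (W : Set K) (p : P) :
    g p ∈ {p | s p ∈ W} ↔ p ∈ {p | s p ∈ W} := by
  simp [hg]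

theorem classSign_mul (hg : ∀ p, s (g p) = s p) (hh : ∀ p, s (h p) = s p) :
    classSign s W (g * h) = classSign s W g * classSign s W h := by
  rw [classSign, restrictPerm_mul (mem_class_iff hg W) (mem_class_iff hh W), Equiv.Perm.sign_mul]
  rfl

theorem classSign_eq_one (hg : ∀ p, s (g p) = s p) (h1 : ∀ p, s p ∈ W → g p = p) :
    classSign s W g = 1 := by
  have : restrictPerm {p | s p ∈ W} g = 1 := by
    ext p
    by_cases hp : p ∈ {p | s p ∈ W}
    · rw [restrictPerm_apply_of_mem (mem_class_iff hg W) hp, h1 p hp]; rfl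
    · rw [restrictPerm_apply_of_notMem (mem_class_iff hg W) hp]; rfl
  rw [classSign, this, Equiv.Perm.sign_one]

theorem classSign_eq_sign (hg : ∀ p, s (g p) = s p) (h1 : ∀ p, s p ∉ W → g p = p) :
    classSign s W g = Equiv.Perm.sign g := by
  have : restrictPerm {p | s p ∈ W} g = g := by
    ext p
    by_cases hp : p ∈ {p | s p ∈ W}
    · rw [restrictPerm_apply_of_mem (mem_class_iff hg W) hp]
    · rw [restrictPerm_apply_of_notMem (mem_class_iff hg W) hp, h1 p hp]
  rw [classSign, this]

theorem classSign_mul_compl (hg : ∀ p, s (g p) = s p) :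
    classSign s W g * classSign s Wᶜ g = Equiv.Perm.sign g := by
  conv_rhs => rw [← restrictPerm_mul_compl (mem_class_iff hg W), Equiv.Perm.sign_mul]
  rfl

theorem classSign_inv (hg : ∀ p, s (g p) = s p) : classSign s W g⁻¹ = classSign s W g := by
  have hg' : ∀ p, s (g⁻¹ p) = s p := fun p => by
    conv_rhs => rw [← g.apply_symm_apply p]
    exact (hg _).symm
  have := classSign_mul (W := W) hg hg'
  rw [mul_inv_cancel, classSign_eq_one (g := 1) (fun _ => rfl) (fun _ _ => rfl)] at this
  rw [← Int.units_inv_eq_self (classSign s W g)]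
  exact eq_inv_of_mul_eq_one_right this.symm

end Restrict

/-! ### The signed sum over a Young subgroup. -/

section Young

variable {P K L : Type*} [Fintype P] [DecidableEq P]

open Classical in
/-- The Young symmetrizer of `s`, antisymmetrizing the positions of each class in `W` and
symmetrizing those of each other class, in coordinates. -/
noncomputable def young (s : P → K) (W : Set K) (y : (P → L) → ℂ) (w : P → L) : ℂ :=
  ∑ g : Equiv.Perm P with ∀ p, s (g p) = s p, ((classSign s W g : ℤ) : ℂ) * y (fun p => w (g p))

/-- Reindexing the sum over the Young subgroup by right multiplication with `h` pulls out the value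
of the character at `h`. -/
theorem young_comp {s : P → K} {W : Set K} {h : Equiv.Perm P} (hh : ∀ p, s (h p) = s p)
    (y : (P → L) → ℂ) :
    young s W (fun w => y (fun p => w (h p))) = ((classSign s W h : ℤ) : ℂ) • young s W y := by
  funext w
  rw [Pi.smul_apply, young, young, smul_eq_mul, Finset.mul_sum]
  have hh' : ∀ p, s (h⁻¹ p) = s p := fun p => by
    conv_rhs => rw [← h.apply_symm_apply p]
    exact (hh _).symm
  refine Finset.sum_bij' (fun g _ => g * h) (fun g _ => g * h⁻¹) ?_ ?_ ?_ ?_ ?_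
  · intro g hg
    simp only [Finset.mem_filter, Finset.mem_univ, true_and] at hg ⊢
    exact fun p => (hg _).trans (hh p)
  · intro g hg
    simp only [Finset.mem_filter, Finset.mem_univ, true_and] at hg ⊢
    exact fun p => (hg _).trans (hh' p)
  · simp
  · simp
  · intro g hg
    have hg' : ∀ p, s (g p) = s p := by simpa using hg
    rw [classSign_mul hg' hh, ← mul_assoc]
    congr 1
    rw [Units.val_mul, mul_comm, Int.cast_mul, mul_assoc, ← Int.cast_mul,
      Int.units_coe_mul_self, Int.cast_one, mul_one]

theorem young_smul (s : P → K) (W : Set K) (c : ℂ) (y : (P → L) → ℂ) :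
    young s W (c • y) = c • young s W y := by
  funext w
  simp only [young, Pi.smul_apply, smul_eq_mul, Finset.mul_sum]
  exact Finset.sum_congr rfl fun _ _ => by ring

theorem young_sum {ι : Type*} (F : Finset ι) (s : P → K) (W : Set K) (y : ι → (P → L) → ℂ) :
    young s W (∑ i ∈ F, y i) = ∑ i ∈ F, young s W (y i) := by
  funext w
  simp only [young, Finset.sum_apply, Finset.mul_sum]
  exact Finset.sum_comm

end Young

/-! ### The projector in coordinates. -/

section Projector

variable {K : Type*} {l N : ℕ}

theorem permAction_mul (π ρ : Equiv.Perm (Fin N)) :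
    permAction l N π * permAction l N ρ = permAction l N (ρ * π) := by
  refine LinearMap.ext fun x => (coords l N).injective (funext fun w => ?_)
  rw [Module.End.mul_apply, coords_permAction, coords_permAction, coords_permAction]
  simp

-- A class-preserving permutation supported on the listed classes factors uniquely into permutations
-- supported on single classes, and `classSign` is multiplicative; so the product of the sums
-- expands to one sum.
open Classical in
theorem prod_young_factor (s : Fin N → K) (W : Set K) (Ls : List K) (hLs : Ls.Nodup) :
    (Ls.map fun x => ∑ g : Equiv.Perm (Fin N) with ∀ p, s p ≠ x → g p = p,
      ((classSign s W g : ℤ) : ℂ) • permAction l N g).prod =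
    ∑ g : Equiv.Perm (Fin N) with (∀ p, s (g p) = s p) ∧ ∀ p, s p ∉ Ls → g p = p,
      ((classSign s W g : ℤ) : ℂ) • permAction l N g := by
  have hclass : ∀ (x : K) (g : Equiv.Perm (Fin N)), (∀ p, s p ≠ x → g p = p) →
      ∀ p, s (g p) = s p := by
    intro x g hg p
    by_cases hp : s p = x
    · by_contra h
      have h1 : s (g p) ≠ x := fun h' => h (h'.trans hp.symm)
      have h2 := g.injective (hg _ h1)
      rw [h2] at h
      exact h rfl
    · rw [hg p hp]
  induction Ls with
  | nil =>
    rw [List.map_nil, List.prod_nil, Finset.sum_eq_single 1]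
    · rw [classSign_eq_one (fun _ => rfl) (fun _ _ => rfl)]
      refine LinearMap.ext fun x => (coords l N).injective (funext fun w => ?_)
      rw [LinearMap.smul_apply, map_smul, Pi.smul_apply, coords_permAction]
      simp
    · intro g hg hne
      refine absurd (Equiv.ext fun p => ?_) hne
      exact (Finset.mem_filter.mp hg).2.2 p (by simp)
    · simp
  | cons x Ls ih =>
    obtain ⟨hx, hLs'⟩ := List.nodup_cons.mp hLs
    rw [List.map_cons, List.prod_cons, ih hLs', Finset.sum_mul_sum, ← Finset.sum_product']
    have memx : ∀ k : Equiv.Perm (Fin N), (∀ p, s (k p) = s p) →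
        ∀ p, k p ∈ {p | s p = x} ↔ p ∈ {p | s p = x} := fun k hk p => by simp [hk]
    have memL : ∀ k : Equiv.Perm (Fin N), (∀ p, s (k p) = s p) →
        ∀ p, k p ∈ {p | s p ∈ Ls} ↔ p ∈ {p | s p ∈ Ls} := fun k hk p => by simp [hk]
    refine Finset.sum_bij' (fun a _ => a.2 * a.1)
      (fun k _ => (restrictPerm {p | s p = x} k, restrictPerm {p | s p ∈ Ls} k)) ?_ ?_ ?_ ?_ ?_
    · rintro ⟨g, h⟩ hgh
      simp only [Finset.mem_product, Finset.mem_filter, Finset.mem_univ, true_and] at hgh ⊢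
      obtain ⟨hg, hh, hh'⟩ := hgh
      refine ⟨fun p => (hh _).trans (hclass x g hg p), fun p hp => ?_⟩
      rw [List.mem_cons, not_or] at hp
      rw [Equiv.Perm.mul_apply, hg p hp.1, hh' p hp.2]
    · intro k hk
      simp only [Finset.mem_product, Finset.mem_filter, Finset.mem_univ, true_and] at hk ⊢
      obtain ⟨hk, -⟩ := hk
      refine ⟨fun p hp => restrictPerm_apply_of_notMem (memx k hk) hp, fun p => ?_,
        fun p hp => restrictPerm_apply_of_notMem (memL k hk) hp⟩
      by_cases hp : p ∈ {p | s p ∈ Ls}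
      · rw [restrictPerm_apply_of_mem (memL k hk) hp, hk]
      · rw [restrictPerm_apply_of_notMem (memL k hk) hp]
    · rintro ⟨g, h⟩ hgh
      simp only [Finset.mem_product, Finset.mem_filter, Finset.mem_univ, true_and] at hgh
      obtain ⟨hg, hh, hh'⟩ := hgh
      have hgc := hclass x g hg
      have hk : ∀ p, s ((h * g) p) = s p := fun p => (hh _).trans (hgc p)
      refine Prod.ext (Equiv.ext fun p => ?_) (Equiv.ext fun p => ?_)
      · dsimp only
        by_cases hp : p ∈ {p | s p = x}
        · rw [restrictPerm_apply_of_mem (memx _ hk) hp, Equiv.Perm.mul_apply, hh']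
          rw [hgc, show s p = x from hp]
          exact hx
        · rw [restrictPerm_apply_of_notMem (memx _ hk) hp, hg p hp]
      · dsimp only
        by_cases hp : p ∈ {p | s p ∈ Ls}
        · rw [restrictPerm_apply_of_mem (memL _ hk) hp, Equiv.Perm.mul_apply, hg]
          rintro rfl
          exact hx hp
        · rw [restrictPerm_apply_of_notMem (memL _ hk) hp, hh' p hp]
    · intro k hk
      simp only [Finset.mem_filter, Finset.mem_univ, true_and] at hk
      obtain ⟨hk, hk'⟩ := hk
      refine Equiv.ext fun p => ?_
      rw [Equiv.Perm.mul_apply]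
      by_cases hp : p ∈ {p | s p = x}
      · rw [restrictPerm_apply_of_mem (memx _ hk) hp, restrictPerm_apply_of_notMem (memL _ hk)]
        simp only [Set.mem_ofPred_eq, hk]
        rw [show s p = x from hp]
        exact hx
      · rw [restrictPerm_apply_of_notMem (memx _ hk) hp]
        by_cases hp' : p ∈ {p | s p ∈ Ls}
        · rw [restrictPerm_apply_of_mem (memL _ hk) hp']
        · rw [restrictPerm_apply_of_notMem (memL _ hk) hp', hk']
          rw [List.mem_cons, not_or]
          exact ⟨hp, hp'⟩
    · rintro ⟨g, h⟩ hgh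
      simp only [Finset.mem_product, Finset.mem_filter, Finset.mem_univ, true_and] at hgh
      obtain ⟨hg, hh, -⟩ := hgh
      dsimp only
      rw [smul_mul_smul_comm, permAction_mul, classSign_mul hh (hclass x g hg), mul_comm]
      push_cast
      rfl

/-- The projector acts as the Young symmetrizer. -/
theorem coords_projector {k : ℕ} (W : Set (Fin k)) (ν : Fin k → ℕ) (b : ℕ)
    (s : Fin (∑ i, ν i + b) → WithTop (Fin k)) (hs : ∀ p x, p ∈ part ν b x ↔ s p = x)
    (x : TensorSpace l (∑ i, ν i + b)) :
    coords l _ (projector l W ν b x) = young s (WithTop.some '' W) (coords l _ x) := by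
  classical
  have hclass : ∀ (x : WithTop (Fin k)) (g : Equiv.Perm (Fin (∑ i, ν i + b))),
      (∀ p, s p ≠ x → g p = p) → ∀ p, s (g p) = s p := by
    intro x g hg p
    by_cases hp : s p = x
    · by_contra h
      have h1 : s (g p) ≠ x := fun h' => h (h'.trans hp.symm)
      have h2 := g.injective (hg _ h1)
      rw [h2] at h
      exact h rfl
    · rw [hg p hp]
  have hA : ∀ x ∈ WithTop.some '' W, antisymmetrizer l _ (part ν b x) =
      ∑ g : Equiv.Perm (Fin (∑ i, ν i + b)) with ∀ p, s p ≠ x → g p = p,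
        ((classSign s (WithTop.some '' W) g : ℤ) : ℂ) • permAction l _ g := by
    intro x hx
    rw [antisymmetrizer]
    simp only [hs]
    refine Finset.sum_congr rfl fun g hg => ?_
    have hg' : ∀ p, s p ≠ x → g p = p := by simpa using hg
    rw [classSign_eq_sign (hclass x g hg')]
    intro p hp
    exact hg' p (by rintro rfl; exact hp hx)
  have hH : ∀ x ∉ WithTop.some '' W, symmetrizer l _ (part ν b x) =
      ∑ g : Equiv.Perm (Fin (∑ i, ν i + b)) with ∀ p, s p ≠ x → g p = p,
        ((classSign s (WithTop.some '' W) g : ℤ) : ℂ) • permAction l _ g := by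
    intro x hx
    rw [symmetrizer]
    simp only [hs]
    refine Finset.sum_congr rfl fun g hg => ?_
    have hg' : ∀ p, s p ≠ x → g p = p := by simpa using hg
    rw [classSign_eq_one (hclass x g hg')]
    · simp
    intro p hp
    exact hg' p (by rintro rfl; exact hx hp)
  have hprod := prod_young_factor (l := l) s (WithTop.some '' W)
    ((List.finRange k).map WithTop.some ++ [⊤]) (by
      rw [List.nodup_append]
      refine ⟨(List.nodup_finRange k).map WithTop.coe_injective, List.nodup_singleton _, ?_⟩
      simp)
  have : projector l W ν b = ∑ g : Equiv.Perm (Fin (∑ i, ν i + b)) with ∀ p, s (g p) = s p,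
      ((classSign s (WithTop.some '' W) g : ℤ) : ℂ) • permAction l _ g := by
    have hall : ∀ y : WithTop (Fin k), y ∈ (List.finRange k).map WithTop.some ++ [⊤] := by
      intro y
      induction y <;> simp
    simp only [hall, not_true_eq_false, false_implies, implies_true, and_true] at hprod
    rw [← hprod, projector, List.map_append, List.prod_append, List.map_map]
    congr 1
    · congr 1
      refine List.map_congr_left fun i _ => ?_
      rw [Function.comp_apply]
      split_ifs with hi
      · convert hA _ (Set.mem_image_of_mem _ hi)
      · convert hH i ?_
        rintro ⟨j, hj, hji⟩
        rw [WithTop.coe_injective hji] at hj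
        exact hi hj
    · rw [hH ⊤ (by rintro ⟨j, _, hj⟩; exact WithTop.coe_ne_top hj)]
      simp
  rw [this]
  funext w
  rw [LinearMap.sum_apply, map_sum, Finset.sum_apply, young]
  -- In coordinates `permAction` composes words with the inverse permutation, hence the inversion.
  refine Finset.sum_bij' (fun g _ => g⁻¹) (fun g _ => g⁻¹) ?_ ?_ ?_ ?_ ?_
  · intro g hg
    simp only [Finset.mem_filter, Finset.mem_univ, true_and] at hg ⊢
    intro p
    rw [← hg (g⁻¹ p)]
    simp
  · intro g hg
    simp only [Finset.mem_filter, Finset.mem_univ, true_and] at hg ⊢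
    intro p
    rw [← hg (g⁻¹ p)]
    simp
  · simp
  · simp
  · intro g hg
    have hg' : ∀ p, s (g p) = s p := by simpa using hg
    rw [LinearMap.smul_apply, map_smul, Pi.smul_apply, coords_permAction, classSign_inv hg',
      smul_eq_mul]

end Projector

/-! ### Conjugacy of matchings -/

section Conjugacy

variable {P C : Type*} [Fintype P] [LinearOrder P]

/-- A choice of one end of each arc of a matching: the end in the smaller class, or the smaller
end if both classes agree. -/
def IsHead [LinearOrder C] (c : P → C) (τ : Equiv.Perm P) (p : P) : Prop :=
  c p < c (τ p) ∨ c p = c (τ p) ∧ p < τ p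

theorem isHead_apply_iff [LinearOrder C] (c : P → C) {τ : Equiv.Perm P} (hτ : IsMatching τ) (p : P) :
    IsHead c τ (τ p) ↔ ¬ IsHead c τ p := by
  have := hτ.ne p
  rw [IsHead, IsHead, hτ.invol]
  rcases lt_trichotomy (c p) (c (τ p)) with h | h | h
  · simp [h, h.asymm, h.ne']
  · simp only [h, lt_irrefl, false_or, true_and, not_lt]
    exact ⟨le_of_lt, fun h => lt_of_le_of_ne h this⟩
  · simp [h, h.asymm, h.ne']

open Classical in
theorem two_mul_card_isHead [LinearOrder C] (c : P → C) {τ : Equiv.Perm P} (hτ : IsMatching τ)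
    (x : C) : 2 * #{p | IsHead c τ p ∧ c p = x ∧ c (τ p) = x} = #{p | c p = x ∧ c (τ p) = x} := by
  rw [← Finset.card_filter_add_card_filter_not (s := {p | c p = x ∧ c (τ p) = x}) (IsHead c τ),
    Finset.filter_filter, Finset.filter_filter, two_mul]
  congr 1
  · congr 1
    ext p
    simp only [Finset.mem_filter]
    tauto
  · refine Finset.card_bij' (fun p _ => τ p) (fun p _ => τ p) ?_ ?_ ?_ ?_
    · intro p hp
      simp only [Finset.mem_filter, Finset.mem_univ, true_and] at hp ⊢
      rw [isHead_apply_iff c hτ, hτ.invol]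
      tauto
    · intro p hp
      simp only [Finset.mem_filter, Finset.mem_univ, true_and] at hp ⊢
      rw [isHead_apply_iff c hτ, hτ.invol]
      tauto
    · simp [hτ.invol]
    · simp [hτ.invol]

-- Every arc between distinct classes has its head in the smaller class, and an arc within a class
-- has exactly one of its two ends as head; both numbers are determined by the counts in `hcount`.
open Classical in
theorem card_isHead_congr [LinearOrder C] (c : P → C) {τ τ' : Equiv.Perm P} (hτ : IsMatching τ)
    (hτ' : IsMatching τ')
    (hcount : ∀ x y, #{p | c p = x ∧ c (τ p) = y} = #{p | c p = x ∧ c (τ' p) = y}) (x y : C) :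
    #{p | IsHead c τ p ∧ c p = x ∧ c (τ p) = y} =
      #{p | IsHead c τ' p ∧ c p = x ∧ c (τ' p) = y} := by
  rcases lt_trichotomy x y with h | rfl | h
  · have key : ∀ σ : Equiv.Perm P, (Finset.univ.filter fun p => IsHead c σ p ∧ c p = x ∧ c (σ p) = y) =
        Finset.univ.filter fun p => c p = x ∧ c (σ p) = y := by
      intro σ
      ext p
      simp only [Finset.mem_filter, Finset.mem_univ, true_and, and_iff_right_iff_imp]
      rintro ⟨rfl, rfl⟩
      exact Or.inl h
    rw [key, key, hcount]
  · have h1 := two_mul_card_isHead c hτ x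
    have h2 := two_mul_card_isHead c hτ' x
    have h3 := hcount x x
    omega
  · have key : ∀ σ : Equiv.Perm P, (Finset.univ.filter fun p => IsHead c σ p ∧ c p = x ∧ c (σ p) = y) =
        ∅ := by
      intro σ
      ext p
      simp only [Finset.mem_filter, Finset.mem_univ, true_and, Finset.notMem_empty, iff_false]
      rintro ⟨h1 | h1, rfl, rfl⟩
      · exact h.asymm h1
      · exact h.ne' h1.1
    rw [key, key]

open Classical in
/-- Two matchings with the same numbers of arcs between any two classes are conjugate by a
permutation that preserves the classes. -/
theorem exists_conj (c : P → C) {τ τ' : Equiv.Perm P} (hτ : IsMatching τ) (hτ' : IsMatching τ')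
    (hcount : ∀ x y, #{p | c p = x ∧ c (τ p) = y} = #{p | c p = x ∧ c (τ' p) = y}) :
    ∃ h : Equiv.Perm P, (∀ p, c (h p) = c p) ∧ ∀ p, h (τ p) = τ' (h p) := by
  -- The choice of the order is immaterial: it only selects one head on each arc. Heads are matched
  -- fibrewise over the pair of classes of their arc, and the tails follow.
  let _ : LinearOrder C := IsWellOrder.linearOrder WellOrderingRel
  let f : Equiv.Perm P → P → C × C := fun σ p => (c p, c (σ p))
  have hfib : ∀ z : C × C, Nonempty ({a : {p // IsHead c τ p} // f τ a = z} ≃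
      {a : {p // IsHead c τ' p} // f τ' a = z}) := by
    rintro ⟨x, y⟩
    refine Fintype.card_eq.mp ?_
    have h0 : ∀ σ : Equiv.Perm P, Fintype.card {a : {p // IsHead c σ p} // f σ a = (x, y)} =
        #{p | IsHead c σ p ∧ c p = x ∧ c (σ p) = y} := by
      intro σ
      rw [Fintype.card_congr (Equiv.subtypeSubtypeEquivSubtypeInter _ (fun p => f σ p = (x, y))),
        Fintype.card_subtype]
      congr 1
      ext p
      simp [f]
    rw [h0, h0]
    exact card_isHead_congr c hτ hτ' (fun x y => by convert hcount x y) x y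
  let e := fun z => Classical.choice (hfib z)
  let θ : {p // IsHead c τ p} ≃ {p // IsHead c τ' p} :=
    Equiv.ofFiberEquiv (f := fun a : {p // IsHead c τ p} => f τ a)
      (g := fun a : {p // IsHead c τ' p} => f τ' a) e
  have hθ : ∀ a, f τ' (θ a) = f τ a := fun a =>
    Equiv.ofFiberEquiv_map (f := fun a : {p // IsHead c τ p} => f τ a)
      (g := fun a : {p // IsHead c τ' p} => f τ' a) e a
  have hθ1 : ∀ a, c (θ a) = c a := fun a => congrArg Prod.fst (hθ a)
  have hθ2 : ∀ a, c (τ' (θ a)) = c (τ a) := fun a => congrArg Prod.snd (hθ a)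
  have hn : ∀ {p}, ¬ IsHead c τ p → IsHead c τ (τ p) := fun {p} hp =>
    (isHead_apply_iff c hτ p).mpr hp
  let h : P → P := fun p => if hp : IsHead c τ p then θ ⟨p, hp⟩ else τ' (θ ⟨τ p, hn hp⟩)
  have hpos : ∀ p (hp : IsHead c τ p), h p = θ ⟨p, hp⟩ := fun p hp => dif_pos hp
  have hneg : ∀ p (hp : ¬ IsHead c τ p), h p = τ' (θ ⟨τ p, hn hp⟩) := fun p hp => dif_neg hp
  have hhead : ∀ p, IsHead c τ' (h p) ↔ IsHead c τ p := by
    intro p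
    by_cases hp : IsHead c τ p
    · rw [hpos p hp]
      exact iff_of_true (θ ⟨p, hp⟩).2 hp
    · rw [hneg p hp, isHead_apply_iff c hτ']
      exact iff_of_false (not_not.mpr (θ ⟨τ p, hn hp⟩).2) hp
  have hinj : Function.Injective h := by
    intro p q hpq
    have hiff : IsHead c τ p ↔ IsHead c τ q := by rw [← hhead, ← hhead, hpq]
    by_cases hp : IsHead c τ p
    · have hq := hiff.mp hp
      rw [hpos p hp, hpos q hq] at hpq
      exact congrArg Subtype.val (θ.injective (Subtype.ext hpq))
    · have hq := fun h => hp (hiff.mpr h)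
      rw [hneg p hp, hneg q hq] at hpq
      exact τ.injective (congrArg Subtype.val (θ.injective (Subtype.ext (τ'.injective hpq))))
  refine ⟨Equiv.ofBijective h (Finite.injective_iff_bijective.mp hinj), fun p => ?_, fun p => ?_⟩
  · rw [Equiv.ofBijective_apply]
    by_cases hp : IsHead c τ p
    · rw [hpos p hp, hθ1]
    · rw [hneg p hp, hθ2, hτ.invol]
  · rw [Equiv.ofBijective_apply, Equiv.ofBijective_apply]
    by_cases hp : IsHead c τ p
    · have hp' : ¬ IsHead c τ (τ p) := fun h => (isHead_apply_iff c hτ p).mp h hp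
      rw [hneg _ hp', hpos p hp]
      simp only [hτ.invol]
    · rw [hneg p hp, hpos _ (hn hp), hτ'.invol]

end Conjugacy

/-! ### Admissible matchings -/

section Admissible

variable {P K : Type*} [Fintype P] [LinearOrder P] {s : P → K} {W : Set K} {τ : Equiv.Perm P}

/-- The matchings whose basic invariants are not killed by the Young symmetrizer: arcs within a
class occur only in classes of `W`, and there is at most one arc between a class in `W` and a
class not in `W`. -/
structure IsAdmissible (s : P → K) (W : Set K) (τ : Equiv.Perm P) : Prop extends IsMatching τ where
  inner : ∀ p, s p = s (τ p) → s p ∈ W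
  cross : ∀ p q, s p ∈ W → s (τ p) ∉ W → s q = s p → s (τ q) = s (τ p) → q = p

/-- An automorphism of the matching multiplies the pairing by its sign, while the symmetrizer sees
`classSign`. If the two differ, the symmetrized tensor is its own negative. -/
theorem young_pairing_eq_zero_of_commute {l : ℕ} (hτ : IsMatching τ) (z : Equiv.Perm P)
    (hz : ∀ p, z (τ p) = τ (z p)) (hs : ∀ p, s (z p) = s p)
    (hsign : classSign s W z = -Equiv.Perm.sign z) : young s W (pairing l τ) = 0 := by
  have h1 := young_comp (W := W) hs (pairing l τ)
  have h2 : (fun w : P → Letter l => pairing l τ fun p => w (z p)) =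
      ((Equiv.Perm.sign z : ℤ) : ℂ) • pairing l τ := by
    funext w
    rw [pairing_comp_of_commute hτ z hz]
    rfl
  rw [h2, young_smul, hsign] at h1
  rcases Int.units_eq_one_or (Equiv.Perm.sign z) with h | h <;>
  · rw [h] at h1
    simp only [Units.val_neg, Units.val_one, Int.cast_neg, Int.cast_one, one_smul, neg_smul,
      neg_neg] at h1
    exact self_eq_neg.mp (by first | exact h1 | exact h1.symm)

/-- Each violation of admissibility supplies an automorphism of the wrong sign: exchanging the ends
of an arc inside a symmetrized class is odd with trivial character; exchanging two arcs between a
class in `W` and one outside is even with character `-1`. -/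
theorem young_pairing_eq_zero {l : ℕ} (hτ : IsMatching τ) (hn : ¬ IsAdmissible s W τ) :
    young s W (pairing l τ) = 0 := by
  by_contra hne
  refine hn ⟨hτ, fun p hp => ?_, fun p q hpW hpW' hq hq' => ?_⟩
  · by_contra hpW
    refine hne (young_pairing_eq_zero_of_commute hτ (Equiv.swap p (τ p)) ?_ ?_ ?_)
    · intro q
      rcases eq_or_ne q p with rfl | h1
      · simp [hτ.invol]
      rcases eq_or_ne q (τ p) with rfl | h2
      · simp [hτ.invol]
      rw [Equiv.swap_apply_of_ne_of_ne h1 h2, Equiv.swap_apply_of_ne_of_ne]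
      · rintro rfl
        exact h2 (hτ.invol q).symm
      · exact fun h => h1 (τ.injective h)
    · intro q
      rcases eq_or_ne q p with rfl | h1
      · simp [hp]
      rcases eq_or_ne q (τ p) with rfl | h2
      · simp [hp]
      rw [Equiv.swap_apply_of_ne_of_ne h1 h2]
    · rw [classSign_eq_one, Equiv.Perm.sign_swap (hτ.ne p).symm, neg_neg]
      · intro q
        rcases eq_or_ne q p with rfl | h1
        · simp [hp]
        rcases eq_or_ne q (τ p) with rfl | h2
        · simp [hp]
        rw [Equiv.swap_apply_of_ne_of_ne h1 h2]
      · intro q hq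
        refine Equiv.swap_apply_of_ne_of_ne ?_ ?_
        · rintro rfl
          exact hpW hq
        · rintro rfl
          exact hpW (hp ▸ hq)
  · by_contra hqp
    have hqp' : τ q ≠ τ p := fun h => hqp (τ.injective h)
    have n1 : p ≠ τ p := (hτ.ne p).symm
    have n2 : q ≠ τ q := (hτ.ne q).symm
    have n3 : p ≠ τ q := fun h => hpW' (hq' ▸ h ▸ hpW)
    have n4 : q ≠ τ p := fun h => hpW' (h ▸ hq.symm ▸ hpW)
    have s1 : ∀ r, s (Equiv.swap p q r) = s r := by
      intro r
      rw [Equiv.swap_apply_def]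
      split_ifs with h1 h2
      · rw [h1, hq]
      · rw [h2, hq]
      · rfl
    have s2 : ∀ r, s (Equiv.swap (τ p) (τ q) r) = s r := by
      intro r
      rw [Equiv.swap_apply_def]
      split_ifs with h1 h2
      · rw [h1, hq']
      · rw [h2, hq']
      · rfl
    refine hne (young_pairing_eq_zero_of_commute hτ
      (Equiv.swap p q * Equiv.swap (τ p) (τ q)) ?_ ?_ ?_)
    · intro r
      simp only [Equiv.Perm.mul_apply]
      rcases eq_or_ne r p with rfl | h1
      · rw [Equiv.swap_apply_left, Equiv.swap_apply_of_ne_of_ne n3.symm n2.symm,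
          Equiv.swap_apply_of_ne_of_ne n1 n3, Equiv.swap_apply_left]
      rcases eq_or_ne r q with rfl | h2
      · rw [Equiv.swap_apply_right, Equiv.swap_apply_of_ne_of_ne n1.symm n4.symm,
          Equiv.swap_apply_of_ne_of_ne n4 n2, Equiv.swap_apply_right]
      rcases eq_or_ne r (τ p) with rfl | h3
      · rw [hτ.invol, Equiv.swap_apply_of_ne_of_ne n1 n3, Equiv.swap_apply_left,
          Equiv.swap_apply_left, Equiv.swap_apply_of_ne_of_ne n3.symm n2.symm, hτ.invol]
      rcases eq_or_ne r (τ q) with rfl | h4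
      · rw [hτ.invol, Equiv.swap_apply_of_ne_of_ne n4 n2, Equiv.swap_apply_right,
          Equiv.swap_apply_right, Equiv.swap_apply_of_ne_of_ne n1.symm n4.symm, hτ.invol]
      have m1 : τ r ≠ p := fun h => h3 (by rw [← h, hτ.invol])
      have m2 : τ r ≠ q := fun h => h4 (by rw [← h, hτ.invol])
      have m3 : τ r ≠ τ p := fun h => h1 (τ.injective h)
      have m4 : τ r ≠ τ q := fun h => h2 (τ.injective h)
      rw [Equiv.swap_apply_of_ne_of_ne m3 m4, Equiv.swap_apply_of_ne_of_ne m1 m2,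
        Equiv.swap_apply_of_ne_of_ne h3 h4, Equiv.swap_apply_of_ne_of_ne h1 h2]
    · exact fun r => (s1 _).trans (s2 r)
    · rw [classSign_mul s1 s2, Equiv.Perm.sign_mul, Equiv.Perm.sign_swap (Ne.symm hqp),
        Equiv.Perm.sign_swap hqp'.symm, classSign_eq_sign s1, classSign_eq_one s2,
        Equiv.Perm.sign_swap (Ne.symm hqp)]
      · simp
      · intro r hr
        refine Equiv.swap_apply_of_ne_of_ne ?_ ?_
        · rintro rfl
          exact hpW' hr
        · rintro rfl
          exact hpW' (hq' ▸ hr)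
      · intro r hr
        refine Equiv.swap_apply_of_ne_of_ne ?_ ?_
        · rintro rfl
          exact hr hpW
        · rintro rfl
          exact hr (hq ▸ hpW)

/-- An automorphism of an admissible matching that preserves the classes has sign `1` on the
classes not in `W`. -/
theorem classSign_compl_eq_one [LinearOrder K] (hτ : IsAdmissible s W τ) (z : Equiv.Perm P)
    (hmono : ∀ p q, s p < s q → p < q)
    (hz : ∀ p, z (τ p) = τ (z p)) (hs : ∀ p, s (z p) = s p) : classSign s Wᶜ z = 1 := by
  have hmem := mem_class_iff hs Wᶜ
  set z' := restrictPerm {p | s p ∈ Wᶜ} z with hz'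
  have hin : ∀ p, s p ∉ W → z' p = z p := fun p hp => restrictPerm_apply_of_mem hmem hp
  have hout : ∀ p, s p ∈ W → z' p = p := fun p hp =>
    restrictPerm_apply_of_notMem hmem (fun h => h hp)
  have hcross : ∀ p, s p ∈ W → s (τ p) ∉ W → z p = p := fun p h1 h2 =>
    hτ.cross p (z p) h1 h2 (hs p) (by rw [← hz, hs])
  have hcross' : ∀ p, s p ∉ W → s (τ p) ∈ W → z p = p := fun p h1 h2 => by
    have := hcross (τ p) h2 (by rwa [hτ.invol])
    rw [hz] at this
    exact τ.injective this
  have hs' : ∀ p, s (z' p) = s p := fun p => by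
    by_cases hp : s p ∈ W
    · rw [hout p hp]
    · rw [hin p hp, hs]
  refine sign_eq_one_of_commute hτ.toIsMatching z' (fun p => ?_) fun p hp => ?_
  · by_cases h1 : s p ∈ W <;> by_cases h2 : s (τ p) ∈ W
    · rw [hout p h1, hout _ h2]
    · rw [hout p h1, hin _ h2, hz, hcross p h1 h2]
    · rw [hin p h1, hout _ h2, hcross' p h1 h2]
    · rw [hin p h1, hin _ h2, hz]
  · by_cases h1 : s p ∈ W
    · rwa [hout p h1]
    · by_cases h2 : s (τ p) ∈ W
      · rwa [hin p h1, hcross' p h1 h2]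
      -- Outside `W` the ends of an arc lie in different classes, so their order is the order of the
      -- classes, which `z` preserves.
      · have hne : s p ≠ s (τ p) := fun h => h1 (hτ.inner p h)
        have hlt : s p < s (τ p) := by
          refine lt_of_le_of_ne (not_lt.mp fun h => ?_) hne
          exact (hmono _ _ h).asymm hp
        refine hmono _ _ ?_
        rw [hin p h1, ← hz, hs, hs]
        exact hlt

end Admissible

/-! ### Standardization -/

section Standardization

variable {P K : Type*} [Fintype P] [LinearOrder P] [LinearOrder K]

/-- A ranking of the positions that refines the order of the classes and along which the
involution `σ` is decreasing on each class in `W` and increasing on each other class. -/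
structure IsStandardRank (s : P → K) (W : Set K) (σ : P → P) (r : P → ℕ) : Prop where
  inj : Function.Injective r
  mono : ∀ p q, s p < s q → r p < r q
  anti : ∀ p q, s p = s q → s p ∈ W → r p < r q → r (σ q) < r (σ p)
  incr : ∀ p q, s p = s q → s p ∉ W → r p < r q → r (σ p) < r (σ q)

theorem IsStandardRank.le {s : P → K} {W : Set K} {σ : P → P} {r : P → ℕ}
    (h : IsStandardRank s W σ r) {p q : P} (hpq : r p ≤ r q) : s p ≤ s q :=
  not_lt.mp fun h' => (h.mono _ _ h').not_ge hpq

theorem exists_rank {R : Type*} [LinearOrder R] (key : P → R) (hkey : Function.Injective key) :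
    ∃ r : P → ℕ, Function.Injective r ∧ ∀ p q, r p < r q ↔ key p < key q := by
  have h1 : ∀ p q, key p ≤ key q → #{x | key x < key p} ≤ #{x | key x < key q} := fun p q h =>
    Finset.card_le_card fun x hx => by
      simp only [Finset.mem_filter, Finset.mem_univ, true_and] at hx ⊢
      exact hx.trans_le h
  have h2 : ∀ p q, key p < key q → #{x | key x < key p} < #{x | key x < key q} := fun p q h =>
    Finset.card_lt_card ⟨fun x hx => by
      simp only [Finset.mem_filter, Finset.mem_univ, true_and] at hx ⊢
      exact hx.trans h, fun h' => by
        have := h' (show p ∈ _ by simpa using h)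
        simp at this⟩
  have h3 : ∀ p q, #{x | key x < key p} < #{x | key x < key q} ↔ key p < key q := fun p q =>
    ⟨fun h => not_le.mp fun h' => (h1 q p h').not_gt h, h2 p q⟩
  refine ⟨fun p => #{x | key x < key p}, fun p q hpq => hkey ?_, h3⟩
  by_contra hne
  rcases lt_or_gt_of_ne hne with h | h
  · exact (h2 _ _ h).ne hpq
  · exact (h2 _ _ h).ne hpq.symm

-- Sort by class, then by the class of the partner (descending in `W`, ascending elsewhere), and
-- break ties among the ends of arcs between the same two classes. The ties must be broken
-- consistently at both ends: oppositely within `W`, equally outside `W`. Between `W` and its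
-- complement no tie occurs, by `hcross`.
open Classical in
theorem exists_isStandardRank [Fintype K] (s : P → K) (W : Set K) (σ : P → P)
    (hσ : ∀ p, σ (σ p) = p) (hin : ∀ p, s p = s (σ p) → s p ∉ W → σ p = p)
    (hcross : ∀ p q, s p ∈ W → s (σ p) ∉ W → s q = s p → s (σ q) = s (σ p) → q = p)
    (hfix : ∀ p q, s p ∈ W → σ p = p → σ q = q → s q = s p → q = p) :
    ∃ r : P → ℕ, IsStandardRank s W σ r := by
  obtain ⟨v, -, hv⟩ := exists_rank (fun x : K => x) (fun _ _ h => h)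
  obtain ⟨i, hi, -⟩ := exists_rank (fun x : P => x) (fun _ _ h => h)
  have hvinj : ∀ x y, v x = v y → x = y := fun x y h => by
    rcases lt_trichotomy x y with h' | h' | h'
    · have := (hv _ _).mpr h'; omega
    · exact h'
    · have := (hv _ _).mpr h'; omega
  obtain ⟨n, hn⟩ : ∃ n : ℕ, ∀ p, i p < n := by
    refine ⟨Finset.univ.sup i + 1, fun p => Nat.lt_succ_of_le (Finset.le_sup (Finset.mem_univ p))⟩
  let e : P → ℤ := fun p => if s p ∈ W then -(v (s (σ p)) : ℤ) else v (s (σ p))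
  -- In `W` the tie-breaker changes sign under `σ` (`htneg`): the bound `n` makes it negative at the
  -- left end, positive at the right end, and a fixed point gets `0`. Outside `W` it is symmetric in
  -- the two ends.
  let t : P → ℤ := fun p => if s p ∈ W then
      (if i p < i (σ p) then (i p : ℤ) - n else if i (σ p) < i p then n - (i (σ p) : ℤ) else 0)
    else min (i p : ℤ) (i (σ p))
  let key : P → K ×ₗ (ℤ ×ₗ ℤ) := fun p => toLex (s p, toLex (e p, t p))
  have hlt : ∀ p q, key p < key q ↔ s p < s q ∨ s p = s q ∧ (e p < e q ∨ e p = e q ∧ t p < t q) := by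
    intro p q
    simp only [key, Prod.Lex.toLex_lt_toLex]
  have htW : ∀ p, s p ∈ W → t p =
      (if i p < i (σ p) then (i p : ℤ) - n else if i (σ p) < i p then n - (i (σ p) : ℤ) else 0) :=
    fun p hp => if_pos hp
  have htN : ∀ p, s p ∉ W → t p = min (i p : ℤ) (i (σ p)) := fun p hp => if_neg hp
  have heW : ∀ p, s p ∈ W → e p = -(v (s (σ p)) : ℤ) := fun p hp => if_pos hp
  have heN : ∀ p, s p ∉ W → e p = v (s (σ p)) := fun p hp => if_neg hp
  have htneg : ∀ p, s p ∈ W → s (σ p) ∈ W → t (σ p) = -t p := by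
    intro p h1 h2
    rw [htW p h1, htW _ h2, hσ]
    split_ifs <;> omega
  have hes : ∀ p q, s p = s q → e p = e q → s (σ p) = s (σ q) := by
    intro p q h1 h2
    refine hvinj _ _ ?_
    by_cases hp : s p ∈ W
    · rw [heW p hp, heW q (h1 ▸ hp)] at h2
      omega
    · rw [heN p hp, heN q (h1 ▸ hp)] at h2
      omega
  have hinj : Function.Injective key := by
    intro p q hpq
    have h1 : s p = s q := congrArg (fun x => (ofLex x).1) hpq
    have h2 : e p = e q := congrArg (fun x => (ofLex (ofLex x).2).1) hpq
    have h3 : t p = t q := congrArg (fun x => (ofLex (ofLex x).2).2) hpq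
    have h4 := hes p q h1 h2
    by_cases hp : s p ∈ W
    · rw [htW p hp, htW q (h1 ▸ hp)] at h3
      have a1 := hn p
      have a2 := hn q
      have a3 := hn (σ p)
      have a4 := hn (σ q)
      have key1 : i p = i q ∨ i (σ p) = i (σ q) ∨ (i (σ p) = i p ∧ i (σ q) = i q) := by
        split_ifs at h3 <;> omega
      rcases key1 with h | h | ⟨h, h'⟩
      · exact hi h
      · rw [← hσ p, ← hσ q, hi h]
      · exact (hfix p q hp (hi h) (hi h') h1.symm).symm
    · rw [htN p hp, htN q (h1 ▸ hp)] at h3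
      have key1 : i p = i q ∨ i (σ p) = i (σ q) ∨ i p = i (σ q) ∨ i (σ p) = i q := by
        omega
      rcases key1 with h | h | h | h
      · exact hi h
      · rw [← hσ p, ← hσ q, hi h]
      · have h5 := hi h
        rw [← h5] at h4
        have h6 := hin p h4.symm hp
        have h7 := congrArg σ h5
        rwa [hσ, h6] at h7
      · have h5 := hi h
        rw [← h5, hin p (by rw [h1, h5]) hp]
  obtain ⟨r, hr, hrk⟩ := exists_rank key hinj
  refine ⟨r, hr, fun p q h => ?_, fun p q h hp hpq => ?_, fun p q h hp hpq => ?_⟩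
  · rw [hrk, hlt]
    exact Or.inl h
  · have hq : s q ∈ W := h ▸ hp
    rw [hrk, hlt] at hpq ⊢
    rcases hpq with hpq | ⟨-, hpq⟩
    · exact absurd h hpq.ne
    rcases hpq with hpq | ⟨he, ht⟩
    · rw [heW p hp, heW q hq] at hpq
      left
      rw [← hv]
      omega
    · have h4 := hes p q h he
      refine Or.inr ⟨h4.symm, ?_⟩
      by_cases hp' : s (σ p) ∈ W
      · have hq' : s (σ q) ∈ W := h4 ▸ hp'
        refine Or.inr ⟨?_, ?_⟩
        · rw [heW _ hp', heW _ hq', hσ, hσ, h]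
        · rw [htneg p hp hp', htneg q hq hq']
          omega
      · have := hcross p q hp hp' h.symm h4.symm
        rw [this] at ht
        exact absurd ht (lt_irrefl _)
  · have hq : s q ∉ W := h ▸ hp
    rw [hrk, hlt] at hpq ⊢
    rcases hpq with hpq | ⟨-, hpq⟩
    · exact absurd h hpq.ne
    rcases hpq with hpq | ⟨he, ht⟩
    · rw [heN p hp, heN q hq] at hpq
      left
      rw [← hv]
      omega
    · have h4 := hes p q h he
      refine Or.inr ⟨h4, ?_⟩
      by_cases hp' : s (σ p) ∈ W
      · have := hcross (σ p) (σ q) hp' (by rwa [hσ]) h4.symm (by rw [hσ, hσ, h])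
        have h5 := congrArg σ this
        rw [hσ, hσ] at h5
        rw [h5] at ht
        exact absurd ht (lt_irrefl _)
      · have hq' : s (σ q) ∉ W := h4 ▸ hp'
        refine Or.inr ⟨?_, ?_⟩
        · rw [heN _ hp', heN _ hq', hσ, hσ, h]
        · rw [htN _ hp', htN _ hq', hσ, hσ]
          rw [htN _ hp, htN _ hq] at ht
          rwa [min_comm, min_comm (i (σ q) : ℤ)]

/-- Sets of positions along which `σ` is decreasing. -/
def IsDecreasingSet (σ : P → P) (r : P → ℕ) (A : Finset P) : Prop :=
  ∀ p ∈ A, ∀ q ∈ A, r p < r q → r (σ q) < r (σ p)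

/-- In the picture of the graph of `σ`, the points of `B` lie on one side of the diagonal. The
mirror image of a decreasing chain continues it on the other side. -/
theorem isDecreasingSet_union_image {σ : P → P} (hσ : ∀ p, σ (σ p) = p) {r : P → ℕ}
    (hr : Function.Injective r) {B : Finset P} (hB : IsDecreasingSet σ r B)
    (hleft : ∀ p ∈ B, r p ≤ r (σ p)) : IsDecreasingSet σ r (B ∪ B.image σ) := by
  have tri : ∀ a b, r a < r b ∨ a = b ∨ r b < r a := fun a b => by
    rcases lt_trichotomy (r a) (r b) with h | h | h
    · exact Or.inl h
    · exact Or.inr (Or.inl (hr h))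
    · exact Or.inr (Or.inr h)
  intro p hp q hq hpq
  rw [Finset.mem_union, Finset.mem_image] at hp hq
  rcases hp with hp | ⟨a, ha, rfl⟩ <;> rcases hq with hq | ⟨b, hb, rfl⟩
  · exact hB p hp q hq hpq
  · rw [hσ]
    rcases tri p b with h | rfl | h
    · exact (hleft b hb).trans_lt (hB p hp b hb h)
    · exact hpq
    · exact h.trans_le (hleft p hp)
  · have h1 := hleft a ha
    have h2 := hleft q hq
    have h3 := hB a ha q hq (h1.trans_lt hpq)
    omega
  · rw [hσ, hσ]
    rcases tri a b with h | rfl | h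
    · have := hB a ha b hb h
      omega
    · omega
    · exact h

/-- A position in `B` and in its mirror image satisfies both inequalities with its partner, so only
fixed points are counted twice. -/
theorem card_union_image {σ : P → P} (hσ : ∀ p, σ (σ p) = p) {r : P → ℕ}
    (hr : Function.Injective r) {B : Finset P} (hleft : ∀ p ∈ B, r p ≤ r (σ p)) :
    2 * #B = #(B ∪ B.image σ) + #{p ∈ B | σ p = p} := by
  have hinj : Function.Injective σ := fun p q h => by rw [← hσ p, h, hσ]
  have h1 := Finset.card_union_add_card_inter B (B.image σ)
  rw [Finset.card_image_of_injective B hinj] at h1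
  have h2 : B ∩ B.image σ = B.filter fun p => σ p = p := by
    ext p
    simp only [Finset.mem_inter, Finset.mem_image, Finset.mem_filter]
    refine and_congr_right fun hp => ⟨?_, fun h => ⟨p, hp, h⟩⟩
    rintro ⟨q, hq, rfl⟩
    have a1 := hleft _ hp
    have a2 := hleft _ hq
    rw [hσ] at a1 ⊢
    exact hr (le_antisymm a2 a1)
  rw [h2] at h1
  omega

theorem card_fixed_le_one {σ : P → P} {r : P → ℕ}
    (hr : Function.Injective r) {B : Finset P} (hB : IsDecreasingSet σ r B) :
    #{p ∈ B | σ p = p} ≤ 1 := by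
  refine Finset.card_le_one.mpr fun p hp q hq => ?_
  simp only [Finset.mem_filter] at hp hq
  by_contra hne
  rcases lt_or_gt_of_ne (fun h => hne (hr h)) with h | h
  · have := hB p hp.1 q hq.1 h
    rw [hp.2, hq.2] at this
    omega
  · have := hB q hq.1 p hp.1 h
    rw [hp.2, hq.2] at this
    omega

/-- A decreasing set can be replaced by one of at least the same size that is stable under `σ`. -/
theorem exists_stable_isDecreasingSet {σ : P → P} (hσ : ∀ p, σ (σ p) = p) {r : P → ℕ}
    (hr : Function.Injective r) {A : Finset P} (hA : IsDecreasingSet σ r A) :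
    ∃ B : Finset P, IsDecreasingSet σ r B ∧ (∀ p ∈ B, σ p ∈ B) ∧ #A ≤ #B ∧
      ∀ p ∈ B, p ∈ A ∨ σ p ∈ A := by
  have hinj : Function.Injective σ := fun p q h => by rw [← hσ p, h, hσ]
  have finish : ∀ B : Finset P, IsDecreasingSet σ r B → (∀ p ∈ B, r p ≤ r (σ p)) →
      #A + #{p ∈ B | σ p = p} ≤ 2 * #B → (∀ p ∈ B, p ∈ A ∨ σ p ∈ A) →
      ∃ B : Finset P, IsDecreasingSet σ r B ∧ (∀ p ∈ B, σ p ∈ B) ∧ #A ≤ #B ∧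
        ∀ p ∈ B, p ∈ A ∨ σ p ∈ A := by
    intro B hB hleft hcard hBA
    refine ⟨B ∪ B.image σ, isDecreasingSet_union_image hσ hr hB hleft, fun p hp => ?_, ?_, ?_⟩
    · rw [Finset.mem_union, Finset.mem_image] at hp ⊢
      rcases hp with hp | ⟨q, hq, rfl⟩
      · exact Or.inr ⟨p, hp, rfl⟩
      · rw [hσ]
        exact Or.inl hq
    · have := card_union_image hσ hr hleft
      omega
    · intro p hp
      rw [Finset.mem_union, Finset.mem_image] at hp
      rcases hp with hp | ⟨q, hq, rfl⟩
      · exact hBA p hp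
      · rw [hσ]
        exact (hBA q hq).symm
  -- The larger of the parts on the two sides of the diagonal is reflected. Fixed points lie in both
  -- parts and are only counted once after reflection; the two effects balance, so nothing is lost.
  set A₁ := A.filter fun p => r p ≤ r (σ p) with hA₁
  set A₂ := A.filter fun p => r (σ p) ≤ r p with hA₂
  have hsum : #A₁ + #A₂ = #A + #{p ∈ A | σ p = p} := by
    have h1 := Finset.card_union_add_card_inter A₁ A₂
    have h2 : A₁ ∪ A₂ = A := by
      ext p
      simp only [hA₁, hA₂, Finset.mem_union, Finset.mem_filter]
      have := le_total (r p) (r (σ p))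
      tauto
    have h3 : A₁ ∩ A₂ = A.filter fun p => σ p = p := by
      ext p
      simp only [hA₁, hA₂, Finset.mem_inter, Finset.mem_filter]
      constructor
      · rintro ⟨⟨hp, h⟩, -, h'⟩
        exact ⟨hp, hr (le_antisymm h' h)⟩
      · rintro ⟨hp, h⟩
        rw [h]
        exact ⟨⟨hp, le_rfl⟩, hp, le_rfl⟩
    rw [h2, h3] at h1
    exact h1.symm
  rcases le_total #A₂ #A₁ with hle | hle
  · refine finish A₁ (fun p hp q hq => hA p (Finset.mem_filter.mp hp).1 q
      (Finset.mem_filter.mp hq).1) (fun p hp => (Finset.mem_filter.mp hp).2) ?_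
      (fun p hp => Or.inl (Finset.mem_filter.mp hp).1)
    have : #{p ∈ A₁ | σ p = p} ≤ #{p ∈ A | σ p = p} :=
      Finset.card_le_card (Finset.filter_subset_filter _ (Finset.filter_subset _ _))
    omega
  · refine finish (A₂.image σ) ?_ ?_ ?_ ?_
    · intro p hp q hq hpq
      obtain ⟨a, ha, rfl⟩ := Finset.mem_image.mp hp
      obtain ⟨b, hb, rfl⟩ := Finset.mem_image.mp hq
      rw [hσ, hσ]
      by_contra h
      have hab : r a < r b := lt_of_le_of_ne (not_lt.mp h) (fun h' => by
        rw [hr h'] at hpq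
        exact lt_irrefl _ hpq)
      have := hA a (Finset.mem_filter.mp ha).1 b (Finset.mem_filter.mp hb).1 hab
      omega
    · intro p hp
      obtain ⟨a, ha, rfl⟩ := Finset.mem_image.mp hp
      rw [hσ]
      exact (Finset.mem_filter.mp ha).2
    · rw [Finset.card_image_of_injective _ hinj]
      have : #{p ∈ A₂.image σ | σ p = p} ≤ #{p ∈ A | σ p = p} := by
        refine Finset.card_le_card fun p hp => ?_
        obtain ⟨h1, h2⟩ := Finset.mem_filter.mp hp
        obtain ⟨a, ha, rfl⟩ := Finset.mem_image.mp h1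
        rw [hσ] at h2
        rw [← h2]
        exact Finset.mem_filter.mpr ⟨(Finset.mem_filter.mp ha).1, h2.symm⟩
      omega
    · intro p hp
      obtain ⟨a, ha, rfl⟩ := Finset.mem_image.mp hp
      rw [hσ]
      exact Or.inr (Finset.mem_filter.mp ha).1

end Standardization

/-! ### Decreasing sequences and decreasing sets -/

section DecLength

variable {P α : Type*} [Fintype P] [LinearOrder P] [LinearOrder α]
  {s : P → WithTop α} {W : Set α} {σ : P → P} {r : P → ℕ} {F : Finset P} {φ : P → α × α}

theorem bddAbove_decLength (W₁ W₂ : Set α) (M : Multiset (α × α)) :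
    BddAbove {n | ∃ L : List (α × α), IsDecreasing W₁ W₂ L ∧
      (L : Multiset (α × α)) ≤ M ∧ L.length = n} := by
  refine ⟨Multiset.card M, ?_⟩
  rintro _ ⟨L, -, hL, rfl⟩
  simpa using Multiset.card_le_card hL

/-- List `A` by increasing rank. Two successive positions cannot share a class outside `W`, nor can
their partners, because there `σ` increases with the rank. -/
theorem card_le_decLength (hr : IsStandardRank s (WithTop.some '' W) σ r)
    (hσ : ∀ p, σ (σ p) = p)
    (hφ : ∀ p ∈ F, s p = (φ p).1 ∧ s (σ p) = (φ p).2) {A : Finset P} (hAF : A ⊆ F)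
    (hA : IsDecreasingSet σ r A) : #A ≤ decLength W W (F.val.map φ) := by
  have hmem : ∀ {a : α}, (a : WithTop α) ∈ WithTop.some '' W → a ∈ W := by
    rintro a ⟨b, hb, hba⟩
    rwa [← WithTop.coe_injective hba]
  let Ls := A.toList.mergeSort fun p q => decide (r p ≤ r q)
  have hperm : Ls.Perm A.toList := List.mergeSort_perm _ _
  have hmemA : ∀ p, p ∈ Ls → p ∈ A := fun p hp => by simpa using hperm.mem_iff.mp hp
  refine le_csSup (bddAbove_decLength W W _) ⟨Ls.map φ, ?_, ?_, ?_⟩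
  · have h1 : Ls.Pairwise fun p q => r p ≤ r q := by
      have := List.pairwise_mergeSort (le := fun p q => decide (r p ≤ r q))
        (fun a b c h1 h2 => by simp only [decide_eq_true_eq] at *; omega)
        (fun a b => by simp only [Bool.or_eq_true, decide_eq_true_eq]; omega) A.toList
      simpa only [decide_eq_true_eq] using this
    have h2 : Ls.Nodup := hperm.nodup_iff.mpr A.nodup_toList
    refine List.Pairwise.isChain ?_
    rw [List.pairwise_map]
    refine ((h1.and h2).imp_of_mem ?_)
    rintro p q hp hq ⟨hle, hne⟩
    have hp' := hmemA p hp
    have hq' := hmemA q hq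
    have hlt : r p < r q := lt_of_le_of_ne hle fun h => hne (hr.inj h)
    have hlt' := hA p hp' q hq' hlt
    obtain ⟨p1, p2⟩ := hφ p (hAF hp')
    obtain ⟨q1, q2⟩ := hφ q (hAF hq')
    refine ⟨?_, ?_, fun h => ?_, fun h => ?_⟩
    · have := hr.le hle
      rwa [p1, q1, WithTop.coe_le_coe] at this
    · have := hr.le hlt'.le
      rwa [p2, q2, WithTop.coe_le_coe] at this
    · by_contra hW
      have := hr.incr p q (by rw [p1, q1, h]) (fun h' => hW (hmem (p1 ▸ h'))) hlt
      omega
    · by_contra hW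
      have := hr.incr (σ q) (σ p) (by rw [p2, q2, h]) (fun h' => hW (hmem (by rwa [q2, ← h] at h')))
        hlt'
      rw [hσ, hσ] at this
      omega
  · have : (Ls.map φ : Multiset (α × α)) = A.val.map φ := by
      rw [← Multiset.map_coe, Multiset.coe_eq_coe.mpr hperm, Finset.coe_toList]
    rw [this]
    exact Multiset.map_le_map (Finset.val_le_iff.mpr hAF)
  · rw [List.length_map, hperm.length_eq, Finset.length_toList]

/-- A longest sequence lifts to distinct positions, one for each copy of a point that it uses.
Copies with an equal first or second coordinate have it in `W`, where the standard rank makes `σ`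
decreasing. -/
theorem exists_isDecreasingSet (hr : IsStandardRank s (WithTop.some '' W) σ r)
    (hσ : ∀ p, σ (σ p) = p)
    (hφ : ∀ p ∈ F, s p = (φ p).1 ∧ s (σ p) = (φ p).2) :
    ∃ A ⊆ F, IsDecreasingSet σ r A ∧ #A = decLength W W (F.val.map φ) := by
  obtain ⟨L, hL, hLM, hlen⟩ := Nat.sSup_mem (s := {n | ∃ L : List (α × α), IsDecreasing W W L ∧
      (L : Multiset (α × α)) ≤ F.val.map φ ∧ L.length = n})
    ⟨0, [], List.isChain_nil, by simp, rfl⟩ (bddAbove_decLength W W _)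
  rw [← Finset.coe_toList, Multiset.map_coe, Multiset.coe_le] at hLM
  obtain ⟨L', hL', hsub⟩ := hLM
  obtain ⟨L'', hsub', rfl⟩ := List.sublist_map_iff.mp hsub
  have hnd : L''.Nodup := hsub'.nodup F.nodup_toList
  have hmemF : ∀ p ∈ L'', p ∈ F := fun p hp => by simpa using hsub'.subset hp
  let R : α × α → α × α → Prop := fun p q =>
    p.1 ≤ q.1 ∧ q.2 ≤ p.2 ∧ (p.1 = q.1 → p.1 ∈ W) ∧ (p.2 = q.2 → p.2 ∈ W)
  -- Transitivity turns the condition on neighbours into one on all pairs, which survives the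
  -- permutation to the order of the lifted positions.
  have htrans : IsTrans _ R := ⟨by
    rintro a b c ⟨h1, h2, h3, h4⟩ ⟨g1, g2, g3, g4⟩
    refine ⟨h1.trans g1, g2.trans h2, fun h => h3 (le_antisymm h1 (h ▸ g1)),
      fun h => h4 (le_antisymm (h ▸ g2) h2)⟩⟩
  have hpw : L.Pairwise R := List.isChain_iff_pairwise.mp hL
  have hpw' : (L''.map φ).Pairwise fun a b => R a b ∨ R b a :=
    (hL'.pairwise_iff (fun {x y} h => h.symm)).mpr (hpw.imp fun h => Or.inl h)
  rw [List.pairwise_map] at hpw'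
  have : Std.Symm fun p q => R (φ p) (φ q) ∨ R (φ q) (φ p) := ⟨fun _ _ h => h.symm⟩
  refine ⟨L''.toFinset, fun p hp => hmemF p (List.mem_toFinset.mp hp), ?_, ?_⟩
  · intro p hp q hq hpq
    rw [List.mem_toFinset] at hp hq
    have hne : p ≠ q := by rintro rfl; exact lt_irrefl _ hpq
    obtain ⟨p1, p2⟩ := hφ p (hmemF p hp)
    obtain ⟨q1, q2⟩ := hφ q (hmemF q hq)
    rcases hpw'.forall hp hq hne with ⟨-, h2, -, h4⟩ | ⟨h1, -, h3, -⟩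
    · rcases h2.lt_or_eq with h | h
      · exact hr.mono _ _ (by rw [p2, q2]; exact WithTop.coe_lt_coe.mpr h)
      · by_contra hcon
        have hne' : r (σ p) ≠ r (σ q) := fun h' => hne (by
          rw [← hσ p, hr.inj h', hσ])
        have := hr.anti (σ p) (σ q) (by rw [p2, q2, h]) (by rw [p2]; exact ⟨_, h4 h.symm, rfl⟩)
          (by omega)
        rw [hσ, hσ] at this
        omega
    · rcases h1.lt_or_eq with h | h
      · have := hr.mono q p (by rw [p1, q1]; exact WithTop.coe_lt_coe.mpr h)
        omega
      · exact hr.anti p q (by rw [p1, q1, h]) (by rw [p1, ← h]; exact ⟨_, h3 h, rfl⟩) hpq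
  · rw [List.toFinset_card_of_nodup hnd, ← List.length_map (f := φ), hL'.length_eq, hlen]
    rfl

end DecLength

/-! ### Counting pairs in layers -/

section Layers

variable {P : Type*}

/-- The product `v p * u p` counts the pairs `(a, b)` with `1 ≤ a ≤ v p` and `1 ≤ b ≤ u p`. -/
theorem sum_mul_eq_sum_card (A : Finset P) (v u : P → ℕ) (B : ℕ) (hv : ∀ p ∈ A, v p ≤ B)
    (hu : ∀ p ∈ A, u p ≤ B) :
    ∑ p ∈ A, v p * u p = ∑ a ∈ Icc 1 B, ∑ b ∈ Icc 1 B, #{p ∈ A | a ≤ v p ∧ b ≤ u p} := by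
  have h1 : ∀ x ≤ B, ∑ a ∈ Icc 1 B, (if a ≤ x then 1 else 0) = x := by
    intro x hx
    rw [Finset.sum_boole]
    have : (Icc 1 B).filter (· ≤ x) = Icc 1 x := by
      ext a
      simp only [Finset.mem_filter, Finset.mem_Icc]
      omega
    simp [this]
  calc ∑ p ∈ A, v p * u p
      = ∑ p ∈ A, ∑ a ∈ Icc 1 B, ∑ b ∈ Icc 1 B, (if a ≤ v p ∧ b ≤ u p then 1 else 0) := by
        refine Finset.sum_congr rfl fun p hp => ?_
        conv_lhs => rw [← h1 _ (hv p hp), ← h1 _ (hu p hp), Finset.sum_mul_sum]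
        refine Finset.sum_congr rfl fun a _ => Finset.sum_congr rfl fun b _ => ?_
        by_cases ha : a ≤ v p <;> by_cases hb : b ≤ u p <;> simp [ha, hb]
    _ = _ := by
        rw [Finset.sum_comm]
        refine Finset.sum_congr rfl fun a _ => ?_
        rw [Finset.sum_comm]
        refine Finset.sum_congr rfl fun b _ => ?_
        rw [Finset.sum_boole]
        simp

/-- Inclusion and exclusion for the corner of a quadrant; it recovers the number of points with
given coordinates from the layer counts. -/
theorem card_layer_eq (A : Finset P) (v u : P → ℕ) (a b : ℕ) :
    #{p ∈ A | a ≤ v p ∧ b ≤ u p} + #{p ∈ A | a + 1 ≤ v p ∧ b + 1 ≤ u p} =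
      #{p ∈ A | v p = a ∧ u p = b} + #{p ∈ A | a + 1 ≤ v p ∧ b ≤ u p} +
        #{p ∈ A | a ≤ v p ∧ b + 1 ≤ u p} := by
  simp only [Finset.card_filter]
  rw [← Finset.sum_add_distrib, ← Finset.sum_add_distrib, ← Finset.sum_add_distrib]
  refine Finset.sum_congr rfl fun p _ => ?_
  split_ifs <;> omega

/-- If the pairs `(v, u)` are dominated layerwise by the pairs `(v', u')`, the same holds for the
sums of the products, with equality only if both families of pairs agree. -/
theorem sum_mul_le_of_layers (A A' : Finset P) (v u v' u' : P → ℕ)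
    (h : ∀ a b, 1 ≤ a → 1 ≤ b →
      #{p ∈ A | a ≤ v p ∧ b ≤ u p} ≤ #{p ∈ A' | a ≤ v' p ∧ b ≤ u' p}) :
    ∑ p ∈ A, v p * u p ≤ ∑ p ∈ A', v' p * u' p ∧
      (∑ p ∈ A, v p * u p = ∑ p ∈ A', v' p * u' p → ∀ a b, 1 ≤ a → 1 ≤ b →
        #{p ∈ A | v p = a ∧ u p = b} = #{p ∈ A' | v' p = a ∧ u' p = b}) := by
  obtain ⟨B, hB⟩ : ∃ B, (∀ p ∈ A, v p ≤ B ∧ u p ≤ B) ∧ ∀ p ∈ A', v' p ≤ B ∧ u' p ≤ B := by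
    refine ⟨A.sup v + A.sup u + (A'.sup v' + A'.sup u'), fun p hp => ?_, fun p hp => ?_⟩
    · have h1 := Finset.le_sup (f := v) hp
      have h2 := Finset.le_sup (f := u) hp
      omega
    · have h1 := Finset.le_sup (f := v') hp
      have h2 := Finset.le_sup (f := u') hp
      omega
  rw [sum_mul_eq_sum_card A v u B (fun p hp => (hB.1 p hp).1) (fun p hp => (hB.1 p hp).2),
    sum_mul_eq_sum_card A' v' u' B (fun p hp => (hB.2 p hp).1) (fun p hp => (hB.2 p hp).2)]
  have h1 : ∀ a ∈ Icc 1 B, ∀ b ∈ Icc 1 B,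
      #{p ∈ A | a ≤ v p ∧ b ≤ u p} ≤ #{p ∈ A' | a ≤ v' p ∧ b ≤ u' p} := fun a ha b hb =>
    h a b (Finset.mem_Icc.mp ha).1 (Finset.mem_Icc.mp hb).1
  refine ⟨Finset.sum_le_sum fun a ha => Finset.sum_le_sum fun b hb => h1 a ha b hb, fun heq => ?_⟩
  have h2 := (Finset.sum_eq_sum_iff_of_le fun a ha => Finset.sum_le_sum (h1 a ha)).mp heq
  have h3 : ∀ a b, 1 ≤ a → 1 ≤ b →
      #{p ∈ A | a ≤ v p ∧ b ≤ u p} = #{p ∈ A' | a ≤ v' p ∧ b ≤ u' p} := by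
    intro a b ha hb
    by_cases hab : a ≤ B ∧ b ≤ B
    · exact (Finset.sum_eq_sum_iff_of_le (h1 a (Finset.mem_Icc.mpr ⟨ha, hab.1⟩))).mp
        (h2 a (Finset.mem_Icc.mpr ⟨ha, hab.1⟩)) b (Finset.mem_Icc.mpr ⟨hb, hab.2⟩)
    · rw [Finset.filter_false_of_mem, Finset.filter_false_of_mem]
      · intro p hp
        have := hB.2 p hp
        omega
      · intro p hp
        have := hB.1 p hp
        omega
  intro a b ha hb
  have e1 := card_layer_eq A v u a b
  have e2 := card_layer_eq A' v' u' a b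
  rw [h3 a b ha hb, h3 (a + 1) (b + 1) (by omega) (by omega), h3 (a + 1) b (by omega) hb,
    h3 a (b + 1) ha (by omega)] at e1
  omega

theorem even_card_of_involution [DecidableEq P] (A : Finset P) (f : P → P)
    (hf : ∀ p ∈ A, f p ∈ A ∧ f p ≠ p ∧ f (f p) = p) : Even #A := by
  have : ∑ _p ∈ A, (1 : ZMod 2) = 0 :=
    Finset.sum_involution (fun p _ => f p) (fun p _ => by decide) (fun p hp _ => (hf p hp).2.1)
      (fun p hp => (hf p hp).1) (fun p hp => (hf p hp).2.2)
  rw [Finset.sum_const, nsmul_eq_mul, mul_one] at this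
  exact (ZMod.natCast_eq_zero_iff_even).mp this

end Layers

/-! ### The partner of a position -/

section Partner

variable {P α : Type*} [Fintype P] [LinearOrder P] [LinearOrder α] {s : P → WithTop α} {W : Set α}
  {τ : Equiv.Perm P}

open Classical in
/-- The involution on the positions induced by a matching after the positions that are matched
with a position in the class `⊤` have been turned into fixed points. -/
noncomputable def partner (s : P → WithTop α) (τ : Equiv.Perm P) (p : P) : P :=
  if s p = ⊤ ∨ s (τ p) = ⊤ then p else τ p

theorem partner_of_top {p : P} (h : s (τ p) = ⊤) : partner s τ p = p := if_pos (Or.inr h)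

theorem partner_of_ne_top {p : P} (h : s p ≠ ⊤) (h' : s (τ p) ≠ ⊤) : partner s τ p = τ p :=
  if_neg (by simp [h, h'])

theorem partner_eq_self_iff (hτ : IsMatching τ) (p : P) :
    partner s τ p = p ↔ s p = ⊤ ∨ s (τ p) = ⊤ := by
  refine ⟨fun h => ?_, fun h => if_pos h⟩
  by_contra hn
  rw [not_or] at hn
  rw [partner_of_ne_top hn.1 hn.2] at h
  exact hτ.ne p h

theorem partner_partner (hτ : IsMatching τ) (p : P) : partner s τ (partner s τ p) = p := by
  by_cases h : s p = ⊤ ∨ s (τ p) = ⊤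
  · have : partner s τ p = p := if_pos h
    rw [this, this]
  · rw [not_or] at h
    rw [partner_of_ne_top h.1 h.2, partner_of_ne_top h.2 (by rw [hτ.invol]; exact h.1), hτ.invol]

theorem class_partner_ne_top {p : P} (h : s p ≠ ⊤) : s (partner s τ p) ≠ ⊤ := by
  by_cases h' : s (τ p) = ⊤
  · rwa [partner_of_top h']
  · rwa [partner_of_ne_top h h']

theorem top_notMem_image : (⊤ : WithTop α) ∉ WithTop.some '' W := by
  rintro ⟨j, _, hj⟩
  exact WithTop.coe_ne_top hj

/-- A fixed point of the partner map in a class of `W` comes from an arc to `⊤`, a class outside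
`W`; admissibility allows one such arc for each class, which is the uniqueness needed to break ties.
-/
theorem IsAdmissible.exists_isStandardRank [Fintype α] (hτ : IsAdmissible s (WithTop.some '' W) τ) :
    ∃ r : P → ℕ, IsStandardRank s (WithTop.some '' W) (partner s τ) r := by
  classical
  have : Fintype (WithTop α) := inferInstanceAs (Fintype (Option α))
  have hne : ∀ p, partner s τ p ≠ p → partner s τ p = τ p := fun p h => by
    have := mt (partner_eq_self_iff hτ.toIsMatching p).mpr h
    rw [not_or] at this
    exact partner_of_ne_top this.1 this.2
  refine SympInv.exists_isStandardRank s _ _ (partner_partner hτ.toIsMatching) ?_ ?_ ?_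
  · intro p hp hpW
    by_contra h
    rw [hne p h] at hp
    exact hpW (hτ.inner p hp)
  · intro p q h1 h2 h3 h4
    have hp : partner s τ p ≠ p := fun h => h2 (h.symm ▸ h1)
    have hq : partner s τ q ≠ q := fun h => h2 (by rw [← h4, h, h3]; exact h1)
    rw [hne p hp] at h2 h4
    rw [hne q hq] at h4
    exact hτ.cross p q h1 h2 h3 h4
  · intro p q h1 h2 h3 h4
    have hs : s p ≠ ⊤ := fun h => top_notMem_image (h ▸ h1)
    have e1 := ((partner_eq_self_iff hτ.toIsMatching p).mp h2).resolve_left hs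
    have e2 := ((partner_eq_self_iff hτ.toIsMatching q).mp h3).resolve_left (h4 ▸ hs)
    exact hτ.cross p q h1 (by rw [e1]; exact top_notMem_image) h4 (by rw [e1, e2])

end Partner

/-! ### Straightening -/

section Straightening

variable {P : Type*} [Fintype P] [LinearOrder P] {k : ℕ} {s : P → WithTop (Fin k)}
  {W : Set (Fin k)} {τ : Equiv.Perm P} {l : ℕ}

/-- A numerical index of the classes: positive and increasing on those different from `⊤`. -/
def classIndex : WithTop (Fin k) → ℕ
  -- With the index `0`, positions in the class `⊤` contribute nothing to the weights and lie in no
  -- layer with bounds at least `1`.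
  | ⊤ => 0
  | (i : Fin k) => i + 1

@[simp] theorem classIndex_top : classIndex (⊤ : WithTop (Fin k)) = 0 := rfl

@[simp] theorem classIndex_coe (i : Fin k) : classIndex (i : WithTop (Fin k)) = i + 1 := rfl

theorem classIndex_pos {x : WithTop (Fin k)} (hx : x ≠ ⊤) : 1 ≤ classIndex x := by
  lift x to Fin k using hx
  simp

theorem classIndex_lt_iff {x y : WithTop (Fin k)} (hx : x ≠ ⊤) (hy : y ≠ ⊤) :
    classIndex x < classIndex y ↔ x < y := by
  lift x to Fin k using hx
  lift y to Fin k using hy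
  simp

theorem classIndex_le_iff {x y : WithTop (Fin k)} (hx : x ≠ ⊤) (hy : y ≠ ⊤) :
    classIndex x ≤ classIndex y ↔ x ≤ y := by
  rw [← not_lt, classIndex_lt_iff hy hx, not_lt]

theorem classIndex_injective : Function.Injective (classIndex (k := k)) := by
  intro x y h
  induction x <;> induction y <;> simp_all [Fin.ext_iff]

/-- The weight of a matching, which increases in each straightening step. -/
noncomputable def weight (s : P → WithTop (Fin k)) (τ : Equiv.Perm P) : ℕ :=
  ∑ p, classIndex (s p) * classIndex (s (partner s τ p))

/-- Antisymmetrizing more than `2l` positions gives zero. -/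
theorem sum_sign_smul_eq_zero {B : Finset P} (hB : 2 * l < #B) (y : (P → Letter l) → ℂ) :
    ∑ g : Equiv.Perm P with ∀ p ∉ B, g p = p, ((Equiv.Perm.sign g : ℤ) : ℂ) •
      (fun w : P → Letter l => y fun p => w (g p)) = 0 := by
  funext w
  rw [Finset.sum_apply, Pi.zero_apply]
  obtain ⟨p, hp, q, hq, hpq, hw⟩ : ∃ p ∈ B, ∃ q ∈ B, p ≠ q ∧ w p = w q := by
    refine Finset.exists_ne_map_eq_of_card_lt_of_maps_to (t := Finset.univ) ?_ (by simp)
    rw [Finset.card_univ, Fintype.card_sum, Fintype.card_fin]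
    omega
  -- Two positions of `B` carry the same letter, so the terms for `g` and for `g` followed by their
  -- exchange cancel.
  refine Finset.sum_involution (fun g _ => Equiv.swap p q * g) ?_ ?_ ?_ ?_
  · intro g hg
    have : (fun r => w ((Equiv.swap p q * g) r)) = fun r => w (g r) := by
      funext r
      rw [Equiv.Perm.mul_apply, Equiv.swap_apply_def]
      split_ifs with h1 h2
      · rw [h1, hw]
      · rw [h2, hw]
      · rfl
    simp only [Pi.smul_apply, this, Equiv.Perm.sign_mul, Equiv.Perm.sign_swap hpq]
    simp
  · intro g _ _ h
    exact hpq (Equiv.swap_eq_one_iff.mp (mul_eq_right.mp h))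
  · intro g hg
    simp only [Finset.mem_filter, Finset.mem_univ, true_and] at hg ⊢
    intro r hr
    rw [Equiv.Perm.mul_apply, hg r hr]
    exact Equiv.swap_apply_of_ne_of_ne (fun h => hr (h ▸ hp)) (fun h => hr (h ▸ hq))
  · intro g _
    rw [← mul_assoc, Equiv.swap_mul_self, one_mul]

end Straightening

/-! ### The straightening relation and its leading term. -/

section Straightening

variable {P : Type*} [Fintype P] [LinearOrder P] {k : ℕ} {s : P → WithTop (Fin k)}
  {W : Set (Fin k)} {τ : Equiv.Perm P} {l : ℕ}

theorem mem_of_fixes_compl {B : Finset P} {g : Equiv.Perm P} (hg : ∀ p ∉ B, g p = p) (p : P) :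
    g p ∈ B ↔ p ∈ B := by
  constructor
  · intro h
    by_contra hp
    rw [hg p hp] at h
    exact hp h
  · intro h
    by_contra hp
    have := g.injective (hg _ hp)
    rw [this] at hp
    exact hp h

theorem partner_conj {B : Finset P} (hBfin : ∀ p ∈ B, s p ≠ ⊤) {g : Equiv.Perm P}
    (hg : ∀ p ∉ B, g p = p) (q : P) : partner s (g * τ * g⁻¹) (g q) = g (partner s τ q) := by
  have htop : ∀ p, s (g p) = ⊤ ↔ s p = ⊤ := by
    intro p
    by_cases hp : p ∈ B
    · exact iff_of_false (hBfin _ ((mem_of_fixes_compl hg p).mpr hp)) (hBfin p hp)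
    · rw [hg p hp]
  have h1 : (g * τ * g⁻¹) (g q) = g (τ q) := by simp
  unfold partner
  simp only [h1, htop]
  split_ifs <;> rfl

theorem card_filter_comp_involution {B : Finset P} {f : P → P} (hf : ∀ p ∈ B, f p ∈ B)
    (hff : ∀ p ∈ B, f (f p) = p) (Q : P → Prop) [DecidablePred Q] :
    #{p ∈ B | Q (f p)} = #{p ∈ B | Q p} := by
  refine Finset.card_bij' (fun p _ => f p) (fun p _ => f p) ?_ ?_ ?_ ?_
  · intro p hp
    simp only [Finset.mem_filter] at hp ⊢
    exact ⟨hf p hp.1, hp.2⟩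
  · intro p hp
    simp only [Finset.mem_filter] at hp ⊢
    exact ⟨hf p hp.1, by rw [hff p hp.1]; exact hp.2⟩
  · intro p hp
    exact hff p (Finset.mem_filter.mp hp).1
  · intro p hp
    exact hff p (Finset.mem_filter.mp hp).1

/-- A decreasing arrangement is layerwise the smallest one. -/
theorem layer_le_of_isDecreasingSet {r : P → ℕ} {σ σ' : P → P}
    (hr : IsStandardRank s (WithTop.some '' W) σ r) {B : Finset P} (hB : IsDecreasingSet σ r B)
    (hBfin : ∀ p ∈ B, s p ≠ ⊤) (hσB : ∀ p ∈ B, σ p ∈ B) (hσ : ∀ p, σ (σ p) = p)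
    (hσ'B : ∀ p ∈ B, σ' p ∈ B) (hσ' : ∀ p, σ' (σ' p) = p) (a b : ℕ) :
    #{p ∈ B | a ≤ classIndex (s p) ∧ b ≤ classIndex (s (σ p))} ≤
      #{p ∈ B | a ≤ classIndex (s p) ∧ b ≤ classIndex (s (σ' p))} := by
  have hmono : ∀ p ∈ B, ∀ q ∈ B, r p < r q → classIndex (s p) ≤ classIndex (s q) :=
    fun p hp q hq h => (classIndex_le_iff (hBfin p hp) (hBfin q hq)).mpr (hr.le h.le)
  -- Both coordinates run through the same multiset of classes for every involution of `B`, so the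
  -- sum of the "and" count and the "or" count does not depend on the involution.
  have e : ∀ f : P → P, (∀ p ∈ B, f p ∈ B) → (∀ p, f (f p) = p) →
      #{p ∈ B | a ≤ classIndex (s p) ∧ b ≤ classIndex (s (f p))} +
        #{p ∈ B | a ≤ classIndex (s p) ∨ b ≤ classIndex (s (f p))} =
      #{p ∈ B | a ≤ classIndex (s p)} + #{p ∈ B | b ≤ classIndex (s p)} := by
    intro f hf hff
    rw [← card_filter_comp_involution hf (fun p _ => hff p) (fun p => b ≤ classIndex (s p)),
      Finset.filter_and, Finset.filter_or, add_comm, Finset.card_union_add_card_inter]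
  have e1 := e σ hσB hσ
  have e2 := e σ' hσ'B hσ'
  -- If a decreasing arrangement has a point below both thresholds, it has none above both, and the
  -- "and" count is zero; otherwise the "or" count is all of `B`, hence maximal.
  by_cases hex : ∃ p ∈ B, classIndex (s p) < a ∧ classIndex (s (σ p)) < b
  · obtain ⟨p₀, hp₀, h1, h2⟩ := hex
    rw [Finset.card_eq_zero.mpr (Finset.filter_false_of_mem _)]
    · exact Nat.zero_le _
    · rintro p hp ⟨h3, h4⟩
      have hlt : r p₀ < r p := by
        by_contra hcon
        rcases (not_lt.mp hcon).lt_or_eq with h | h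
        · have := hmono p hp p₀ hp₀ h
          omega
        · rw [hr.inj h] at h3
          omega
      have := hmono _ (hσB p hp) _ (hσB p₀ hp₀) (hB p₀ hp₀ p hp hlt)
      omega
  · push Not at hex
    have h1 : #{p ∈ B | a ≤ classIndex (s p) ∨ b ≤ classIndex (s (σ p))} = #B := by
      congr 1
      refine Finset.filter_true_of_mem fun p hp => ?_
      by_cases h : a ≤ classIndex (s p)
      · exact Or.inl h
      · exact Or.inr (hex p hp (not_le.mp h))
    have h2 : #{p ∈ B | a ≤ classIndex (s p) ∨ b ≤ classIndex (s (σ' p))} ≤ #B :=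
      Finset.card_filter_le _ _
    omega

-- The partner map is decreasing on `B`, so it is layerwise minimal among the involutions obtained
-- by permuting `B`; summing over the layers compares the weights. Equality forces the same numbers
-- of pairs between any two classes, and then `exists_conj` gives a conjugation.
open Classical in
theorem weight_conj (hτ : IsMatching τ) {r : P → ℕ}
    (hr : IsStandardRank s (WithTop.some '' W) (partner s τ) r) {B : Finset P}
    (hB : IsDecreasingSet (partner s τ) r B) (hBfin : ∀ p ∈ B, s p ≠ ⊤)
    (hstab : ∀ p ∈ B, partner s τ p ∈ B) {g : Equiv.Perm P} (hg : ∀ p ∉ B, g p = p) :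
    weight s τ ≤ weight s (g * τ * g⁻¹) ∧ (weight s τ = weight s (g * τ * g⁻¹) →
      ∃ h : Equiv.Perm P, (∀ p ∉ B, h p = p) ∧ (∀ p, s (h p) = s p) ∧
        ∀ p, h (τ p) = (g * τ * g⁻¹) (h p)) := by
  set σ := partner s τ with hσdef
  set τ' := g * τ * g⁻¹ with hτ'def
  set σ' := partner s τ' with hσ'def
  have hτ' : IsMatching τ' := hτ.conj g
  have hσ : ∀ p, σ (σ p) = p := partner_partner hτ
  have hσ' : ∀ p, σ' (σ' p) = p := partner_partner hτ'
  have hgB := mem_of_fixes_compl hg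
  have hconj : ∀ q, σ' (g q) = g (σ q) := partner_conj hBfin hg
  have hτg : ∀ q, τ' (g q) = g (τ q) := fun q => by simp [hτ'def]
  have hσB : ∀ p, σ p ∈ B ↔ p ∈ B := fun p =>
    ⟨fun h => by rw [← hσ p]; exact hstab _ h, hstab p⟩
  have hσ'B : ∀ p ∈ B, σ' p ∈ B := by
    intro p hp
    obtain ⟨q, rfl⟩ := g.surjective p
    rw [hconj, hgB, hσB]
    exact (hgB q).mp hp
  have hout : ∀ p ∉ B, σ' p = σ p := by
    intro p hp
    have := hconj p
    rwa [hg p hp, hg _ (fun h => hp ((hσB p).mp h))] at this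
  have hsplit : ∀ f : P → P, ∑ p, classIndex (s p) * classIndex (s (f p)) =
      ∑ p ∈ B, classIndex (s p) * classIndex (s (f p)) +
        ∑ p ∈ Bᶜ, classIndex (s p) * classIndex (s (f p)) := fun f =>
    (Finset.sum_add_sum_compl B _).symm
  have hcompl : ∑ p ∈ Bᶜ, classIndex (s p) * classIndex (s (σ' p)) =
      ∑ p ∈ Bᶜ, classIndex (s p) * classIndex (s (σ p)) :=
    Finset.sum_congr rfl fun p hp => by rw [hout p (Finset.mem_compl.mp hp)]
  obtain ⟨hle, heq⟩ := sum_mul_le_of_layers B B (fun p => classIndex (s p))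
    (fun p => classIndex (s (σ p))) (fun p => classIndex (s p)) (fun p => classIndex (s (σ' p)))
    fun a b _ _ => layer_le_of_isDecreasingSet hr hB hBfin hstab hσ hσ'B hσ' a b
  have w1 : weight s τ = _ := hsplit σ
  have w2 : weight s τ' = _ := hsplit σ'
  rw [w1, w2, hcompl]
  refine ⟨by omega, fun hw => ?_⟩
  have hcount : ∀ x y : WithTop (Fin k), x ≠ ⊤ → y ≠ ⊤ →
      #{p ∈ B | s p = x ∧ s (σ p) = y} = #{p ∈ B | s p = x ∧ s (σ' p) = y} := by
    intro x y hx hy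
    have := heq (by omega) (classIndex x) (classIndex y) (classIndex_pos hx) (classIndex_pos hy)
    simpa only [classIndex_injective.eq_iff] using this
  -- the fixed point of `σ` in `B`
  have hone : #{p ∈ B | σ p = p} ≤ 1 := card_fixed_le_one hr.inj hB
  have heven : ∀ f : P → P, (∀ p ∈ B, f p ∈ B) → (∀ p, f (f p) = p) → ∀ x,
      Even #{p ∈ B | (s p = x ∧ s (f p) = x) ∧ ¬ f p = p} := by
    intro f hf hff x
    refine even_card_of_involution _ f fun p hp => ?_
    simp only [Finset.mem_filter] at hp ⊢
    refine ⟨⟨hf p hp.1, ⟨hp.2.1.2, by rw [hff]; exact hp.2.1.1⟩, fun h => ?_⟩, hp.2.2, hff p⟩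
    rw [hff] at h
    exact hp.2.2 h.symm
  -- At most one arc leaves `B`, at the fixed point of `σ`. Non-fixed positions whose partner is in
  -- the same class come in pairs, so by parity `σ'` also has a fixed point in the class of `c`; it
  -- must be `g c`.
  have hfix : ∀ c ∈ B, σ c = c → s (g c) = s c := by
    intro c hc hcc
    have huniq : ∀ d ∈ B, σ d = d → d = c := fun d hd hdd =>
      Finset.card_le_one.mp hone d (Finset.mem_filter.mpr ⟨hd, hdd⟩) c
        (Finset.mem_filter.mpr ⟨hc, hcc⟩)
    have h1 := hcount (s c) (s c) (hBfin c hc) (hBfin c hc)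
    rw [← Finset.card_filter_add_card_filter_not (s := {p ∈ B | s p = s c ∧ s (σ p) = s c})
      (fun p => σ p = p), ← Finset.card_filter_add_card_filter_not
      (s := {p ∈ B | s p = s c ∧ s (σ' p) = s c}) (fun p => σ' p = p)] at h1
    simp only [Finset.filter_filter] at h1
    have h2 : #{p ∈ B | (s p = s c ∧ s (σ p) = s c) ∧ σ p = p} = 1 := by
      refine Finset.card_eq_one.mpr ⟨c, ?_⟩
      ext p
      simp only [Finset.mem_filter, Finset.mem_singleton]
      constructor
      · rintro ⟨hp, -, hpp⟩
        exact huniq p hp hpp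
      · rintro rfl
        exact ⟨hc, ⟨rfl, by rw [hcc]⟩, hcc⟩
    have h3 := heven σ hstab hσ (s c)
    have h4 := heven σ' hσ'B hσ' (s c)
    rw [h2] at h1
    have h5 : #{p ∈ B | (s p = s c ∧ s (σ' p) = s c) ∧ σ' p = p} ≠ 0 := by
      intro h0
      rw [h0] at h1
      obtain ⟨i, hi⟩ := h3
      obtain ⟨j, hj⟩ := h4
      omega
    obtain ⟨p, hp⟩ := Finset.card_ne_zero.mp h5
    simp only [Finset.mem_filter] at hp
    obtain ⟨hpB, ⟨hps, -⟩, hpp⟩ := hp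
    obtain ⟨q, rfl⟩ := g.surjective p
    rw [hconj] at hpp
    rw [huniq q ((hgB q).mp hpB) (g.injective hpp)] at hps
    exact hps
  -- Positions in `B` are coloured by their class and every other position by itself, so that a
  -- colour-preserving conjugation is supported on `B` and preserves classes.
  let c : P → WithTop (Fin k) ⊕ P := fun p => if p ∈ B then Sum.inl (s p) else Sum.inr p
  have cin : ∀ p ∈ B, c p = Sum.inl (s p) := fun p hp => if_pos hp
  have cout : ∀ p ∉ B, c p = Sum.inr p := fun p hp => if_neg hp
  -- a position of `B` that is matched with a position outside `B` is fixed by `σ`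
  have hcross : ∀ p ∈ B, τ p ∉ B → σ p = p := by
    intro p hp hp'
    by_contra hne
    have := mt (partner_eq_self_iff hτ p).mpr hne
    rw [not_or] at this
    have h1 : σ p = τ p := partner_of_ne_top this.1 this.2
    rw [← h1] at hp'
    exact hp' (hstab p hp)
  have hτB : ∀ p ∈ B, (τ p ∈ B ↔ σ p ≠ p) := by
    intro p hp
    refine ⟨fun h h' => ?_, fun h => by_contra fun h' => h (hcross p hp h')⟩
    rcases (partner_eq_self_iff hτ p).mp h' with h1 | h1
    · exact hBfin p hp h1
    · exact hBfin _ h h1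
  have hτ'B : ∀ p ∈ B, (τ' p ∈ B ↔ σ' p ≠ p) := by
    intro p hp
    obtain ⟨q, rfl⟩ := g.surjective p
    rw [hτg, hconj, hgB, hτB q ((hgB q).mp hp), Ne, Ne, g.injective.eq_iff]
  have hστ : ∀ p ∈ B, σ p ≠ p → σ p = τ p := fun p hp h => by
    have := mt (partner_eq_self_iff hτ p).mpr h
    rw [not_or] at this
    exact partner_of_ne_top this.1 this.2
  have hστ' : ∀ p ∈ B, σ' p ≠ p → σ' p = τ' p := fun p hp h => by
    have := mt (partner_eq_self_iff hτ' p).mpr h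
    rw [not_or] at this
    exact partner_of_ne_top this.1 this.2
  have hcc : ∀ x y, #{p | c p = x ∧ c (τ p) = y} = #{p | c p = x ∧ c (τ' p) = y} := by
    intro x y
    have hoff : ∀ p ∉ B, c (τ' p) = c (τ p) := by
      intro p hp
      have h1 := hτg p
      rw [hg p hp] at h1
      rw [h1]
      by_cases h2 : τ p ∈ B
      · rw [cin _ h2, cin _ ((hgB _).mpr h2), hfix _ h2]
        exact hcross _ h2 (by rwa [hτ.invol])
      · rw [hg _ h2]
    have hon : #{p ∈ B | c p = x ∧ c (τ p) = y} = #{p ∈ B | c p = x ∧ c (τ' p) = y} := by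
      rcases y with y | q
      · -- arcs within `B`
        have key : ∀ (f : P → P) (ρ : Equiv.Perm P), (∀ p ∈ B, (ρ p ∈ B ↔ f p ≠ p)) →
            (∀ p ∈ B, f p ≠ p → f p = ρ p) →
            #{p ∈ B | c p = x ∧ c (ρ p) = Sum.inl y} =
              #{p ∈ B | (Sum.inl (s p) = x ∧ s (f p) = y) ∧ ¬ f p = p} := by
          intro f ρ h1 h2
          congr 1
          refine Finset.filter_congr fun p hp => ?_
          rw [cin p hp]
          by_cases h3 : f p = p
          · have h4 : ρ p ∉ B := fun h => (h1 p hp).mp h h3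
            rw [cout _ h4]
            simp [h3]
          · rw [cin _ ((h1 p hp).mpr h3), h2 p hp h3]
            simp only [Sum.inl.injEq]
            rw [h2 p hp h3] at h3
            tauto
        rw [key σ τ hτB hστ, key σ' τ' hτ'B hστ']
        rcases x with x | x
        · simp only [Sum.inl.injEq]
          by_cases hx : x = ⊤
          · rw [Finset.filter_false_of_mem, Finset.filter_false_of_mem]
            · rintro p hp ⟨⟨h, -⟩, -⟩
              exact hBfin p hp (h.trans hx)
            · rintro p hp ⟨⟨h, -⟩, -⟩
              exact hBfin p hp (h.trans hx)
          by_cases hy : y = ⊤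
          · rw [Finset.filter_false_of_mem, Finset.filter_false_of_mem]
            · rintro p hp ⟨⟨-, h⟩, -⟩
              exact hBfin _ (hσ'B p hp) (h.trans hy)
            · rintro p hp ⟨⟨-, h⟩, -⟩
              exact hBfin _ (hstab p hp) (h.trans hy)
          have h1 := hcount x y hx hy
          rw [← Finset.card_filter_add_card_filter_not (s := {p ∈ B | s p = x ∧ s (σ p) = y})
            (fun p => σ p = p), ← Finset.card_filter_add_card_filter_not
            (s := {p ∈ B | s p = x ∧ s (σ' p) = y}) (fun p => σ' p = p)] at h1
          simp only [Finset.filter_filter] at h1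
          have h2 : #{p ∈ B | (s p = x ∧ s (σ p) = y) ∧ σ p = p} =
              #{p ∈ B | (s p = x ∧ s (σ' p) = y) ∧ σ' p = p} := by
            refine Finset.card_bij (fun p _ => g p) ?_ (fun p _ q _ h => g.injective h) ?_
            · intro p hp
              simp only [Finset.mem_filter] at hp ⊢
              obtain ⟨hp, ⟨h3, h4⟩, h5⟩ := hp
              rw [h5] at h4
              rw [hgB, hconj, h5, hfix p hp h5]
              exact ⟨hp, ⟨h3, h4⟩, rfl⟩
            · intro p hp
              simp only [Finset.mem_filter] at hp
              obtain ⟨hp, ⟨h3, h4⟩, h5⟩ := hp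
              obtain ⟨q, rfl⟩ := g.surjective p
              rw [h5] at h4
              rw [hconj] at h5
              have h6 := g.injective h5
              rw [hgB] at hp
              rw [hfix q hp h6] at h3 h4
              exact ⟨q, Finset.mem_filter.mpr ⟨hp, ⟨h3, by rw [h6]; exact h4⟩, h6⟩, rfl⟩
          omega
        · simp
      · -- arcs leaving `B`
        refine Finset.card_bij (fun p _ => g p) ?_ (fun p _ q _ h => g.injective h) ?_
        · intro p hp
          simp only [Finset.mem_filter] at hp ⊢
          obtain ⟨hp, h3, h4⟩ := hp
          by_cases h5 : τ p ∈ B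
          · rw [cin _ h5] at h4
            exact absurd h4 (by simp)
          · have h6 := hfix p hp (hcross p hp h5)
            rw [hτg, hg _ h5, hgB, cin _ ((hgB p).mpr hp), h6, ← cin p hp]
            exact ⟨hp, h3, h4⟩
        · intro p hp
          simp only [Finset.mem_filter] at hp
          obtain ⟨hp, h3, h4⟩ := hp
          obtain ⟨p', rfl⟩ := g.surjective p
          rw [hgB] at hp
          rw [hτg] at h4
          by_cases h5 : τ p' ∈ B
          · rw [cin _ ((hgB _).mpr h5)] at h4
            exact absurd h4 (by simp)
          · have h6 := hfix p' hp (hcross p' hp h5)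
            rw [hg _ h5] at h4
            rw [cin _ ((hgB p').mpr hp), h6, ← cin p' hp] at h3
            exact ⟨p', Finset.mem_filter.mpr ⟨hp, h3, h4⟩, rfl⟩
    have hsp : ∀ ρ : Equiv.Perm P, #{p | c p = x ∧ c (ρ p) = y} =
        #{p ∈ B | c p = x ∧ c (ρ p) = y} + #{p ∈ Bᶜ | c p = x ∧ c (ρ p) = y} := by
      intro ρ
      simp only [Finset.card_filter]
      exact (Finset.sum_add_sum_compl B _).symm
    rw [hsp, hsp, hon]
    congr 2
    refine Finset.filter_congr fun p hp => ?_
    rw [hoff p (Finset.mem_compl.mp hp)]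
  obtain ⟨h, hc, hh⟩ := exists_conj c hτ hτ' (fun x y => by convert hcc x y)
  have hhB : ∀ p ∉ B, h p = p := by
    intro p hp
    have := hc p
    rw [cout p hp] at this
    by_cases hp' : h p ∈ B
    · rw [cin _ hp'] at this
      exact absurd this (by simp)
    · rw [cout _ hp'] at this
      exact Sum.inr_injective this
  refine ⟨h, hhB, fun p => ?_, hh⟩
  by_cases hp : p ∈ B
  · have := hc p
    rw [cin p hp, cin _ ((mem_of_fixes_compl hhB p).mpr hp)] at this
    exact Sum.inl_injective this
  · rw [hhB p hp]

/-- Straightening: an admissible matching with a long decreasing sequence is a combination of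
matchings of larger weight. -/
theorem young_pairing_mem_span (hτ : IsMatching τ) {r : P → ℕ}
    (hr : IsStandardRank s (WithTop.some '' W) (partner s τ) r) {A : Finset P}
    (hA : IsDecreasingSet (partner s τ) r A) (hAfin : ∀ p ∈ A, s p ≠ ⊤) (hcard : 2 * l < #A) :
    young s (WithTop.some '' W) (pairing l τ) ∈ Submodule.span ℂ
      ((fun τ' : Equiv.Perm P => young s (WithTop.some '' W) (pairing l τ')) ''
        {τ' | IsMatching τ' ∧ weight s τ < weight s τ'}) := by
  classical
  have hσ := partner_partner (s := s) hτ
  obtain ⟨B, hB, hstab, hAB, hBA⟩ := exists_stable_isDecreasingSet hσ hr.inj hA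
  have hBfin : ∀ p ∈ B, s p ≠ ⊤ := by
    intro p hp
    rcases hBA p hp with h | h
    · exact hAfin p h
    · have := class_partner_ne_top (τ := τ) (hAfin _ h)
      rwa [hσ] at this
  set S := Submodule.span ℂ
      ((fun τ' : Equiv.Perm P => young s (WithTop.some '' W) (pairing l τ')) ''
        {τ' | IsMatching τ' ∧ weight s τ < weight s τ'})
  let G := Finset.univ.filter fun g : Equiv.Perm P => ∀ p ∉ B, g p = p
  -- The good `g` are those for which the conjugate matching is again `τ` up to a class-preserving
  -- permutation of `B`. They all contribute the same vector with the same sign; the others raise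
  -- the weight.
  let good : Equiv.Perm P → Prop := fun g => ∃ h : Equiv.Perm P, (∀ p ∉ B, h p = p) ∧
    (∀ p, s (h p) = s p) ∧ ∀ p, h (τ p) = (g * τ * g⁻¹) (h p)
  have hrel := congrArg (young s (WithTop.some '' W)) (sum_sign_smul_eq_zero (l := l)
    (hcard.trans_le hAB) (pairing l τ))
  rw [young_sum] at hrel
  have hzero : young s (WithTop.some '' W) (0 : (P → Letter l) → ℂ) = 0 := by
    have := young_smul s (WithTop.some '' W) 0 (0 : (P → Letter l) → ℂ)
    rwa [zero_smul, zero_smul] at this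
  rw [hzero, ← Finset.sum_filter_add_sum_filter_not G good] at hrel
  have h1 : ∀ g ∈ G.filter good, young s (WithTop.some '' W) (((Equiv.Perm.sign g : ℤ) : ℂ) •
      (fun w : P → Letter l => pairing l τ fun p => w (g p))) =
      young s (WithTop.some '' W) (pairing l τ) := by
    intro g hg
    obtain ⟨h, hhB, hhs, hh⟩ := (Finset.mem_filter.mp hg).2
    have hz : ∀ p, (h⁻¹ * g) (τ p) = τ ((h⁻¹ * g) p) := by
      intro p
      apply h.injective
      rw [hh]
      simp
    have e1 : (fun w : P → Letter l => pairing l τ fun p => w (g p)) =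
        ((Equiv.Perm.sign (h⁻¹ * g) : ℤ) : ℂ) •
          fun w : P → Letter l => pairing l τ fun p => w (h p) := by
      funext w
      have := pairing_comp_of_commute hτ (h⁻¹ * g) hz (fun p => w (h p))
      simpa using this
    -- On a class outside `W` the partner map increases, on `B` it decreases; so `B` meets such a
    -- class at most once and `h` acts trivially there.
    have e2 : classSign s (WithTop.some '' W) h = Equiv.Perm.sign h := by
      refine classSign_eq_sign hhs fun p hp => ?_
      by_contra hne
      have hpB : p ∈ B := by
        by_contra h'
        exact hne (hhB p h')
      have hpB' := (mem_of_fixes_compl hhB p).mpr hpB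
      rcases lt_or_gt_of_ne (fun h' => hne (hr.inj h')) with h' | h'
      · have a1 := hB _ hpB' _ hpB h'
        have a2 := hr.incr _ _ (hhs p) (by rw [hhs]; exact hp) h'
        omega
      · have a1 := hB _ hpB _ hpB' h'
        have a2 := hr.incr _ _ (hhs p).symm hp h'
        omega
    rw [e1, young_smul, young_smul, young_comp hhs, e2, smul_smul, smul_smul, Equiv.Perm.sign_mul,
      Equiv.Perm.sign_inv]
    have e3 : ∀ a b : ℤˣ, ((a : ℤ) : ℂ) * (((b * a : ℤˣ) : ℤ) : ℂ) * ((b : ℤ) : ℂ) = 1 := by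
      intro a b
      rcases Int.units_eq_one_or a with rfl | rfl <;>
        rcases Int.units_eq_one_or b with rfl | rfl <;> simp
    rw [e3, one_smul]
  have h2 : ∀ g ∈ G.filter (fun g => ¬ good g), young s (WithTop.some '' W)
      (((Equiv.Perm.sign g : ℤ) : ℂ) •
        (fun w : P → Letter l => pairing l τ fun p => w (g p))) ∈ S := by
    intro g hg
    obtain ⟨hg, hng⟩ := Finset.mem_filter.mp hg
    have hgB : ∀ p ∉ B, g p = p := (Finset.mem_filter.mp hg).2
    obtain ⟨hle, heq⟩ := weight_conj hτ hr hB hBfin hstab hgB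
    have e1 : (fun w : P → Letter l => pairing l τ fun p => w (g p)) =
        ((flipSign τ g : ℤ) : ℂ) • pairing l (g * τ * g⁻¹) := by
      funext w
      exact pairing_comp hτ g w
    rw [e1, young_smul, young_smul]
    refine S.smul_mem _ (S.smul_mem _ (Submodule.subset_span ⟨_, ⟨hτ.conj g, ?_⟩, rfl⟩))
    exact lt_of_le_of_ne hle fun h => hng (heq h)
  rw [Finset.sum_congr rfl h1, Finset.sum_const] at hrel
  -- The identity is good, so the coefficient of the leading term is a positive integer.
  have hcard' : (#(G.filter good) : ℂ) ≠ 0 := by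
    rw [Nat.cast_ne_zero]
    refine Finset.card_ne_zero.mpr ⟨1, Finset.mem_filter.mpr ⟨?_, 1, ?_, ?_, ?_⟩⟩
    · exact Finset.mem_filter.mpr ⟨Finset.mem_univ _, fun _ _ => rfl⟩
    · exact fun _ _ => rfl
    · exact fun _ => rfl
    · simp
  have h3 := S.sum_mem h2
  rw [← Nat.cast_smul_eq_nsmul ℂ] at hrel
  have h4 := eq_neg_of_add_eq_zero_left hrel
  rw [← inv_smul_smul₀ hcard' (young s (WithTop.some '' W) (pairing l τ)), h4]
  exact S.smul_mem _ (S.neg_mem h3)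

end Straightening

/-! ### The depth of a left end -/

section Depth

variable {P K : Type*} [Fintype P] [LinearOrder P]

/-- The positions that are the left end of their arc, or fixed by the involution `σ`. -/
def IsLeftEnd [Top K] (s : P → K) (σ : P → P) (r : P → ℕ) (p : P) : Prop :=
  s p ≠ ⊤ ∧ r p ≤ r (σ p)

open Classical in
/-- The largest size of a decreasing set of left ends with last element `p`. -/
noncomputable def depth [Top K] (s : P → K) (σ : P → P) (r : P → ℕ) (p : P) : ℕ :=
  (univ.filter fun B : Finset P => IsDecreasingSet σ r B ∧ p ∈ B ∧
    ∀ q ∈ B, IsLeftEnd s σ r q ∧ r q ≤ r p).sup card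

variable [Top K] {s : P → K} {σ : P → P} {r : P → ℕ} {p q : P}

theorem card_le_depth {B : Finset P} (hB : IsDecreasingSet σ r B) (hp : p ∈ B)
    (h : ∀ q ∈ B, IsLeftEnd s σ r q ∧ r q ≤ r p) : #B ≤ depth s σ r p := by
  classical
  exact Finset.le_sup (f := card) (by simpa using ⟨hB, hp, fun q hq => h q hq⟩)

theorem depth_pos (hp : IsLeftEnd s σ r p) : 1 ≤ depth s σ r p := by
  have := card_le_depth (s := s) (σ := σ) (r := r) (p := p) (B := {p})
    (by intro x hx y hy h; simp_all) (by simp) (by simpa using hp)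
  simpa using this

theorem exists_card_eq_depth (hp : IsLeftEnd s σ r p) :
    ∃ B : Finset P, IsDecreasingSet σ r B ∧ p ∈ B ∧
      (∀ q ∈ B, IsLeftEnd s σ r q ∧ r q ≤ r p) ∧ #B = depth s σ r p := by
  classical
  obtain ⟨B, hB, hB'⟩ := Finset.exists_mem_eq_sup (univ.filter fun B : Finset P =>
    IsDecreasingSet σ r B ∧ p ∈ B ∧ ∀ q ∈ B, IsLeftEnd s σ r q ∧ r q ≤ r p)
    ⟨{p}, by
      simp only [Finset.mem_filter, Finset.mem_univ, true_and]
      exact ⟨by intro x hx y hy h; simp_all, by simp, by simpa using hp⟩⟩ card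
  simp only [Finset.mem_filter, Finset.mem_univ, true_and] at hB
  exact ⟨B, hB.1, hB.2.1, hB.2.2, hB'.symm⟩

/-- A longest decreasing set finishing at `p` can be extended by `q`. Hence left ends of equal depth
form an increasing set. -/
theorem depth_lt_depth (hinj : Function.Injective r) (hp : IsLeftEnd s σ r p)
    (hq : IsLeftEnd s σ r q) (hpq : r p < r q)
    (hσ : r (σ q) < r (σ p)) : depth s σ r p < depth s σ r q := by
  obtain ⟨B, hB, hpB, h, hcard⟩ := exists_card_eq_depth hp
  have hqB : q ∉ B := fun hqB => ((h q hqB).2.trans_lt hpq).false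
  rw [← hcard, Nat.lt_iff_add_one_le, ← Finset.card_insert_of_notMem hqB]
  have hlast : ∀ x ∈ B, r (σ p) ≤ r (σ x) := by
    intro x hx
    rcases (h x hx).2.lt_or_eq with h' | h'
    · exact (hB x hx p hpB h').le
    · rw [hinj h']
  refine card_le_depth ?_ (Finset.mem_insert_self _ _) ?_
  · intro x hx y hy hxy
    rcases Finset.mem_insert.mp hx with h1 | h1 <;> rcases Finset.mem_insert.mp hy with h2 | h2
    · rw [h1, h2] at hxy
      exact absurd hxy (lt_irrefl _)
    · rw [h1] at hxy
      exact absurd (hxy.trans_le ((h y h2).2.trans hpq.le)) (lt_irrefl _)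
    · rw [h2]
      exact hσ.trans_le (hlast x h1)
    · exact hB x h1 y h2 hxy
  · intro x hx
    rcases Finset.mem_insert.mp hx with rfl | hx
    · exact ⟨hq, le_rfl⟩
    · exact ⟨(h x hx).1, (h x hx).2.trans hpq.le⟩

/-- Reflecting a decreasing set of `d` left ends gives one of at least `2 * d - 1` elements, since
at most one of them is fixed. By parity the bound `2 * l` still yields `d ≤ l`. -/
theorem depth_le (hσσ : ∀ p, σ (σ p) = p) (hinj : Function.Injective r)
    (hs : ∀ p, s p ≠ ⊤ → s (σ p) ≠ ⊤) {l : ℕ}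
    (hbound : ∀ A : Finset P, IsDecreasingSet σ r A → (∀ p ∈ A, s p ≠ ⊤) → #A ≤ 2 * l)
    (hp : IsLeftEnd s σ r p) : depth s σ r p ≤ l := by
  obtain ⟨B, hB, hpB, h, hcard⟩ := exists_card_eq_depth hp
  have hleft : ∀ q ∈ B, r q ≤ r (σ q) := fun q hq => (h q hq).1.2
  have h1 := card_union_image hσσ hinj hleft
  have h2 := card_fixed_le_one hinj hB
  have h3 := hbound _ (isDecreasingSet_union_image hσσ hinj hB hleft) (by
    intro q hq
    rcases Finset.mem_union.mp hq with hq | hq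
    · exact (h q hq).1.1
    · obtain ⟨x, hx, rfl⟩ := Finset.mem_image.mp hq
      exact hs x (h x hx).1.1)
  omega

end Depth

/-! ### Separating words -/

section Separating

variable {P : Type*} [Fintype P] [LinearOrder P] {k : ℕ} {s : P → WithTop (Fin k)}
  {W : Set (Fin k)} {τ τ' : Equiv.Perm P} {l : ℕ} {r : P → ℕ} {w : P → Letter l}

theorem IsAdmissible.apply_ne_top (hτ : IsAdmissible s (WithTop.some '' W) τ) {p : P}
    (h : s p = ⊤) : s (τ p) ≠ ⊤ := fun h' =>
  top_notMem_image (h ▸ hτ.inner p (h.trans h'.symm))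

/-- On an arc to `⊤` the end in `⊤` is the right end by definition, and the other end counts as left
since its partner is itself. -/
theorem isLeftEnd_apply_iff (hτ : IsAdmissible s (WithTop.some '' W) τ)
    (hr : Function.Injective r) (p : P) :
    IsLeftEnd s (partner s τ) r (τ p) ↔ ¬ IsLeftEnd s (partner s τ) r p := by
  unfold IsLeftEnd
  by_cases h : s p = ⊤
  · rw [partner_of_top (p := τ p) (by rwa [hτ.invol])]
    simp [h, hτ.apply_ne_top h]
  by_cases h' : s (τ p) = ⊤
  · rw [partner_of_top h']
    simp [h, h']
  · rw [partner_of_ne_top h h', partner_of_ne_top h' (by rwa [hτ.invol]), hτ.invol]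
    have := hr.ne (hτ.ne p)
    simp only [ne_eq, h, h', not_false_eq_true, true_and]
    omega

/-- The words that separate the matching `τ` from other admissible matchings: left ends receive
their depth as a letter, right ends the opposite letter. -/
structure IsSeparating (s : P → WithTop (Fin k)) (τ : Equiv.Perm P) (r : P → ℕ)
    (w : P → Letter l) : Prop where
  swap : ∀ p, w (τ p) = (w p).swap
  isLeft : ∀ p, (w p).isLeft ↔ IsLeftEnd s (partner s τ) r p
  incr : ∀ p q, (w p).isLeft → w p = w q → r p < r q → r (partner s τ p) < r (partner s τ q)

/-- The depths of left ends lie between `1` and `l`, so after a shift by one they serve as letters.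
-/
theorem exists_isSeparating (hτ : IsAdmissible s (WithTop.some '' W) τ)
    (hr : Function.Injective r)
    (hbound : ∀ A : Finset P, IsDecreasingSet (partner s τ) r A → (∀ p ∈ A, s p ≠ ⊤) →
      #A ≤ 2 * l) : ∃ w : P → Letter l, IsSeparating s τ r w := by
  classical
  have hσσ := partner_partner (s := s) hτ.toIsMatching
  have hc : ∀ p, IsLeftEnd s (partner s τ) r p →
      ∃ c : Fin l, (c : ℕ) + 1 = depth s (partner s τ) r p := by
    intro p hp
    have h1 := depth_pos hp
    have h2 := depth_le hσσ hr (fun p hp => class_partner_ne_top hp) hbound hp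
    exact ⟨⟨depth s (partner s τ) r p - 1, by omega⟩, by simp only []; omega⟩
  choose c hc using hc
  let w : P → Letter l := fun p => if h : IsLeftEnd s (partner s τ) r p then Sum.inl (c p h)
    else Sum.inr (c (τ p) ((isLeftEnd_apply_iff hτ hr p).mpr h))
  have w1 : ∀ p (h : IsLeftEnd s (partner s τ) r p), w p = Sum.inl (c p h) := fun p h => dif_pos h
  have w2 : ∀ p (h : ¬ IsLeftEnd s (partner s τ) r p), w p = Sum.inr (c (τ p)
    ((isLeftEnd_apply_iff hτ hr p).mpr h)) := fun p h => dif_neg h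
  have hl : ∀ p, (w p).isLeft ↔ IsLeftEnd s (partner s τ) r p := by
    intro p
    by_cases h : IsLeftEnd s (partner s τ) r p
    · rw [w1 p h]; simpa using h
    · rw [w2 p h]; simpa using h
  refine ⟨w, ?_, hl, ?_⟩
  · intro p
    by_cases h : IsLeftEnd s (partner s τ) r p
    · have h' : ¬ IsLeftEnd s (partner s τ) r (τ p) := by
        rw [isLeftEnd_apply_iff hτ hr]; exact not_not.mpr h
      rw [w1 p h, w2 _ h']
      simp only [hτ.invol, Sum.swap_inl]
    · have h' := (isLeftEnd_apply_iff hτ hr p).mpr h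
      rw [w2 p h, w1 _ h', Sum.swap_inr]
  · intro p q hp hpq hlt
    have hq := hp
    rw [hpq] at hq
    rw [hl] at hp hq
    rw [w1 p hp, w1 q hq] at hpq
    have hd : depth s (partner s τ) r p = depth s (partner s τ) r q := by
      rw [← hc p hp, ← hc q hq, Sum.inl_injective hpq]
    have hσinj : Function.Injective (partner s τ) := fun p q h => by rw [← hσσ p, h, hσσ]
    rcases lt_trichotomy (r (partner s τ p)) (r (partner s τ q)) with h | h | h
    · exact h
    · rw [hσinj (hr h)] at hlt
      exact absurd hlt (lt_irrefl _)
    · exact absurd (depth_lt_depth hr hp hq hlt h) (by omega)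

/-- In a class of `W` the partner map decreases, whereas on left ends with equal letters it
increases. Two right ends are handled through their partners, which are left ends with equal
letters. -/
theorem IsSeparating.eq_of_class_mem (hw : IsSeparating s τ r w)
    (hτ : IsAdmissible s (WithTop.some '' W) τ)
    (hr : IsStandardRank s (WithTop.some '' W) (partner s τ) r) {p q : P}
    (hp : s p ∈ WithTop.some '' W) (hs : s p = s q) (hpq : w p = w q) : p = q := by
  have key : ∀ p q : P, s p ∈ WithTop.some '' W → s p = s q → w p = w q → ¬ r p < r q := by
    intro p q hp hs hpq hlt
    have h1 := hr.anti p q hs hp hlt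
    by_cases hl : (w p).isLeft
    · have := hw.incr p q hl hpq hlt
      omega
    · have hl' : ¬ (w q).isLeft := hpq ▸ hl
      have hne : ∀ x, s x ∈ WithTop.some '' W → ¬ (w x).isLeft → s (τ x) ≠ ⊤ := by
        intro x hx hxl h
        rw [hw.isLeft, ← isLeftEnd_apply_iff hτ hr.inj] at hxl
        exact hxl.1 h
      have hp' := hne p hp hl
      have hq' := hne q (hs ▸ hp) hl'
      have hpt : s p ≠ ⊤ := fun h => top_notMem_image (h ▸ hp)
      have hqt : s q ≠ ⊤ := hs ▸ hpt
      rw [partner_of_ne_top hpt hp', partner_of_ne_top hqt hq'] at h1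
      have h2 := hw.incr (τ q) (τ p) (by
        rw [hw.isLeft, isLeftEnd_apply_iff hτ hr.inj, ← hw.isLeft]; exact hl')
        (by rw [hw.swap, hw.swap, hpq]) h1
      rw [partner_of_ne_top hp' (by rwa [hτ.invol]), partner_of_ne_top hq' (by rwa [hτ.invol]),
        hτ.invol, hτ.invol] at h2
      omega
  rcases lt_trichotomy (r p) (r q) with h | h | h
  · exact absurd h (key p q hp hs hpq)
  · exact hr.inj h
  · exact absurd h (key q p (hs ▸ hp) hs.symm hpq.symm)

/-- The sum of the larger class indices over the arcs between classes different from `⊤`. -/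
noncomputable def outerWeight (s : P → WithTop (Fin k)) (τ : Equiv.Perm P) : ℕ :=
  ∑ p, if s p = ⊤ ∨ s (τ p) = ⊤ then 0 else max (classIndex (s p)) (classIndex (s (τ p)))

/-- The sum of the products of the class indices over the arcs. -/
def productWeight (s : P → WithTop (Fin k)) (τ : Equiv.Perm P) : ℕ :=
  ∑ p, classIndex (s p) * classIndex (s (τ p))

theorem sum_class_conj (F : WithTop (Fin k) → WithTop (Fin k) → ℕ) {g : Equiv.Perm P}
    (hg : ∀ p, s (g p) = s p) :
    ∑ p, F (s p) (s ((g * τ * g⁻¹) p)) = ∑ p, F (s p) (s (τ p)) := by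
  rw [← Equiv.sum_comp g]
  refine Finset.sum_congr rfl fun p _ => ?_
  have : (g * τ * g⁻¹) (g p) = g (τ p) := by simp
  rw [this, hg, hg]

theorem outerWeight_conj {g : Equiv.Perm P} (hg : ∀ p, s (g p) = s p) :
    outerWeight s (g * τ * g⁻¹) = outerWeight s τ :=
  sum_class_conj (fun x y => if x = ⊤ ∨ y = ⊤ then 0 else max (classIndex x) (classIndex y)) hg

theorem productWeight_conj {g : Equiv.Perm P} (hg : ∀ p, s (g p) = s p) :
    productWeight s (g * τ * g⁻¹) = productWeight s τ :=
  sum_class_conj (fun x y => classIndex x * classIndex y) hg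

theorem sum_isLeft_eq_sum_isRight (hτ' : IsMatching τ') (hw' : ∀ p, w (τ' p) = (w p).swap)
    (F : P → P → ℕ) :
    ∑ p with (w p).isLeft, F p (τ' p) = ∑ p with ¬ (w p).isLeft, F (τ' p) p := by
  refine Finset.sum_nbij' τ' τ' ?_ ?_ (fun p _ => hτ'.invol p) (fun p _ => hτ'.invol p)
    (fun p _ => by rw [hτ'.invol])
  · intro p
    simp only [Finset.mem_filter, Finset.mem_univ, true_and, hw']
    cases w p <;> simp
  · intro p
    simp only [Finset.mem_filter, Finset.mem_univ, true_and, hw']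
    cases w p <;> simp

theorem outerWeight_eq (hτ' : IsMatching τ') (hw' : ∀ p, w (τ' p) = (w p).swap)
    (hleft : ∀ p, (w p).isLeft → s p ≠ ⊤) :
    outerWeight s τ' = 2 * ∑ p with ¬ (w p).isLeft,
      if s p = ⊤ then 0 else max (classIndex (s p)) (classIndex (s (τ' p))) := by
  have hr : ∀ p, ¬ (w p).isLeft → s (τ' p) ≠ ⊤ := fun p hp => hleft _ (by
    rw [hw']; revert hp; cases w p <;> simp)
  rw [outerWeight, ← Finset.sum_filter_add_sum_filter_not univ fun p => ((w p).isLeft : Prop),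
    sum_isLeft_eq_sum_isRight hτ' hw' (fun p q => if s p = ⊤ ∨ s q = ⊤ then 0 else
      max (classIndex (s p)) (classIndex (s q))), two_mul]
  congr 1 <;> refine Finset.sum_congr rfl fun p hp => ?_
  · simp [hr p (Finset.mem_filter.mp hp).2, max_comm]
  · simp [hr p (Finset.mem_filter.mp hp).2]

theorem sum_isLeft_eq (f : P → ℕ) :
    ∑ p with (w p).isLeft, f p = ∑ c : Fin l, ∑ p with w p = Sum.inl c, f p := by
  simp only [Finset.sum_filter]
  rw [Finset.sum_comm]
  refine Finset.sum_congr rfl fun p _ => ?_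
  rcases w p with c | c <;> simp

theorem productWeight_eq (hτ' : IsMatching τ') (hw' : ∀ p, w (τ' p) = (w p).swap) :
    productWeight s τ' = 2 * ∑ c : Fin l, ∑ p with w p = Sum.inl c,
      classIndex (s p) * classIndex (s (τ' p)) := by
  rw [productWeight, ← Finset.sum_filter_add_sum_filter_not univ fun p => ((w p).isLeft : Prop),
    ← sum_isLeft_eq, two_mul, sum_isLeft_eq_sum_isRight hτ' hw'
      (fun p q => classIndex (s p) * classIndex (s q))]
  congr 1
  exact Finset.sum_congr rfl fun p _ => mul_comm _ _

end Separating

/-! ### Comparison of weights on a separating word. -/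

section Separating

variable {P : Type*} [Fintype P] [LinearOrder P] {k : ℕ} {s : P → WithTop (Fin k)}
  {W : Set (Fin k)} {τ τ' : Equiv.Perm P} {l : ℕ} {r : P → ℕ} {w : P → Letter l}

theorem IsSeparating.class_ne_top (hw : IsSeparating s τ r w) {p : P} (hp : (w p).isLeft) :
    s p ≠ ⊤ := ((hw.isLeft p).mp hp).1

theorem IsSeparating.class_le (hw : IsSeparating s τ r w)
    (hr : IsStandardRank s (WithTop.some '' W) (partner s τ) r) {p : P} (hp : (w p).isLeft)
    (ht : s (τ p) ≠ ⊤) : classIndex (s p) ≤ classIndex (s (τ p)) := by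
  have h := (hw.isLeft p).mp hp
  have h2 := hr.le h.2
  rw [partner_of_ne_top h.1 ht] at h2
  exact (classIndex_le_iff h.1 ht).mpr h2

/-- The word fixes which positions are right ends. In `τ` the right end, if not in `⊤`, carries the
larger class index of its arc; in `τ'` this index is still a lower bound for the maximum. Equality
means that all arcs of `τ'` avoiding `⊤` point in the same direction. -/
theorem IsSeparating.outerWeight_le (hw : IsSeparating s τ r w) (hτ : IsMatching τ)
    (hr : IsStandardRank s (WithTop.some '' W) (partner s τ) r) (hτ' : IsMatching τ')
    (hw' : ∀ p, w (τ' p) = (w p).swap) :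
    outerWeight s τ ≤ outerWeight s τ' ∧ (outerWeight s τ = outerWeight s τ' →
      ∀ p, (w p).isLeft → s (τ' p) ≠ ⊤ → classIndex (s p) ≤ classIndex (s (τ' p))) := by
  have hleft : ∀ p, (w p).isLeft → s p ≠ ⊤ := fun p hp => hw.class_ne_top hp
  rw [outerWeight_eq hτ hw.swap hleft, outerWeight_eq hτ' hw' hleft]
  have hle : ∀ p ∈ univ.filter (fun p => ¬ (w p).isLeft),
      (if s p = ⊤ then 0 else max (classIndex (s p)) (classIndex (s (τ p)))) ≤
        if s p = ⊤ then 0 else max (classIndex (s p)) (classIndex (s (τ' p))) := by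
    intro p hp
    split_ifs with h
    · exact le_rfl
    · refine max_le (le_max_left _ _) (le_trans ?_ (le_max_left _ _))
      have := hw.class_le hr (p := τ p) (by
        have := (Finset.mem_filter.mp hp).2
        rw [hw.swap]; revert this; cases w p <;> simp) (by rwa [hτ.invol])
      rwa [hτ.invol] at this
  refine ⟨Nat.mul_le_mul_left _ (Finset.sum_le_sum hle), fun heq p hp ht => ?_⟩
  have h1 := (Finset.sum_eq_sum_iff_of_le hle).mp (Nat.eq_of_mul_eq_mul_left two_pos heq) (τ' p)
  have hnl : ¬ (w (τ' p)).isLeft := by rw [hw']; revert hp; cases w p <;> simp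
  specialize h1 (by simpa using hnl)
  rw [if_neg ht, if_neg ht, hτ'.invol] at h1
  have h2 := hw.class_le hr (p := τ (τ' p)) (by rw [hw.swap]; revert hnl; cases w (τ' p) <;> simp)
    (by rwa [hτ.invol])
  rw [hτ.invol] at h2
  rw [max_eq_left h2] at h1
  exact h1 ▸ le_max_right _ _

/-- On left ends with a fixed letter `τ` is increasing as far as arcs avoid `⊤`, and an increasing
arrangement is layerwise the largest. The arcs to `⊤` break this principle; they are dealt with by
an injection that is cut at the first harmful one. -/
theorem IsSeparating.layer_le (hw : IsSeparating s τ r w)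
    (hτ : IsAdmissible s (WithTop.some '' W) τ)
    (hr : IsStandardRank s (WithTop.some '' W) (partner s τ) r)
    (hτ' : IsAdmissible s (WithTop.some '' W) τ')
    (hw' : ∀ p, w (τ' p) = (w p).swap)
    (hdir : ∀ p, (w p).isLeft → s (τ' p) ≠ ⊤ → classIndex (s p) ≤ classIndex (s (τ' p)))
    (c : Fin l) {a b : ℕ} (hb : 1 ≤ b) :
    #{p ∈ univ.filter (fun p => w p = Sum.inl c) | a ≤ classIndex (s p) ∧
      b ≤ classIndex (s (τ' p))} ≤
    #{p ∈ univ.filter (fun p => w p = Sum.inl c) | a ≤ classIndex (s p) ∧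
      b ≤ classIndex (s (τ p))} := by
  classical
  have hσσ := partner_partner (s := s) hτ.toIsMatching
  have hL : ∀ p, w p = Sum.inl c → (w p).isLeft := fun p h => by rw [h]; rfl
  have hR : ∀ {ρ : Equiv.Perm P}, (∀ p, w (ρ p) = (w p).swap) → ∀ p, w p = Sum.inl c →
      w (ρ p) = Sum.inr c := fun h p hp => by rw [h, hp]; rfl
  have hR' : ∀ {ρ : Equiv.Perm P}, (∀ p, w (ρ p) = (w p).swap) → ∀ p, w p = Sum.inr c →
      w (ρ p) = Sum.inl c := fun h p hp => by rw [h, hp]; rfl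
  have hfin : ∀ x, b ≤ classIndex x → x ≠ (⊤ : WithTop (Fin k)) := by
    rintro x hx rfl
    simp only [classIndex_top] at hx
    omega
  by_cases hbad : ∃ p, w p = Sum.inl c ∧ a ≤ classIndex (s p) ∧ classIndex (s (τ p)) < b
  swap
  · push Not at hbad
    refine Finset.card_le_card fun p hp => ?_
    simp only [Finset.mem_filter, Finset.mem_univ, true_and] at hp ⊢
    exact ⟨hp.1, hp.2.1, hbad p hp.1 hp.2.1⟩
  by_cases hclose : ∃ q, w q = Sum.inr c ∧ b ≤ classIndex (s q) ∧ classIndex (s (τ q)) < a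
  swap
  · push Not at hclose
    refine Finset.card_le_card_of_injOn (fun p => τ (τ' p)) ?_ ?_
    · intro p hp
      simp only [Finset.coe_filter, Finset.mem_filter, Finset.mem_univ, true_and,
        Set.mem_ofPred_eq] at hp ⊢
      have h1 := hR hw' p hp.1
      exact ⟨hR' hw.swap _ h1, hclose _ h1 hp.2.2, by rw [hτ.invol]; exact hp.2.2⟩
    · intro p _ q _ h
      exact τ'.injective (τ.injective h)
  -- If neither of the simple inclusions works, a harmful arc of `τ` that avoids `⊤` would
  -- contradict monotonicity against the arc of `q` given by `hclose`; so harmful left ends are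
  -- matched into `⊤`.
  have hbadfix : ∀ p, w p = Sum.inl c → a ≤ classIndex (s p) → classIndex (s (τ p)) < b →
      partner s τ p = p := by
    intro p hp hpa hpb
    by_contra hne
    rw [partner_eq_self_iff hτ.toIsMatching, not_or] at hne
    obtain ⟨q, hq, hqb, hqa⟩ := hclose
    have hq' := hR' hw.swap q hq
    have hqt : s (τ q) ≠ ⊤ := hw.class_ne_top (hL _ hq')
    have h1 : r (τ q) < r p := hr.mono _ _ ((classIndex_lt_iff hqt hne.1).mp (hqa.trans_le hpa))
    have h2 := hw.incr _ _ (hL _ hq') (hq'.trans hp.symm) h1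
    rw [partner_of_ne_top hqt (by rw [hτ.invol]; exact hfin _ hqb), hτ.invol,
      partner_of_ne_top hne.1 hne.2] at h2
    have h3 := (classIndex_le_iff (hfin _ hqb) hne.2).mpr (hr.le h2.le)
    omega
  obtain ⟨x, hx, hmin⟩ := Finset.exists_min_image
    (univ.filter fun p => w p = Sum.inl c ∧ a ≤ classIndex (s p) ∧ classIndex (s (τ p)) < b) r
    (by obtain ⟨p, hp⟩ := hbad; exact ⟨p, by simpa using hp⟩)
  simp only [Finset.mem_filter, Finset.mem_univ, true_and] at hx hmin
  obtain ⟨hxc, hxa, hxb⟩ := hx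
  have hxσ := hbadfix x hxc hxa hxb
  have hxt : s x ≠ ⊤ := hw.class_ne_top (hL _ hxc)
  -- The direction of the arcs of `τ'` puts `τ' p` after `x`; otherwise `p`, `x` and `τ' p` would
  -- share a class, which belongs to `W` since it contains an arc, and there the partner map is
  -- decreasing. Then `τ (τ' p)` lies after `x` because the partner map is increasing on the letter
  -- `c` and fixes `x`.
  have hgt : ∀ p, w p = Sum.inl c → b ≤ classIndex (s (τ' p)) → ¬ r p < r x →
      r x < r (τ (τ' p)) := by
    intro p hp hpb hlt
    have h1 := hR hw' p hp
    have h2 := hR' hw.swap _ h1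
    have hq := hfin _ hpb
    have hq' : s (τ (τ' p)) ≠ ⊤ := hw.class_ne_top (hL _ h2)
    have hσ : partner s τ (τ (τ' p)) = τ' p := by
      rw [partner_of_ne_top hq' (by rwa [hτ.invol]), hτ.invol]
    have hne : τ' p ≠ x := fun h => by rw [h, hxc] at h1; cases h1
    have hxq : r x < r (τ' p) := by
      by_contra h
      have hlt' := lt_of_le_of_ne (not_lt.mp h) fun h => hne (hr.inj h)
      have c1 := hr.le hlt'.le
      have c2 := hr.le (not_lt.mp hlt)
      have hpt : s p ≠ ⊤ := hw.class_ne_top (hL _ hp)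
      have c3 := (classIndex_le_iff hpt hq).mp (hdir p (hL _ hp) hq)
      have e1 : s p = s (τ' p) := le_antisymm c3 (c1.trans c2)
      have e2 : s (τ' p) = s x := le_antisymm c1 (c2.trans c3)
      have hmem := hτ'.inner p e1
      have h3 := hr.anti _ _ e2 (e1 ▸ hmem) hlt'
      rw [hxσ] at h3
      have h4 : ¬ (w (τ' p)).isLeft := by rw [h1]; simp
      rw [hw.isLeft, IsLeftEnd, not_and] at h4
      have := h4 hq
      omega
    rcases lt_trichotomy (r (τ (τ' p))) (r x) with h | h | h
    · have := hw.incr _ _ (hL _ h2) (h2.trans hxc.symm) h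
      rw [hσ, hxσ] at this
      exact absurd this hxq.not_gt
    · have := hr.inj h
      rw [this, hxσ] at hσ
      exact absurd hσ.symm hne
    · exact h
  -- Positions before the first harmful one are kept; later ones are moved by `τ ∘ τ'`, and their
  -- images stay after `x`, so the two parts do not collide.
  refine Finset.card_le_card_of_injOn (fun p => if r p < r x then p else τ (τ' p)) ?_ ?_
  · intro p hp
    simp only [Finset.coe_filter, Finset.mem_filter, Finset.mem_univ, true_and,
      Set.mem_ofPred_eq] at hp ⊢
    obtain ⟨hp, hpa, hpb⟩ := hp
    split_ifs with hlt
    · refine ⟨hp, hpa, ?_⟩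
      by_contra h
      exact (hmin p ⟨hp, hpa, not_le.mp h⟩).not_gt hlt
    · have h2 := hR' hw.swap _ (hR hw' p hp)
      refine ⟨h2, ?_, by rwa [hτ.invol]⟩
      have h3 := (classIndex_le_iff hxt (hw.class_ne_top (hL _ h2))).mpr
        (hr.le (hgt p hp hpb hlt).le)
      omega
  · intro p hp p' hp' h
    simp only [Finset.coe_filter, Finset.mem_filter, Finset.mem_univ, true_and,
      Set.mem_ofPred_eq] at hp hp'
    dsimp only at h
    split_ifs at h with h1 h2 h2
    · exact h
    · rw [h] at h1
      exact absurd h1 (hgt p' hp'.1 hp'.2.2 h2).not_gt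
    · rw [← h] at h2
      exact absurd h2 (hgt p hp.1 hp.2.2 h1).not_gt
    · exact τ'.injective (τ.injective h)

/-- A matching compatible with a separating word of `τ` and of the same weights is conjugate to
`τ` by a permutation preserving the classes and the word. -/
theorem IsSeparating.productWeight_le (hw : IsSeparating s τ r w)
    (hτ : IsAdmissible s (WithTop.some '' W) τ)
    (hr : IsStandardRank s (WithTop.some '' W) (partner s τ) r)
    (hτ' : IsAdmissible s (WithTop.some '' W) τ')
    (hw' : ∀ p, w (τ' p) = (w p).swap) (ho : outerWeight s τ = outerWeight s τ') :
    productWeight s τ' ≤ productWeight s τ ∧ (productWeight s τ' = productWeight s τ →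
      ∃ h : Equiv.Perm P, (∀ p, (s (h p), w (h p)) = (s p, w p)) ∧ ∀ p, h (τ p) = τ' (h p)) := by
  classical
  have hdir := (hw.outerWeight_le hτ.toIsMatching hr hτ'.toIsMatching hw').2 ho
  have hlayer := fun c : Fin l => sum_mul_le_of_layers (univ.filter fun p => w p = Sum.inl c)
    (univ.filter fun p => w p = Sum.inl c) (fun p => classIndex (s p))
    (fun p => classIndex (s (τ' p))) (fun p => classIndex (s p)) (fun p => classIndex (s (τ p)))
    (fun a b _ hb => by convert hw.layer_le hτ hr hτ' hw' hdir c (a := a) hb)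
  rw [productWeight_eq hτ.toIsMatching hw.swap, productWeight_eq hτ'.toIsMatching hw']
  refine ⟨Nat.mul_le_mul_left _ (Finset.sum_le_sum fun c _ => (hlayer c).1), fun heq => ?_⟩
  have heq' := (Finset.sum_eq_sum_iff_of_le fun c _ => (hlayer c).1).mp
    (Nat.eq_of_mul_eq_mul_left two_pos heq)
  have hpos : ∀ c a b, 1 ≤ a → 1 ≤ b →
      #{p | w p = Sum.inl c ∧ classIndex (s p) = a ∧ classIndex (s (τ p)) = b} =
      #{p | w p = Sum.inl c ∧ classIndex (s p) = a ∧ classIndex (s (τ' p)) = b} := by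
    intro c a b ha hb
    have := (hlayer c).2 (heq' c (Finset.mem_univ _)) a b ha hb
    rw [Finset.filter_filter, Finset.filter_filter] at this
    exact this.symm
  have hsplit : ∀ (ρ : Equiv.Perm P) (c : Fin l) (x : WithTop (Fin k)),
      #{p | w p = Sum.inl c ∧ s p = x} =
      ∑ y, #{p | w p = Sum.inl c ∧ s p = x ∧ s (ρ p) = y} := by
    intro ρ c x
    rw [Finset.card_eq_sum_card_fiberwise (f := fun p => s (ρ p)) (t := univ)
      (fun _ _ => Finset.mem_coe.mpr (Finset.mem_univ _))]
    refine Finset.sum_congr rfl fun y _ => ?_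
    rw [Finset.filter_filter]
    simp only [and_assoc]
  have hne : ∀ c x y, y ≠ (⊤ : WithTop (Fin k)) →
      #{p | w p = Sum.inl c ∧ s p = x ∧ s (τ p) = y} =
      #{p | w p = Sum.inl c ∧ s p = x ∧ s (τ' p) = y} := by
    intro c x y hy
    by_cases hx : x = ⊤
    · subst hx
      rw [Finset.filter_false_of_mem, Finset.filter_false_of_mem]
      all_goals
        rintro p - ⟨h1, h2, -⟩
        exact hw.class_ne_top (by rw [h1]; rfl) h2
    · simpa only [classIndex_injective.eq_iff] using
        hpos c _ _ (classIndex_pos hx) (classIndex_pos hy)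
  have hcount : ∀ c x y, #{p | w p = Sum.inl c ∧ s p = x ∧ s (τ p) = y} =
      #{p | w p = Sum.inl c ∧ s p = x ∧ s (τ' p) = y} := by
    intro c x y
    by_cases hy : y = ⊤
    · subst hy
      -- The layers do not see `⊤`; the arcs to `⊤` are what remains of the positions with given
      -- class and letter.
      have h1 := (hsplit τ c x).symm.trans (hsplit τ' c x)
      rw [← Finset.add_sum_erase _ _ (Finset.mem_univ (⊤ : WithTop (Fin k))),
        ← Finset.add_sum_erase _ _ (Finset.mem_univ (⊤ : WithTop (Fin k))),
        Finset.sum_congr rfl fun y hy => hne c x y (Finset.ne_of_mem_erase hy)] at h1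
      exact Nat.add_right_cancel h1
    · exact hne c x y hy
  have hl : ∀ (x y : WithTop (Fin k)) (c : Fin l) (e : Letter l),
      #{p | (s p, w p) = (x, Sum.inl c) ∧ (s (τ p), w (τ p)) = (y, e)} =
      #{p | (s p, w p) = (x, Sum.inl c) ∧ (s (τ' p), w (τ' p)) = (y, e)} := by
    intro x y c e
    by_cases he : e = Sum.inr c
    · subst he
      convert hcount c x y using 2 <;>
      · ext p
        simp only [Finset.mem_filter, Finset.mem_univ, true_and, Prod.mk.injEq, hw.swap, hw']
        constructor
        · rintro ⟨⟨h1, h2⟩, h3, -⟩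
          exact ⟨h2, h1, h3⟩
        · rintro ⟨h2, h1, h3⟩
          exact ⟨⟨h1, h2⟩, h3, by rw [h2]; rfl⟩
    · rw [Finset.filter_false_of_mem, Finset.filter_false_of_mem] <;>
      · intro p _ h
        simp only [Prod.mk.injEq, hw.swap, hw'] at h
        refine he ?_
        rw [← h.2.2, h.1.2]
        rfl
  have hsw : ∀ {ρ : Equiv.Perm P}, IsMatching ρ → ∀ x y : WithTop (Fin k) × Letter l,
      #{p | (s p, w p) = x ∧ (s (ρ p), w (ρ p)) = y} =
      #{p | (s p, w p) = y ∧ (s (ρ p), w (ρ p)) = x} := by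
    intro ρ hρ x y
    refine Finset.card_nbij' ρ ρ ?_ ?_ (fun p _ => hρ.invol p) (fun p _ => hρ.invol p) <;>
    · intro p hp
      simp only [Finset.coe_filter, Finset.mem_univ, true_and, Set.mem_ofPred_eq, hρ.invol] at hp ⊢
      exact hp.symm
  suffices hall : ∀ x y : WithTop (Fin k) × Letter l,
      #{p | (s p, w p) = x ∧ (s (τ p), w (τ p)) = y} =
      #{p | (s p, w p) = x ∧ (s (τ' p), w (τ' p)) = y} from
    exists_conj (fun p => (s p, w p)) hτ.toIsMatching hτ'.toIsMatching
      fun x y => by convert hall x y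
  rintro ⟨x, c | c⟩ ⟨y, e⟩
  · exact hl x y c e
  · rcases e with d | d
    · have := hl y x d (Sum.inr c)
      rw [hsw hτ.toIsMatching, hsw hτ'.toIsMatching] at this
      exact this
    · refine (Finset.card_eq_zero.mpr (Finset.filter_eq_empty_iff.mpr ?_)).trans
        (Finset.card_eq_zero.mpr (Finset.filter_eq_empty_iff.mpr ?_)).symm <;>
      · intro p _ h
        simp only [Prod.mk.injEq, hw.swap, hw'] at h
        have := h.2.2
        rw [h.1.2] at this
        cases this

end Separating

/-! ### Triangularity and linear independence. -/

section Independence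

variable {P : Type*} [Fintype P] [LinearOrder P] {k : ℕ} {s : P → WithTop (Fin k)}
  {W : Set (Fin k)} {τ τ' : Equiv.Perm P} {l : ℕ} {r : P → ℕ} {w : P → Letter l}

theorem IsAdmissible.conj (hτ : IsAdmissible s (WithTop.some '' W) τ) {g : Equiv.Perm P}
    (hg : ∀ p, s (g p) = s p) : IsAdmissible s (WithTop.some '' W) (g * τ * g⁻¹) := by
  have h1 : ∀ q, (g * τ * g⁻¹) (g q) = g (τ q) := fun q => by simp
  refine ⟨hτ.toIsMatching.conj g, ?_, ?_⟩
  · intro p hp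
    obtain ⟨q, rfl⟩ := g.surjective p
    rw [h1, hg, hg] at hp
    rw [hg]
    exact hτ.inner q hp
  · intro p q h2 h3 h4 h5
    obtain ⟨p, rfl⟩ := g.surjective p
    obtain ⟨q, rfl⟩ := g.surjective q
    rw [h1, hg] at h3
    rw [h1, h1, hg, hg] at h5
    rw [hg] at h2
    rw [hg, hg] at h4
    rw [hτ.cross p q h2 h3 h4 h5]

theorem swap_of_pairing_comp_ne_zero (hτ : IsMatching τ) {g : Equiv.Perm P}
    (h : pairing l τ (fun p => w (g p)) ≠ 0) (p : P) : w ((g * τ * g⁻¹) p) = (w p).swap := by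
  obtain ⟨q, rfl⟩ := g.surjective p
  have h1 : (g * τ * g⁻¹) (g q) = g (τ q) := by simp
  rw [h1]
  exact (pairing_ne_zero_iff hτ _).mp h q

theorem exists_of_young_ne_zero {K : Set (WithTop (Fin k))} (hτ : IsMatching τ)
    (h : young s K (pairing l τ) w ≠ 0) : ∃ g : Equiv.Perm P, (∀ p, s (g p) = s p) ∧
      ∀ p, w ((g * τ * g⁻¹) p) = (w p).swap := by
  obtain ⟨g, hg, hne⟩ := Finset.exists_ne_zero_of_sum_ne_zero h
  have hg' : ∀ p, s (g p) = s p := by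
    simp only [Finset.mem_filter] at hg
    exact hg.2
  exact ⟨g, hg', swap_of_pairing_comp_ne_zero hτ (right_ne_zero_of_mul hne)⟩

/-- A nonzero value gives a class-preserving conjugate of `τ'` whose support contains the word;
conjugation changes neither weight, so the comparisons above apply. -/
theorem IsSeparating.weights_of_young_ne_zero (hw : IsSeparating s τ r w)
    (hτ : IsAdmissible s (WithTop.some '' W) τ)
    (hr : IsStandardRank s (WithTop.some '' W) (partner s τ) r)
    (hτ' : IsAdmissible s (WithTop.some '' W) τ')
    (h : young s (WithTop.some '' W) (pairing l τ') w ≠ 0) :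
    outerWeight s τ ≤ outerWeight s τ' ∧ (outerWeight s τ = outerWeight s τ' →
      productWeight s τ' ≤ productWeight s τ ∧ (productWeight s τ' = productWeight s τ →
        ∃ h : Equiv.Perm P, (∀ p, s (h p) = s p) ∧ ∀ p, h (τ p) = τ' (h p))) := by
  obtain ⟨g, hg, hgw⟩ := exists_of_young_ne_zero hτ'.toIsMatching h
  have hc := hτ'.conj hg
  rw [← outerWeight_conj (τ := τ') hg, ← productWeight_conj (τ := τ') hg]
  refine ⟨(hw.outerWeight_le hτ.toIsMatching hr hc.toIsMatching hgw).1, fun ho => ?_⟩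
  obtain ⟨h1, h2⟩ := hw.productWeight_le hτ hr hc hgw ho
  refine ⟨h1, fun hp => ?_⟩
  obtain ⟨h, hs, hh⟩ := h2 hp
  refine ⟨g⁻¹ * h, fun p => ?_, fun p => ?_⟩
  · rw [← hg, Equiv.Perm.mul_apply]
    simpa using congrArg Prod.fst (hs p)
  · rw [Equiv.Perm.mul_apply, hh]
    simp

/-- No cancellation occurs. A contributing `g` is a product `h * z`, where `h` preserves classes and
letters and is therefore trivial on `W`, and `z` is an automorphism, whose sign on the pairing
equals its character because it is even outside `W`. Hence all nonzero terms are equal. -/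
theorem IsSeparating.young_ne_zero (hw : IsSeparating s τ r w)
    (hmono : ∀ p q, s p < s q → p < q) (hτ : IsAdmissible s (WithTop.some '' W) τ)
    (hr : IsStandardRank s (WithTop.some '' W) (partner s τ) r) :
    young s (WithTop.some '' W) (pairing l τ) w ≠ 0 := by
  classical
  have hτw : pairing l τ w ≠ 0 := (pairing_ne_zero_iff hτ.toIsMatching w).mpr hw.swap
  have hterm : ∀ g : Equiv.Perm P, (∀ p, s (g p) = s p) → pairing l τ (fun p => w (g p)) ≠ 0 →
      ((classSign s (WithTop.some '' W) g : ℤ) : ℂ) * pairing l τ (fun p => w (g p)) =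
        pairing l τ w := by
    intro g hg hne
    have hc := hτ.conj hg
    obtain ⟨h, hh, hhτ⟩ := (hw.productWeight_le hτ hr hc
      (swap_of_pairing_comp_ne_zero hτ.toIsMatching hne) (outerWeight_conj hg).symm).2
      (productWeight_conj hg)
    have hhs : ∀ p, s (h p) = s p := fun p => congrArg Prod.fst (hh p)
    have hhw : ∀ p, w (h p) = w p := fun p => congrArg Prod.snd (hh p)
    obtain ⟨z, rfl⟩ : ∃ z, g = h * z := ⟨h⁻¹ * g, by simp⟩
    have hz : ∀ p, z (τ p) = τ (z p) := by
      intro p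
      apply h.injective
      rw [hhτ]
      simp
    have hzs : ∀ p, s (z p) = s p := fun p => by rw [← hhs, ← hg p]; rfl
    have e1 : classSign s (WithTop.some '' W) h = 1 :=
      classSign_eq_one hhs fun p hp =>
        hw.eq_of_class_mem hτ hr (by rwa [hhs]) (hhs p) (hhw p)
    have e2 : classSign s (WithTop.some '' W) z = Equiv.Perm.sign z := by
      rw [← classSign_mul_compl (W := WithTop.some '' W) hzs,
        classSign_compl_eq_one hτ z hmono hz hzs, mul_one]
    have e3 : pairing l τ (fun p => w ((h * z) p)) = ((Equiv.Perm.sign z : ℤ) : ℂ) *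
        pairing l τ w := by
      have := pairing_comp_of_commute hτ.toIsMatching z hz (fun p => w (h p))
      rw [funext hhw] at this
      exact this
    rw [classSign_mul hhs hzs, e1, e2, e3, one_mul, ← mul_assoc]
    rcases Int.units_eq_one_or (Equiv.Perm.sign z) with h' | h' <;> simp [h']
  have hsum : young s (WithTop.some '' W) (pairing l τ) w =
      #{g : Equiv.Perm P | (∀ p, s (g p) = s p) ∧ pairing l τ (fun p => w (g p)) ≠ 0} *
        pairing l τ w := by
    rw [young, ← nsmul_eq_mul, ← Finset.sum_const, ← Finset.filter_filter,
      Finset.sum_filter (fun g : Equiv.Perm P => pairing l τ (fun p => w (g p)) ≠ 0)]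
    refine Finset.sum_congr (by congr) fun g hg => ?_
    split_ifs with h
    · exact hterm g (Finset.mem_filter.mp hg).2 h
    · rw [not_not.mp h, mul_zero]
  rw [hsum]
  refine mul_ne_zero (Nat.cast_ne_zero.mpr (Finset.card_ne_zero.mpr ⟨1, ?_⟩)) hτw
  simpa using hτw

theorem linearIndependent_young {ι : Type*} (hmono : ∀ p q, s p < s q → p < q)
    (ρ : ι → Equiv.Perm P) (hρ : ∀ i, IsAdmissible s (WithTop.some '' W) (ρ i)) (R : ι → P → ℕ)
    (hR : ∀ i, IsStandardRank s (WithTop.some '' W) (partner s (ρ i)) (R i))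
    (hbound : ∀ i, ∀ A : Finset P, IsDecreasingSet (partner s (ρ i)) (R i) A →
      (∀ p ∈ A, s p ≠ ⊤) → #A ≤ 2 * l)
    (hinj : ∀ i j, (∃ h : Equiv.Perm P, (∀ p, s (h p) = s p) ∧ ∀ p, h (ρ i p) = ρ j (h p)) →
      i = j) :
    LinearIndependent ℂ fun i => young s (WithTop.some '' W) (pairing l (ρ i)) := by
  classical
  rw [linearIndependent_iff']
  intro t c hsum
  by_contra! hne
  obtain ⟨i₀, hi₀, hc₀⟩ := hne
  -- Among the terms with nonzero coefficient, take the largest outer weight and then the smallest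
  -- product weight; at the separating word of that term all the others vanish.
  obtain ⟨i₁, hi₁, hmax⟩ := Finset.exists_max_image (t.filter fun i => c i ≠ 0)
    (fun i => outerWeight s (ρ i)) ⟨i₀, Finset.mem_filter.mpr ⟨hi₀, hc₀⟩⟩
  obtain ⟨i, hi, hmin⟩ := Finset.exists_min_image ((t.filter fun i => c i ≠ 0).filter
    fun i => outerWeight s (ρ i) = outerWeight s (ρ i₁)) (fun i => productWeight s (ρ i))
    ⟨i₁, Finset.mem_filter.mpr ⟨hi₁, rfl⟩⟩
  obtain ⟨hit, ho⟩ := Finset.mem_filter.mp hi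
  obtain ⟨hit, hci⟩ := Finset.mem_filter.mp hit
  obtain ⟨w, hw⟩ := exists_isSeparating (hρ i) (hR i).inj (hbound i)
  have h1 := congrFun hsum w
  rw [Finset.sum_apply, Finset.sum_eq_single i] at h1
  · rw [Pi.smul_apply, smul_eq_mul, Pi.zero_apply, mul_eq_zero] at h1
    exact h1.elim hci (hw.young_ne_zero hmono (hρ i) (hR i))
  · intro j hj hji
    rw [Pi.smul_apply, smul_eq_mul]
    by_contra h
    have hj' : j ∈ t.filter fun i => c i ≠ 0 :=
      Finset.mem_filter.mpr ⟨hj, left_ne_zero_of_mul h⟩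
    obtain ⟨h2, h3⟩ := hw.weights_of_young_ne_zero (hρ i) (hR i) (hρ j) (right_ne_zero_of_mul h)
    have h4 := hmax j hj'
    have h5 : outerWeight s (ρ i) = outerWeight s (ρ j) := le_antisymm h2 (ho ▸ h4)
    obtain ⟨h6, h7⟩ := h3 h5
    exact hji (hinj i j (h7 (le_antisymm h6
      (hmin j (Finset.mem_filter.mpr ⟨hj', h5.symm.trans ho⟩))))).symm
  · intro h
    exact absurd hit h

end Independence

/-! ### Matchings with prescribed numbers of arcs between classes -/

section Existence

/-- Positions of class `x` are identified with triples `(x, y, m)` where `m < C x y`. Exchanging `x`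
and `y` and reversing `m` is an involution; it has no fixed point because the diagonal entries are
even. -/
theorem exists_isMatching {P K : Type*} [Fintype P] [LinearOrder P] [Fintype K] [DecidableEq K]
    (s : P → K) (C : K → K → ℕ) (hsymm : ∀ x y, C x y = C y x) (heven : ∀ x, Even (C x x))
    (hrow : ∀ x, #{p | s p = x} = ∑ y, C x y) :
    ∃ τ : Equiv.Perm P, IsMatching τ ∧ ∀ x y, #{p | s p = x ∧ s (τ p) = y} = C x y := by
  classical
  let T := {z : K × K × ℕ // z.2.2 < C z.1 z.2.1}
  have hfib : ∀ x, Nonempty ({p // s p = x} ≃ {z : T // z.1.1 = x}) := by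
    intro x
    let e : {z : T // z.1.1 = x} ≃ Σ y, Fin (C x y) :=
      { toFun := fun z => ⟨z.1.1.2.1, ⟨z.1.1.2.2, lt_of_lt_of_eq z.1.2 (by rw [z.2])⟩⟩
        invFun := fun z => ⟨⟨(x, z.1, z.2), z.2.2⟩, rfl⟩
        left_inv := by rintro ⟨⟨⟨x, y, m⟩, hm⟩, rfl⟩; rfl
        right_inv := by rintro ⟨y, m⟩; rfl }
    refine ⟨(Fintype.equivOfCardEq ?_).trans e.symm⟩
    rw [Fintype.card_subtype, Fintype.card_sigma, hrow]
    simp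
  let e : P ≃ T := Equiv.ofFiberEquiv (f := s) (g := fun z : T => z.1.1) fun x => (hfib x).some
  have he : ∀ p, (e p).1.1 = s p := fun p =>
    Equiv.ofFiberEquiv_map (g := fun z : T => z.1.1) (fun x => (hfib x).some) p
  let θ : T → T := fun z => ⟨(z.1.2.1, z.1.1, C z.1.1 z.1.2.1 - 1 - z.1.2.2), by
    have := z.2
    simp only [hsymm z.1.2.1 z.1.1]
    omega⟩
  have hθ : Function.Involutive θ := by
    rintro ⟨⟨x, y, m⟩, hm⟩
    have h1 : C y x - 1 - (C x y - 1 - m) = m := by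
      have := hsymm y x
      dsimp only at hm
      omega
    exact Subtype.ext (Prod.ext rfl (Prod.ext rfl h1))
  let τ : Equiv.Perm P := (e.trans hθ.toPerm).trans e.symm
  have hτ : ∀ p, e (τ p) = θ (e p) := fun p => by simp [τ]
  refine ⟨τ, ⟨fun p => e.injective (by rw [hτ, hτ, hθ]), fun p hp => ?_⟩, fun x y => ?_⟩
  · have h := hτ p
    rw [hp] at h
    generalize e p = z at h
    obtain ⟨⟨x, y, m⟩, hm⟩ := z
    have h1 : x = y := congrArg (fun z : T => z.1.1) h
    have h2 : m = C x y - 1 - m := congrArg (fun z : T => z.1.2.2) h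
    subst h1
    obtain ⟨n, hn⟩ := heven x
    dsimp only at hm
    omega
  · have h2 : ∀ p, s (τ p) = (e p).1.2.1 := fun p => by rw [← he, hτ]
    rw [← Fintype.card_fin (C x y), ← Fintype.card_subtype]
    refine Fintype.card_congr
      { toFun := fun p => ⟨(e p.1).1.2.2, ?_⟩
        invFun := fun m => ⟨e.symm ⟨(x, y, m), m.2⟩, ?_⟩
        left_inv := ?_
        right_inv := ?_ }
    · have := (e p.1).2
      rwa [he, ← h2, p.2.1, p.2.2] at this
    · rw [← he, h2]
      simp
    · rintro ⟨p, hp1, hp2⟩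
      refine Subtype.ext (e.injective (Subtype.ext ?_))
      rw [Equiv.apply_symm_apply]
      dsimp only
      rw [← hp1, ← hp2, h2, ← he]
    · intro m
      simp

end Existence

/-! ### The classes of the tensor positions -/

section Classes

variable {k : ℕ} (ν : Fin k → ℕ) (b : ℕ)

theorem sum_Iic_eq (i : Fin k) : ∑ j ∈ Iic i, ν j = ∑ j ∈ Iio i, ν j + ν i := by
  rw [← Finset.Iio_insert, Finset.sum_insert (by simp), add_comm]

theorem sum_Iic_le_sum_Iio {i j : Fin k} (h : i < j) : ∑ x ∈ Iic i, ν x ≤ ∑ x ∈ Iio j, ν x :=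
  Finset.sum_le_sum_of_subset fun x hx => by
    simp only [Finset.mem_Iic, Finset.mem_Iio] at hx ⊢
    exact hx.trans_lt h

theorem sum_Iic_le_sum (i : Fin k) : ∑ x ∈ Iic i, ν x ≤ ∑ x, ν x :=
  Finset.sum_le_sum_of_subset (Finset.subset_univ _)

variable {ν b}

theorem mem_part_coe {i : Fin k} {p : Fin (∑ i, ν i + b)} : p ∈ part ν b i ↔
    ∑ j ∈ Iio i, ν j ≤ (p : ℕ) ∧ (p : ℕ) < ∑ j ∈ Iic i, ν j := by
  simp [part]

theorem mem_part_top {p : Fin (∑ i, ν i + b)} : p ∈ part ν b ⊤ ↔ ∑ i, ν i ≤ (p : ℕ) := by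
  simp [part]

theorem lt_of_mem_part {x y : WithTop (Fin k)} (hxy : x < y) {p q : Fin (∑ i, ν i + b)}
    (hp : p ∈ part ν b x) (hq : q ∈ part ν b y) : p < q := by
  lift x to Fin k using hxy.ne_top
  rw [mem_part_coe] at hp
  rw [Fin.lt_def]
  induction y with
  | top =>
    rw [mem_part_top] at hq
    exact hp.2.trans_le ((sum_Iic_le_sum ν x).trans hq)
  | coe y =>
    rw [mem_part_coe] at hq
    exact hp.2.trans_le ((sum_Iic_le_sum_Iio ν (WithTop.coe_lt_coe.mp hxy)).trans hq.1)

theorem exists_mem_part (p : Fin (∑ i, ν i + b)) : ∃ x, p ∈ part ν b x := by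
  by_cases h : ∑ i, ν i ≤ (p : ℕ)
  · exact ⟨⊤, mem_part_top.mpr h⟩
  have hne : (univ.filter fun i : Fin k => (p : ℕ) < ∑ j ∈ Iic i, ν j).Nonempty := by
    by_contra hemp
    rw [Finset.not_nonempty_iff_eq_empty, Finset.filter_eq_empty_iff] at hemp
    rcases (univ : Finset (Fin k)).eq_empty_or_nonempty with h' | h'
    · exact h ((Finset.sum_eq_zero (f := ν) fun i hi => by rw [h'] at hi; simp at hi).trans_le
        (Nat.zero_le _))
    · have := hemp (Finset.mem_univ (univ.max' h'))
      rw [Finset.eq_univ_of_forall (s := Iic (univ.max' h')) fun i =>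
        Finset.mem_Iic.mpr (Finset.le_max' _ _ (Finset.mem_univ i))] at this
      omega
  obtain ⟨i, hi, hmin⟩ := Finset.exists_minimal hne
  simp only [Finset.mem_filter, Finset.mem_univ, true_and] at hi hmin
  refine ⟨i, mem_part_coe.mpr ⟨?_, hi⟩⟩
  by_contra hlt
  rcases (Iio i).eq_empty_or_nonempty with h' | h'
  · rw [h'] at hlt; simp at hlt
  · have hm := Finset.max'_mem _ h'
    have : Iic ((Iio i).max' h') = Iio i := by
      ext j
      rw [Finset.mem_Iic, Finset.mem_Iio]
      exact ⟨fun h => h.trans_lt (Finset.mem_Iio.mp hm),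
        fun h => Finset.le_max' _ _ (Finset.mem_Iio.mpr h)⟩
    have h1 := hmin (y := (Iio i).max' h') (by rw [this]; omega) (Finset.mem_Iio.mp hm).le
    exact h1.not_gt (Finset.mem_Iio.mp hm)

theorem card_fin_Ico {N a c : ℕ} (hc : c ≤ N) : #{p : Fin N | a ≤ (p : ℕ) ∧ (p : ℕ) < c} = c - a := by
  rw [← Nat.card_Ico, ← Finset.card_map Fin.valEmbedding]
  congr 1
  ext x
  simp only [Finset.mem_map, Finset.mem_filter, Finset.mem_univ, true_and, Fin.valEmbedding_apply,
    Finset.mem_Ico]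
  constructor
  · rintro ⟨p, hp, rfl⟩
    exact hp
  · intro hx
    exact ⟨⟨x, hx.2.trans_le hc⟩, hx, rfl⟩

theorem card_part_coe (i : Fin k) : #(part ν b i) = ν i := by
  have : part ν b i = univ.filter fun p : Fin (∑ i, ν i + b) =>
      ∑ j ∈ Iio i, ν j ≤ (p : ℕ) ∧ (p : ℕ) < ∑ j ∈ Iic i, ν j := by
    ext p; simp [mem_part_coe]
  rw [this, card_fin_Ico ((sum_Iic_le_sum ν i).trans (Nat.le_add_right _ _)), sum_Iic_eq]
  omega

theorem card_part_top : #(part ν b ⊤) = b := by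
  have : part ν b ⊤ = univ.filter fun p : Fin (∑ i, ν i + b) =>
      ∑ j, ν j ≤ (p : ℕ) ∧ (p : ℕ) < ∑ j, ν j + b := by
    ext p; simp [mem_part_top]
  rw [this, card_fin_Ico le_rfl]
  omega

variable (ν b) in
/-- The class of a tensor position. -/
noncomputable def classOf (p : Fin (∑ i, ν i + b)) : WithTop (Fin k) :=
  (exists_mem_part p).choose

theorem mem_part_iff (p : Fin (∑ i, ν i + b)) (x : WithTop (Fin k)) :
    p ∈ part ν b x ↔ classOf ν b p = x := by
  have h := (exists_mem_part p).choose_spec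
  refine ⟨fun hx => ?_, fun hx => hx ▸ h⟩
  rcases lt_trichotomy (classOf ν b p) x with h' | h' | h'
  · exact absurd (lt_of_mem_part h' h hx) (lt_irrefl _)
  · exact h'
  · exact absurd (lt_of_mem_part h' hx h) (lt_irrefl _)

theorem lt_of_classOf_lt (p q : Fin (∑ i, ν i + b)) (h : classOf ν b p < classOf ν b q) : p < q :=
  lt_of_mem_part h ((mem_part_iff p _).mpr rfl) ((mem_part_iff q _).mpr rfl)

theorem card_classOf_coe (i : Fin k) : #{p | classOf ν b p = i} = ν i := by
  rw [← card_part_coe (ν := ν) (b := b) i]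
  congr 1
  ext p
  simp [mem_part_iff]

theorem card_classOf_top : #{p | classOf ν b p = ⊤} = b := by
  conv_rhs => rw [← card_part_top (ν := ν) (b := b)]
  congr 1
  ext p
  simp [mem_part_iff]

end Classes

/-! ### Matchings and symmetric multisets -/

section Multiplicities

variable {k : ℕ}

theorem fixedPointMult_of_mem {V : Set (Fin k)} {i : Fin k} (h : i ∈ V)
    (M : Multiset (Fin k × Fin k)) : fixedPointMult V M i = M.count (i, i) := if_pos h

theorem fixedPointMult_of_notMem {V : Set (Fin k)} {i : Fin k} (h : i ∉ V)
    (M : Multiset (Fin k × Fin k)) : fixedPointMult V M i = M.count (i, i) % 2 := if_neg h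

theorem fixedPointMult_le (V : Set (Fin k)) (M : Multiset (Fin k × Fin k)) (i : Fin k) :
    fixedPointMult V M i ≤ M.count (i, i) := by
  unfold fixedPointMult
  split_ifs
  · exact le_rfl
  · exact Nat.mod_le _ _

theorem count_map_fst (M : Multiset (Fin k × Fin k)) (i : Fin k) :
    (M.map Prod.fst).count i = ∑ j, M.count (i, j) := by
  induction M using Multiset.induction with
  | empty => simp
  | cons a M ih =>
    obtain ⟨x, y⟩ := a
    rw [Multiset.map_cons, Multiset.count_cons, ih]
    simp only [Multiset.count_cons, Finset.sum_add_distrib, Prod.mk.injEq, ite_and]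
    congr 1
    split_ifs <;> simp

theorem map_swap_eq_iff (M : Multiset (Fin k × Fin k)) :
    M.map Prod.swap = M ↔ ∀ i j, M.count (i, j) = M.count (j, i) := by
  have h : ∀ i j, (M.map Prod.swap).count (i, j) = M.count (j, i) := fun i j =>
    Multiset.count_map_eq_count' Prod.swap M Prod.swap_injective (j, i)
  constructor
  · intro hM i j
    rw [← h, hM]
  · intro hM
    ext ⟨i, j⟩
    rw [h, hM]

theorem count_withInfinity_coe_coe (V : Set (Fin k)) (M : Multiset (Fin k × Fin k)) (i j : Fin k) :
    (withInfinity V M).count ((i : WithTop (Fin k)), (j : WithTop (Fin k))) =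
      M.count (i, j) - if i = j then fixedPointMult V M i else 0 := by
  have hinj : Function.Injective fun x : Fin k × Fin k =>
      ((x.1 : WithTop (Fin k)), (x.2 : WithTop (Fin k))) := by
    rintro ⟨a, b⟩ ⟨c, d⟩ h
    simpa using h
  rw [withInfinity, Multiset.count_add, Multiset.count_map_eq_count' _ _ hinj (i, j),
    Multiset.count_sub, Multiset.count_sum', Multiset.count_sum']
  simp only [Multiset.count_nsmul, Multiset.insert_eq_cons, Multiset.count_cons,
    Multiset.count_singleton, Prod.mk.injEq, WithTop.coe_ne_top, and_false, false_and, if_false,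
    add_zero, mul_zero, Finset.sum_const_zero]
  congr 1
  rw [Finset.sum_eq_single i]
  · simp [eq_comm]
  · intro x _ hx
    simp [Ne.symm hx]
  · simp

theorem count_withInfinity_coe_top (V : Set (Fin k)) (M : Multiset (Fin k × Fin k)) (i : Fin k) :
    (withInfinity V M).count ((i : WithTop (Fin k)), ⊤) = fixedPointMult V M i := by
  rw [withInfinity, Multiset.count_add, Multiset.count_sum', Multiset.count_eq_zero_of_notMem,
    zero_add]
  · rw [Finset.sum_eq_single i]
    · simp
    · intro x _ hx
      simp [Ne.symm hx]
    · simp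
  · simp

theorem count_withInfinity_top_coe (V : Set (Fin k)) (M : Multiset (Fin k × Fin k)) (i : Fin k) :
    (withInfinity V M).count (⊤, (i : WithTop (Fin k))) = fixedPointMult V M i := by
  rw [withInfinity, Multiset.count_add, Multiset.count_sum', Multiset.count_eq_zero_of_notMem,
    zero_add]
  · rw [Finset.sum_eq_single i]
    · simp
    · intro x _ hx
      simp [Ne.symm hx]
    · simp
  · simp

theorem count_withInfinity_top_top (V : Set (Fin k)) (M : Multiset (Fin k × Fin k)) :
    (withInfinity V M).count ((⊤ : WithTop (Fin k)), (⊤ : WithTop (Fin k))) = 0 := by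
  rw [withInfinity, Multiset.count_add, Multiset.count_sum', Multiset.count_eq_zero_of_notMem,
    zero_add]
  · simp
  · simp

end Multiplicities

/-! ### Matchings that represent a multiset. -/

section Represents

variable {k : ℕ} {ν : Fin k → ℕ} {b : ℕ} {W : Set (Fin k)}
  {τ : Equiv.Perm (Fin (∑ i, ν i + b))} {M : Multiset (Fin k × Fin k)}

theorem represents_iff {M' : Multiset (WithTop (Fin k) × WithTop (Fin k))} :
    Represents ν b M' τ ↔ IsMatching τ ∧
      ∀ x y, #{p | classOf ν b p = x ∧ classOf ν b (τ p) = y} = M'.count (x, y) := by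
  have : ∀ x y, (univ.filter fun p => p ∈ part ν b x ∧ τ p ∈ part ν b y) =
      univ.filter fun p => classOf ν b p = x ∧ classOf ν b (τ p) = y := by
    intro x y
    ext p
    simp [mem_part_iff]
  simp only [Represents, this]
  exact ⟨fun h => ⟨⟨h.1, h.2.1⟩, h.2.2⟩, fun h => ⟨h.1.invol, h.1.ne, h.2⟩⟩

theorem sum_withTop (f : WithTop (Fin k) → ℕ) : ∑ x, f x = f ⊤ + ∑ i : Fin k, f i :=
  Fintype.sum_option f

/-- The counts of the extended multiset satisfy `exists_isMatching`: moving fixed points to `⊤`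
makes the diagonal even, the row sums give `ν`, and the row of `⊤` sums to the number `b` of fixed
points. -/
theorem exists_represents (hM : M ∈ symmetricMultisets Wᶜ ν b) :
    ∃ τ, Represents ν b (withInfinity Wᶜ M) τ := by
  classical
  obtain ⟨hsw, hcomp, hrow, hfix⟩ := hM
  rw [map_swap_eq_iff] at hsw
  suffices h : ∃ τ : Equiv.Perm (Fin (∑ i, ν i + b)), IsMatching τ ∧ ∀ x y,
      #{p | classOf ν b p = x ∧ classOf ν b (τ p) = y} = (withInfinity Wᶜ M).count (x, y) by
    obtain ⟨τ, hτ, h⟩ := h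
    exact ⟨τ, represents_iff.mpr ⟨hτ, fun x y => by convert h x y⟩⟩
  refine exists_isMatching (classOf ν b) (fun x y => (withInfinity Wᶜ M).count (x, y)) ?_ ?_ ?_
  · intro x y
    induction x <;> induction y
    · rfl
    · simp only [count_withInfinity_coe_top, count_withInfinity_top_coe]
    · simp only [count_withInfinity_coe_top, count_withInfinity_top_coe]
    · rename_i i j
      simp only [count_withInfinity_coe_coe]
      rw [hsw]
      by_cases h : i = j
      · rw [h]
      · rw [if_neg h, if_neg (Ne.symm h)]
  · intro x
    induction x with
    | top => rw [count_withInfinity_top_top]; exact Even.zero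
    | coe i =>
      rw [count_withInfinity_coe_coe, if_pos rfl]
      by_cases h : i ∈ Wᶜ
      · rw [fixedPointMult_of_mem h, Nat.sub_self]; exact Even.zero
      · rw [fixedPointMult_of_notMem h, Nat.even_iff]; omega
  · intro x
    rw [sum_withTop]
    induction x with
    | top =>
      simp only [count_withInfinity_top_top, count_withInfinity_top_coe]
      rw [card_classOf_top, hfix, zero_add]
    | coe i =>
      simp only [count_withInfinity_coe_top, count_withInfinity_coe_coe]
      rw [card_classOf_coe, ← hrow, count_map_fst,
        ← Finset.add_sum_erase _ _ (Finset.mem_univ i),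
        ← Finset.add_sum_erase _ (fun j => M.count (i, j) - _) (Finset.mem_univ i),
        if_pos rfl, ← add_assoc, add_tsub_cancel_of_le (fixedPointMult_le _ _ _)]
      congr 1
      refine Finset.sum_congr rfl fun j hj => ?_
      rw [if_neg (Finset.ne_of_mem_erase hj).symm, Nat.sub_zero]

theorem card_partner {P : Type*} [Fintype P] [LinearOrder P] (s : P → WithTop (Fin k))
    (τ : Equiv.Perm P) (i j : Fin k) :
    #{p | s p = i ∧ s (partner s τ p) = j} = #{p | s p = i ∧ s (τ p) = j} +
      if i = j then #{p | s p = i ∧ s (τ p) = ⊤} else 0 := by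
  have h : ∀ p, (if s p = i ∧ s (partner s τ p) = j then 1 else 0) =
      (if s p = i ∧ s (τ p) = j then 1 else 0) +
        if i = j then (if s p = i ∧ s (τ p) = ⊤ then 1 else 0) else 0 := by
    intro p
    by_cases hp : s p = i
    · by_cases ht : s (τ p) = ⊤
      · rw [partner_of_top ht, ht, hp]
        simp
      · rw [partner_of_ne_top (by simp [hp]) ht]
        simp [ht]
    · simp [hp]
  simp only [Finset.card_filter]
  rw [Finset.sum_congr rfl fun p _ => h p, Finset.sum_add_distrib]
  congr 1
  split_ifs <;> simp

/-- Compatibility bounds the arcs between a class in `W` and a finite class outside; for `⊤` the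
bound comes from the fixed-point multiplicity, which is a residue modulo `2` on `W`. Outside `W` all
diagonal points are moved to `⊤`, so no inner arcs remain. -/
theorem Represents.isAdmissible (hM : M ∈ symmetricMultisets Wᶜ ν b)
    (hτ : Represents ν b (withInfinity Wᶜ M) τ) :
    IsAdmissible (classOf ν b) (WithTop.some '' W) τ := by
  obtain ⟨-, hcomp, -, -⟩ := hM
  obtain ⟨hτ, hcount⟩ := represents_iff.mp hτ
  refine ⟨hτ, ?_, ?_⟩
  · intro p hp
    by_contra hpW
    have h1 := hcount (classOf ν b p) (classOf ν b p)
    have h2 : (withInfinity Wᶜ M).count (classOf ν b p, classOf ν b p) = 0 := by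
      generalize classOf ν b p = x at hpW
      induction x with
      | top => exact count_withInfinity_top_top _ _
      | coe i =>
        rw [count_withInfinity_coe_coe, if_pos rfl, fixedPointMult_of_mem, Nat.sub_self]
        exact fun h => hpW ⟨i, h, rfl⟩
    rw [h2, Finset.card_eq_zero, Finset.filter_eq_empty_iff] at h1
    exact h1 (Finset.mem_univ p) ⟨rfl, hp.symm⟩
  · intro p q hp hp' hq hq'
    have h1 := hcount (classOf ν b p) (classOf ν b (τ p))
    have h2 : (withInfinity Wᶜ M).count (classOf ν b p, classOf ν b (τ p)) ≤ 1 := by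
      obtain ⟨i, hi, hip⟩ := hp
      rw [← hip]
      generalize classOf ν b (τ p) = y at hp'
      induction y with
      | top =>
        rw [count_withInfinity_coe_top, fixedPointMult_of_notMem (not_not.mpr hi)]
        omega
      | coe j =>
        have hj : j ∉ W := fun h => hp' ⟨j, h, rfl⟩
        rw [count_withInfinity_coe_coe]
        exact (Nat.sub_le _ _).trans (hcomp i j fun h => h.mpr hj hi)
    rw [← h1, Finset.card_le_one] at h2
    exact h2 q (by simpa using ⟨hq, hq'⟩) p (by simp)

/-- The partner map undoes the passage to `⊤`, so the multiset can be read off from any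
representative. -/
theorem Represents.count_eq (hτ : Represents ν b (withInfinity Wᶜ M) τ) (i j : Fin k) :
    M.count (i, j) = #{p | classOf ν b p = i ∧ classOf ν b (partner (classOf ν b) τ p) = j} := by
  obtain ⟨hτ, hcount⟩ := represents_iff.mp hτ
  rw [card_partner, hcount, hcount, count_withInfinity_coe_coe, count_withInfinity_coe_top]
  split_ifs with h
  · subst h
    exact (Nat.sub_add_cancel (fixedPointMult_le _ _ _)).symm
  · simp

end Represents

/-! ### Admissible matchings up to conjugation and symmetric multisets. -/

section Represents

variable {k : ℕ} {ν : Fin k → ℕ} {b : ℕ} {W : Set (Fin k)}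
  {τ τ' : Equiv.Perm (Fin (∑ i, ν i + b))} {M : Multiset (Fin k × Fin k)} {l : ℕ}

theorem exists_multiset_count (m : Fin k → Fin k → ℕ) :
    ∃ M : Multiset (Fin k × Fin k), ∀ i j, M.count (i, j) = m i j := by
  refine ⟨∑ x : Fin k × Fin k, m x.1 x.2 • {x}, fun i j => ?_⟩
  rw [Multiset.count_sum', Finset.sum_eq_single (i, j)]
  · simp
  · intro x _ hx
    simp [hx.symm]
  · simp

theorem IsAdmissible.exists_multiset (hτ : IsAdmissible (classOf ν b) (WithTop.some '' W) τ) :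
    ∃ M ∈ symmetricMultisets Wᶜ ν b, Represents ν b (withInfinity Wᶜ M) τ := by
  classical
  set s := classOf ν b with hs
  obtain ⟨M, hM⟩ := exists_multiset_count fun i j : Fin k =>
    #{p | s p = i ∧ s (partner s τ p) = j}
  have hpp := partner_partner (s := s) hτ.toIsMatching
  have hM' : ∀ i j : Fin k, M.count (i, j) = #{p | s p = i ∧ s (τ p) = j} +
      if i = j then #{p | s p = i ∧ s (τ p) = ⊤} else 0 := fun i j => by
    rw [hM, ← card_partner]
  have hsymm : ∀ i j, M.count (i, j) = M.count (j, i) := by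
    intro i j
    rw [hM, hM]
    refine Finset.card_nbij' (partner s τ) (partner s τ) ?_ ?_ (fun p _ => hpp p) fun p _ => hpp p
    all_goals
      intro p hp
      simp only [Finset.coe_filter, Finset.mem_univ, true_and, Set.mem_ofPred_eq, hpp] at hp ⊢
      exact hp.symm
  -- Outside `W` there are no inner arcs, so the diagonal multiplicity counts arcs to `⊤`; in `W`
  -- inner arcs contribute an even number and there is at most one arc to `⊤`, so the residue modulo
  -- `2` counts it.
  have hfix : ∀ i, fixedPointMult Wᶜ M i = #{p | s p = i ∧ s (τ p) = ⊤} := by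
    intro i
    by_cases hi : i ∈ Wᶜ
    · rw [fixedPointMult_of_mem hi, hM', if_pos rfl, Finset.card_eq_zero.mpr, zero_add]
      refine Finset.filter_eq_empty_iff.mpr fun p _ hp => hi ?_
      obtain ⟨j, hj, hji⟩ := hτ.inner p (hp.1.trans hp.2.symm)
      rw [hp.1] at hji
      rwa [← WithTop.coe_injective hji]
    · rw [fixedPointMult_of_notMem hi, hM', if_pos rfl]
      have hev : Even #{p | s p = i ∧ s (τ p) = i} := by
        refine even_card_of_involution _ τ fun p hp => ?_
        simp only [Finset.mem_filter, Finset.mem_univ, true_and] at hp ⊢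
        rw [hτ.invol]
        exact ⟨hp.symm, hτ.ne p, rfl⟩
      have hle : #{p | s p = i ∧ s (τ p) = ⊤} ≤ 1 := by
        refine Finset.card_le_one.mpr fun q hq p hp => ?_
        simp only [Finset.mem_filter, Finset.mem_univ, true_and] at hp hq
        exact hτ.cross p q (hp.1 ▸ ⟨i, not_not.mp hi, rfl⟩) (hp.2 ▸ top_notMem_image)
          (hq.1.trans hp.1.symm) (hq.2.trans hp.2.symm)
      obtain ⟨n, hn⟩ := hev
      omega
  have hcomp : ∀ i j, i ∈ W → j ∉ W → M.count (i, j) ≤ 1 := by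
    intro i j hi hj
    rw [hM', if_neg (by rintro rfl; exact hj hi), add_zero]
    refine Finset.card_le_one.mpr fun q hq p hp => ?_
    simp only [Finset.mem_filter, Finset.mem_univ, true_and] at hp hq
    refine hτ.cross p q (hp.1 ▸ ⟨i, hi, rfl⟩) ?_ (hq.1.trans hp.1.symm) (hq.2.trans hp.2.symm)
    rw [hp.2]
    rintro ⟨x, hx, hxj⟩
    exact hj (WithTop.coe_injective hxj ▸ hx)
  refine ⟨M, ⟨(map_swap_eq_iff M).mpr hsymm, ?_, ?_, ?_⟩, represents_iff.mpr ⟨hτ.toIsMatching, ?_⟩⟩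
  · intro i j hij
    by_cases hi : i ∈ W
    · by_cases hj : j ∈ W
      · exact absurd (by simp [hi, hj]) hij
      · exact hcomp i j hi hj
    · by_cases hj : j ∈ W
      · rw [hsymm]
        exact hcomp j i hj hi
      · exact absurd (by simp [hi, hj]) hij
  · intro i
    rw [count_map_fst, ← card_classOf_coe (ν := ν) (b := b) i,
      Finset.card_eq_sum_card_fiberwise (f := fun p => s (partner s τ p)) (t := univ)
      (fun _ _ => Finset.mem_coe.mpr (Finset.mem_univ _)), sum_withTop, Finset.card_eq_zero.mpr,
      zero_add]
    · refine Finset.sum_congr rfl fun j _ => ?_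
      rw [hM, Finset.filter_filter]
    · rw [Finset.filter_filter]
      refine Finset.filter_eq_empty_iff.mpr fun p _ hp => ?_
      exact class_partner_ne_top (by rw [hs, hp.1]; exact WithTop.coe_ne_top) hp.2
  · have h1 : #{p | s p = ⊤} = #{p | s (τ p) = ⊤} := by
      refine Finset.card_nbij' τ τ ?_ ?_ (fun p _ => hτ.invol p) fun p _ => hτ.invol p
      all_goals
        intro p hp
        simpa [hτ.invol] using hp
    rw [← card_classOf_top (ν := ν) (b := b), ← hs, h1,
      Finset.card_eq_sum_card_fiberwise (f := s) (t := univ)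
      (fun _ _ => Finset.mem_coe.mpr (Finset.mem_univ _)), sum_withTop, Finset.card_eq_zero.mpr,
      zero_add]
    · refine Finset.sum_congr rfl fun i _ => ?_
      rw [hfix, Finset.filter_filter]
      congr 1
      exact Finset.filter_congr fun p _ => and_comm
    · rw [Finset.filter_filter]
      exact Finset.filter_eq_empty_iff.mpr fun p _ hp => hτ.apply_ne_top hp.2 hp.1
  · intro x y
    rw [← hs]
    induction x with
    | top =>
      induction y with
      | top =>
        rw [count_withInfinity_top_top, Finset.card_eq_zero]
        exact Finset.filter_eq_empty_iff.mpr fun p _ hp => hτ.apply_ne_top hp.1 hp.2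
      | coe j =>
        rw [count_withInfinity_top_coe, hfix]
        refine Finset.card_nbij' τ τ ?_ ?_ (fun p _ => hτ.invol p) fun p _ => hτ.invol p
        all_goals
          intro p hp
          simp only [Finset.coe_filter, Finset.mem_univ, true_and, Set.mem_ofPred_eq,
            hτ.invol] at hp ⊢
          exact hp.symm
    | coe i =>
      induction y with
      | top =>
        rw [count_withInfinity_coe_top, hfix]
      | coe j =>
        rw [count_withInfinity_coe_coe, hM', hfix]
        split_ifs <;> omega

theorem Represents.exists_conj (hτ : Represents ν b (withInfinity Wᶜ M) τ)
    (hτ' : Represents ν b (withInfinity Wᶜ M) τ') :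
    ∃ h : Equiv.Perm (Fin (∑ i, ν i + b)), (∀ p, classOf ν b (h p) = classOf ν b p) ∧
      ∀ p, h (τ p) = τ' (h p) := by
  obtain ⟨h1, h2⟩ := represents_iff.mp hτ
  obtain ⟨h3, h4⟩ := represents_iff.mp hτ'
  exact SympInv.exists_conj _ h1 h3 fun x y => by convert (h2 x y).trans (h4 x y).symm

theorem eq_of_represents_of_conj {M' : Multiset (Fin k × Fin k)}
    (hτ : Represents ν b (withInfinity Wᶜ M) τ)
    (hτ' : Represents ν b (withInfinity Wᶜ M') τ') {h : Equiv.Perm (Fin (∑ i, ν i + b))}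
    (hs : ∀ p, classOf ν b (h p) = classOf ν b p) (hh : ∀ p, h (τ p) = τ' (h p)) : M = M' := by
  have hcard : ∀ x y, #{p | classOf ν b p = x ∧ classOf ν b (τ p) = y} =
      #{p | classOf ν b p = x ∧ classOf ν b (τ' p) = y} := by
    intro x y
    refine Finset.card_equiv h fun p => ?_
    simp only [Finset.mem_filter, Finset.mem_univ, true_and]
    rw [← hh, hs, hs]
  ext ⟨i, j⟩
  rw [hτ.count_eq, hτ'.count_eq, card_partner, card_partner, hcard, hcard]

/-- The multiset is the image of the positions outside `⊤` under recording the class of a position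
and of its partner, so the two comparison lemmas for decreasing sequences and sets apply. -/
theorem decLength_of_represents (hM : M ∈ symmetricMultisets Wᶜ ν b)
    (hτ : Represents ν b (withInfinity Wᶜ M) τ) {r : Fin (∑ i, ν i + b) → ℕ}
    (hr : IsStandardRank (classOf ν b) (WithTop.some '' W) (partner (classOf ν b) τ) r) :
    (∀ A : Finset (Fin (∑ i, ν i + b)), IsDecreasingSet (partner (classOf ν b) τ) r A →
      (∀ p ∈ A, classOf ν b p ≠ ⊤) → #A ≤ decLength W W M) ∧
    ∃ A : Finset (Fin (∑ i, ν i + b)), IsDecreasingSet (partner (classOf ν b) τ) r A ∧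
      (∀ p ∈ A, classOf ν b p ≠ ⊤) ∧ #A = decLength W W M := by
  classical
  have had := hτ.isAdmissible hM
  have hσ := partner_partner (s := classOf ν b) had.toIsMatching
  obtain ⟨φ, hφ⟩ : ∃ φ : Fin (∑ i, ν i + b) → Fin k × Fin k, ∀ p, classOf ν b p ≠ ⊤ →
      classOf ν b p = (φ p).1 ∧ classOf ν b (partner (classOf ν b) τ p) = (φ p).2 := by
    have : ∀ p, ∃ x : Fin k × Fin k, classOf ν b p ≠ ⊤ →
        classOf ν b p = x.1 ∧ classOf ν b (partner (classOf ν b) τ p) = x.2 := by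
      intro p
      by_cases hp : classOf ν b p = ⊤
      · obtain ⟨i, hi⟩ := WithTop.ne_top_iff_exists.mp (had.apply_ne_top hp)
        exact ⟨(i, i), fun h => absurd hp h⟩
      · obtain ⟨i, hi⟩ := WithTop.ne_top_iff_exists.mp hp
        obtain ⟨j, hj⟩ := WithTop.ne_top_iff_exists.mp (class_partner_ne_top (τ := τ) hp)
        exact ⟨(i, j), fun _ => ⟨hi.symm, hj.symm⟩⟩
    choose φ hφ using this
    exact ⟨φ, hφ⟩
  set F := univ.filter fun p => classOf ν b p ≠ ⊤ with hF
  have hMF : M = F.val.map φ := by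
    ext ⟨i, j⟩
    rw [hτ.count_eq, Multiset.count_map, ← Finset.filter_val, Finset.card_val, hF,
      Finset.filter_filter]
    congr 1
    ext p
    simp only [Finset.mem_filter, Finset.mem_univ, true_and]
    constructor
    · rintro ⟨h1, h2⟩
      have hp : classOf ν b p ≠ ⊤ := by rw [h1]; exact WithTop.coe_ne_top
      obtain ⟨h3, h4⟩ := hφ p hp
      exact ⟨hp, Prod.ext (WithTop.coe_injective (h1.symm.trans h3))
        (WithTop.coe_injective (h2.symm.trans h4))⟩
    · rintro ⟨hp, h⟩
      have := hφ p hp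
      rwa [← h] at this
  have hφF : ∀ p ∈ F, classOf ν b p = (φ p).1 ∧
      classOf ν b (partner (classOf ν b) τ p) = (φ p).2 := fun p hp =>
    hφ p (by simpa [hF] using hp)
  rw [hMF]
  refine ⟨fun A hA hfin => card_le_decLength hr hσ hφF
    (fun p hp => by simpa [hF] using hfin p hp) hA, ?_⟩
  obtain ⟨A, hAF, hA, hcard⟩ := exists_isDecreasingSet hr hσ hφF
  exact ⟨A, hA, fun p hp => by simpa [hF] using hAF hp, hcard⟩

end Represents

/-! ### The basis of the invariants -/

section Basis

variable {k : ℕ} {ν : Fin k → ℕ} {b : ℕ} {W : Set (Fin k)} {l : ℕ}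

theorem coords_projector_basicInvariant (τ : Equiv.Perm (Fin (∑ i, ν i + b))) :
    coords l _ (projector l W ν b (basicInvariant l _ τ)) =
      young (classOf ν b) (WithTop.some '' W) (pairing l τ) := by
  rw [coords_projector W ν b _ mem_part_iff, coords_basicInvariant]

theorem young_pairing_mem_span_of_conj {τ τ' : Equiv.Perm (Fin (∑ i, ν i + b))} (hτ : IsMatching τ)
    {h : Equiv.Perm (Fin (∑ i, ν i + b))}
    (hs : ∀ p, classOf ν b (h p) = classOf ν b p) (hh : ∀ p, h (τ p) = τ' (h p)) :
    young (classOf ν b) (WithTop.some '' W) (pairing l τ) ∈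
      Submodule.span ℂ {young (classOf ν b) (WithTop.some '' W) (pairing l τ')} := by
  have h1 := young_comp (W := WithTop.some '' W) hs (pairing l τ)
  have h2 : (fun w : Fin (∑ i, ν i + b) → Letter l => pairing l τ fun p => w (h p)) =
      ((flipSign τ h : ℤ) : ℂ) • pairing l τ' := by
    funext w
    have hc : h * τ * h⁻¹ = τ' := by
      ext p
      obtain ⟨q, rfl⟩ := h.surjective p
      simp [hh]
    rw [← hc]
    exact pairing_comp hτ h w
  rw [h2, young_smul] at h1
  rw [Submodule.mem_span_singleton]
  refine ⟨((classSign (classOf ν b) (WithTop.some '' W) h : ℤ) : ℂ) * ((flipSign τ h : ℤ) : ℂ), ?_⟩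
  rw [mul_smul, h1, smul_smul]
  rcases Int.units_eq_one_or (classSign (classOf ν b) (WithTop.some '' W) h) with h' | h' <;>
    simp [h']

variable (τ : {M // M ∈ symmetricMultisets Wᶜ ν b ∧ decLength W W M ≤ 2 * l} →
  Equiv.Perm (Fin (∑ i, ν i + b)))

theorem young_pairing_mem_span_range (hτ : ∀ M, Represents ν b (withInfinity Wᶜ M.1) (τ M))
    (ρ : Equiv.Perm (Fin (∑ i, ν i + b))) (hρ : IsMatching ρ) :
    young (classOf ν b) (WithTop.some '' W) (pairing l ρ) ∈ Submodule.span ℂ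
      (Set.range fun M => young (classOf ν b) (WithTop.some '' W) (pairing l (τ M))) := by
  obtain ⟨n, hn⟩ : ∃ n, ∀ ρ : Equiv.Perm (Fin (∑ i, ν i + b)), weight (classOf ν b) ρ ≤ n :=
    ⟨_, fun ρ => Finset.le_sup (f := weight (classOf ν b)) (Finset.mem_univ ρ)⟩
  -- Straightening strictly increases the weight, which is bounded by `n`, so the distance to the
  -- bound is the induction parameter.
  induction hm : n - weight (classOf ν b) ρ using Nat.strong_induction_on generalizing ρ with
  | _ m ih =>
    subst hm
    by_cases had : IsAdmissible (classOf ν b) (WithTop.some '' W) ρ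
    swap
    · rw [young_pairing_eq_zero hρ had]
      exact Submodule.zero_mem _
    obtain ⟨M, hM, hrep⟩ := had.exists_multiset
    by_cases hlen : decLength W W M ≤ 2 * l
    · obtain ⟨h, hs, hh⟩ := hrep.exists_conj (hτ ⟨M, hM, hlen⟩)
      refine Submodule.span_mono ?_ (young_pairing_mem_span_of_conj hρ hs hh)
      exact Set.singleton_subset_iff.mpr ⟨⟨M, hM, hlen⟩, rfl⟩
    · obtain ⟨r, hr⟩ := had.exists_isStandardRank
      obtain ⟨A, hA, hfin, hcard⟩ := (decLength_of_represents hM hrep hr).2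
      refine Submodule.span_le.mpr ?_
        (young_pairing_mem_span (l := l) hρ hr hA hfin (by omega))
      rintro _ ⟨ρ', ⟨hρ', hlt⟩, rfl⟩
      exact ih _ (by have := hn ρ'; omega) ρ' hρ' rfl

theorem linearIndependent_projector (hτ : ∀ M, Represents ν b (withInfinity Wᶜ M.1) (τ M)) :
    LinearIndependent ℂ fun M => projector l W ν b (basicInvariant l _ (τ M)) := by
  have had := fun M => (hτ M).isAdmissible M.2.1
  choose R hR using fun M => (had M).exists_isStandardRank
  refine LinearIndependent.of_comp (coords l (∑ i, ν i + b)).toLinearMap ?_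
  have : ((coords l (∑ i, ν i + b)).toLinearMap ∘ fun M =>
      projector l W ν b (basicInvariant l _ (τ M))) =
      fun M => young (classOf ν b) (WithTop.some '' W) (pairing l (τ M)) :=
    funext fun M => coords_projector_basicInvariant (τ M)
  rw [this]
  refine linearIndependent_young lt_of_classOf_lt τ had R hR (fun M A hA hfin =>
    ((decLength_of_represents M.2.1 (hτ M) (hR M)).1 A hA hfin).trans M.2.2) ?_
  rintro M M' ⟨h, hs, hh⟩
  exact Subtype.ext (eq_of_represents_of_conj (hτ M) (hτ M') hs hh)

theorem span_projector (hτ : ∀ M, Represents ν b (withInfinity Wᶜ M.1) (τ M)) :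
    Submodule.span ℂ (Set.range fun M => projector l W ν b (basicInvariant l _ (τ M))) =
      (invariants l (∑ i, ν i + b)).map (projector l W ν b) := by
  rw [invariants_eq_span, Submodule.map_span]
  apply le_antisymm
  · refine Submodule.span_mono ?_
    rintro _ ⟨M, rfl⟩
    exact ⟨_, ⟨τ M, (represents_iff.mp (hτ M)).1, rfl⟩, rfl⟩
  · refine Submodule.span_le.mpr ?_
    rintro _ ⟨_, ⟨ρ, hρ, rfl⟩, rfl⟩
    have h := young_pairing_mem_span_range τ hτ ρ hρ
    have hrange : (Set.range fun M => young (classOf ν b) (WithTop.some '' W) (pairing l (τ M))) =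
        (coords l (∑ i, ν i + b)).toLinearMap ''
          Set.range fun M => projector l W ν b (basicInvariant l _ (τ M)) := by
      rw [← Set.range_comp]
      exact congrArg Set.range (funext fun M => (coords_projector_basicInvariant (τ M)).symm)
    rw [hrange, ← Submodule.map_span, ← coords_projector_basicInvariant] at h
    obtain ⟨x, hx, hxe⟩ := h
    rwa [← (coords l (∑ i, ν i + b)).injective hxe]

end Basis

end SympInv

theorem theorem8p8 (l b k : ℕ) (ν : Fin k → ℕ) (W : Set (Fin k)) :
    (∀ M ∈ SympInv.symmetricMultisets Wᶜ ν b,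
      ∃ τ, SympInv.Represents ν b (SympInv.withInfinity Wᶜ M) τ) ∧
    ∀ τ : {M // M ∈ SympInv.symmetricMultisets Wᶜ ν b ∧ SympInv.decLength W W M ≤ 2 * l} →
        Equiv.Perm (Fin (∑ i, ν i + b)),
      (∀ M, SympInv.Represents ν b (SympInv.withInfinity Wᶜ M.1) (τ M)) →
      ∃ B : Module.Basis
          {M // M ∈ SympInv.symmetricMultisets Wᶜ ν b ∧ SympInv.decLength W W M ≤ 2 * l} ℂ
          ((SympInv.invariants l (∑ i, ν i + b)).map (SympInv.projector l W ν b)),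
        ∀ M, (B M : SympInv.TensorSpace l (∑ i, ν i + b)) =
          SympInv.projector l W ν b (SympInv.basicInvariant l (∑ i, ν i + b) (τ M)) := by
  refine ⟨fun M hM => SympInv.exists_represents hM, fun τ hτ => ?_⟩
  refine ⟨(Module.Basis.span (SympInv.linearIndependent_projector τ hτ)).map
    (LinearEquiv.ofEq _ _ (SympInv.span_projector τ hτ)), fun M => ?_⟩
  rw [Module.Basis.map_apply, LinearEquiv.coe_ofEq_apply, Module.Basis.span_apply]
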